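/- Let $n\ge m$ be natural numbers and let $X\in\mathbb{R}^{n\times m}$ be a random matrix with independent entries $X_{ij}\sim\mathrm{N}(M_{ij},1)$, where $M\in\mathbb{R}^{n\times m}$ is unknown. Estimators $\hat M(X)$ of $M$ are assessed by the Frobenius loss $$l(M,\hat M)=\|\hat M-M\|_{\mathrm F}^2=\sum_{i=1}^n\sum_{j=1}^m(\hat M_{ij}-M_{ij})^2 .$$ For $p>0$ and $\alpha\ge 0$ let $\pi_{p,\alpha}$ be the (improper) prior on $\mathbb{R}^{n\times m}$ with Lebesgue density $$\pi_{p,\alpha}(M)=\|M\|_p^{-\alpha}=\Big(\sum_{i=1}^m\sigma_i^p\Big)^{-\alpha/p},$$ where $\sigma_1\ge\dots\ge\sigma_m\ge 0$ are the singular values of $M$. A generalized Bayes estimator with respect to a prior $\pi$ is a map $\delta:\mathbb{R}^{n\times m}\to\mathbb{R}^{n\times m}$ such that for every $X$ the posterior $\pi(M\mid X)\propto p(X\mid M)\,\pi(M)$ is a proper probability distribution and $\delta(X)$ minimizes the posterior expected loss $A\mapsto\int l(M,A)\,\pi(M\mid X)\,dM$ over $A\in\mathbb{R}^{n\times m}$.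 An estimator is minimax if it is measurable and its maximal risk $\sup_M \mathrm{E}_M[l(M,\hat M(X))]$ equals the infimum of the maximal risks of all (possibly randomized) estimators. Suppose that either - $p\in[1,2]$ and $\alpha\in\big[0,\;nm-(1-\tfrac p2)m(m+1)-p\big]$, or - $p\in(0,1)$ and $\alpha\in\big[0,\;nm-m(m+1)+(m-1)p\big]$. Then there is exactly one generalized Bayes estimator with respect to $\pi_{p,\alpha}$, and it is minimax under the Frobenius loss. -/

import Mathlib

open MeasureTheory ProbabilityTheory
open scoped ENNReal

/-- Real `n × m` matrices, as families of entries: Mathlib's product Borel structure and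
Lebesgue measure `volume` on `ℝ^{n × m}` are available on this type. -/
abbrev RealMat (n m : ℕ) : Type := Fin n → Fin m → ℝ

/-- The Frobenius loss `l(M, A) = ∑ᵢⱼ (A i j - M i j)²`. -/
noncomputable def frobeniusLoss {n m : ℕ} (M A : RealMat n m) : ℝ≥0∞ :=
  ENNReal.ofReal (∑ i, ∑ j, (A i j - M i j) ^ 2)

/-- The law of a random matrix with independent entries `X i j ∼ N(M i j, 1)`. -/
noncomputable def gaussianMatrixLaw {n m : ℕ} (M : RealMat n m) : Measure (RealMat n m) :=
  Measure.pi fun i => Measure.pi fun j => gaussianReal (M i j) 1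

instance {n m : ℕ} (M : RealMat n m) : IsProbabilityMeasure (gaussianMatrixLaw M) := by
  unfold gaussianMatrixLaw; infer_instance

/-- A finite product of measurably parametrized probability measures depends measurably on
the parameter. -/
theorem measurable_measure_pi {Ω ι : Type*} [MeasurableSpace Ω] [Fintype ι] {β : ι → Type*}
    [∀ i, MeasurableSpace (β i)] {μ : Ω → ∀ i, Measure (β i)}
    [∀ ω i, IsProbabilityMeasure (μ ω i)] (hμ : ∀ i, Measurable fun ω => μ ω i) :
    Measurable fun ω => Measure.pi (μ ω) := by
  refine Measurable.measure_of_isPiSystem_of_isProbabilityMeasure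
    generateFrom_pi.symm isPiSystem_pi ?_
  rintro _ ⟨s, hs, rfl⟩
  simp only [Measure.pi_pi]
  exact Finset.measurable_prod _ fun i _ =>
    (Measure.measurable_coe (hs i (Set.mem_univ i))).comp (hμ i)

theorem measurable_gaussianMatrixLaw (n m : ℕ) :
    Measurable (gaussianMatrixLaw : RealMat n m → Measure (RealMat n m)) := by
  refine measurable_measure_pi fun i => measurable_measure_pi fun j => ?_
  have h : Measurable fun M : RealMat n m => (M i j, (1 : NNReal)) := by fun_prop
  exact measurable_gaussianReal.comp h

/-- The statistical model `M ↦ (law of X given M)` as a Markov kernel. -/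
noncomputable def gaussianMatrixModel (n m : ℕ) : Kernel (RealMat n m) (RealMat n m) :=
  ⟨gaussianMatrixLaw, measurable_gaussianMatrixLaw n m⟩

/-- The likelihood `p(X | M)`, i.e. the Lebesgue density of `gaussianMatrixLaw M` at `X`. -/
noncomputable def gaussianMatrixDensity {n m : ℕ} (M X : RealMat n m) : ℝ≥0∞ :=
  ∏ i, ∏ j, gaussianPDF (M i j) 1 (X i j)

/-- The `i`-th largest singular value of `M` (indices start at `0`). -/
noncomputable def singularValue {n m : ℕ} (M : RealMat n m) (i : Fin m) : ℝ :=
  (Matrix.toEuclideanLin (Matrix.of M)).singularValues i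

/-- The Schatten (quasi-)norm `‖M‖_p = (∑ᵢ σᵢ^p)^{1/p}`. -/
noncomputable def schattenNorm {n m : ℕ} (p : ℝ) (M : RealMat n m) : ℝ :=
  (∑ i, singularValue M i ^ p) ^ (1 / p)

/-- The (improper) prior with Lebesgue density `π_{p,α}(M) = ‖M‖_p^{-α}`. The power is taken in
`[0, ∞]`, so that for `α > 0` the density is `∞` at `M = 0`. -/
noncomputable def schattenPrior (n m : ℕ) (p α : ℝ) : Measure (RealMat n m) :=
  volume.withDensity fun M => ENNReal.ofReal (schattenNorm p M) ^ (-α)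

/-- The formal posterior distribution of `M` given `X` under the prior `π`, with density
`p(X | M) / ∫ p(X | M') π(dM')` with respect to `π`. -/
noncomputable def posteriorLaw {n m : ℕ} (π : Measure (RealMat n m)) (X : RealMat n m) :
    Measure (RealMat n m) :=
  (∫⁻ M, gaussianMatrixDensity M X ∂π)⁻¹ • π.withDensity fun M => gaussianMatrixDensity M X

/-- `δ` is a generalized Bayes estimator for the prior `π` under Frobenius loss: for each
observation `X` the posterior is a genuine probability distribution and `δ X` minimizes the
posterior expected loss. -/
def IsGeneralizedBayes {n m : ℕ} (π : Measure (RealMat n m))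
    (δ : RealMat n m → RealMat n m) : Prop :=
  ∀ X, IsProbabilityMeasure (posteriorLaw π X) ∧
    ∀ A, ∫⁻ M, frobeniusLoss M (δ X) ∂(posteriorLaw π X) ≤
      ∫⁻ M, frobeniusLoss M A ∂(posteriorLaw π X)

/-- `δ` is minimax under Frobenius loss: it is measurable and its maximal risk
`sup_M E_M[l(M, δ(X))]` equals the minimax risk, the infimum of the maximal risk over all
(possibly randomized) estimators. -/
def IsMinimax {n m : ℕ} (δ : RealMat n m → RealMat n m) : Prop :=
  Measurable δ ∧
    ⨆ M, ∫⁻ X, frobeniusLoss M (δ X) ∂(gaussianMatrixModel n m M) =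
      minimaxRisk frobeniusLoss (gaussianMatrixModel n m)

/-! The argument is Stein's. If a prior density F is smooth, positive and superharmonic and m(X) is
its Gaussian average around X, then Stein's identity gives posterior mean X + ∇ log m(X), with risk
nm + 2 E[Δm/m] - E|∇ log m|². Averaging preserves superharmonicity, so the risk is at most nm
(`SmoothSuperharmonic.risk_le`). Conversely, under independent N(0, t) priors the Bayes risk is at
least nm t/(1+t), which tends to nm as t → ∞ (`le_minimaxRisk`). A measurable estimator whose risk
never exceeds nm is therefore minimax.

The Schatten prior is singular, so it is replaced by h ^ (-α/p) with h = tr (MᵀM + ε)^q and q = p/2.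
Such a power is superharmonic once (α/p + 1)|∇h|² ≤ h Δh (`smoothSuperharmonic_rpow_neg`). For q <
1, h is an integral of resolvent traces tr (MᵀM + ε + t)⁻¹, which can be differentiated entry by
entry without differentiating eigenvalues. With s_k = σ_k² + ε and K the divided difference of x ↦
x^q, the result is |∇h|² ≤ 4q² ∑ s_k^(2q-1) and Δh ≥ 2((n-m-1+2q) ∑ K(s_k,s_k) + q ∑_{k≠l}
K(s_k,s_l)) (`sum_regGrad_sq`, `sum_regHess_ge`).

What remains is an inequality between spectral sums, `spectral_ineq`. Chebyshev's sum inequality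
handles the diagonal terms. For q ≥ 1/2 the off-diagonal terms contribute as well, since K(s,u)(s^q
+ u^q) is the divided difference of x^(2q), whose derivative is concave, and the trapezoidal rule
bounds it below. For q < 1/2 they are only known to be nonnegative and are dropped; this is the
origin of the two parameter ranges. The case p = 2 is a direct computation with the Frobenius norm.

Finally ε → 0. Since α < nm, the function ‖M‖^(-α) is locally integrable and dominates every
regularized prior, so the posterior means converge pointwise and Fatou's lemma carries the risk
bound to the limit. Quadratic loss makes the posterior mean the only generalized Bayes estimator
(`isGeneralizedBayes_iff`). -/

/-! ### Gaussian matrices -/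

/-- A product of measures with integrable densities has the product density. -/
theorem pi_withDensity_ofReal {ι : Type*} [Fintype ι] {β : ι → Type*}
    [∀ i, MeasurableSpace (β i)] (ν : ∀ i, Measure (β i)) [∀ i, SigmaFinite (ν i)]
    (f : ∀ i, β i → ℝ) (hf : ∀ i, Integrable (f i) (ν i)) (hf0 : ∀ i x, 0 ≤ f i x)
    [∀ i, SigmaFinite ((ν i).withDensity fun x => ENNReal.ofReal (f i x))] :
    Measure.pi (fun i => (ν i).withDensity fun x => ENNReal.ofReal (f i x)) =
      (Measure.pi ν).withDensity fun x => ENNReal.ofReal (∏ i, f i (x i)) := by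
  refine Measure.pi_eq fun s hs => ?_
  rw [withDensity_apply _ (MeasurableSet.univ_pi hs), Measure.restrict_pi_pi,
    ← ofReal_integral_eq_lintegral_ofReal]
  · rw [integral_fintype_prod_eq_prod, ENNReal.ofReal_prod_of_nonneg
      fun i _ => integral_nonneg (hf0 i)]
    refine Finset.prod_congr rfl fun i _ => ?_
    rw [withDensity_apply _ (hs i),
      ofReal_integral_eq_lintegral_ofReal (hf i).integrableOn (.of_forall (hf0 i))]
  · exact Integrable.fintype_prod_dep fun i => (hf i).integrableOn
  · exact .of_forall fun x => Finset.prod_nonneg fun i _ => hf0 i _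

/-- The matrix Gaussian with independent entries of variance `v` has the product density. -/
theorem pi_gaussianReal_eq_withDensity {n m : ℕ} (M : RealMat n m) {v : NNReal} (hv : v ≠ 0) :
    (Measure.pi fun i => Measure.pi fun j => gaussianReal (M i j) v) =
      (volume : Measure (RealMat n m)).withDensity
        fun X => ENNReal.ofReal (∏ i, ∏ j, gaussianPDFReal (M i j) v (X i j)) := by
  have h1 : ∀ i, (Measure.pi fun j => gaussianReal (M i j) v) =
      (volume : Measure (Fin m → ℝ)).withDensity
        fun x => ENNReal.ofReal (∏ j, gaussianPDFReal (M i j) v (x j)) := by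
    intro i
    have h0 : ∀ j, gaussianReal (M i j) v =
        (volume : Measure ℝ).withDensity fun x => ENNReal.ofReal (gaussianPDFReal (M i j) v x) :=
      fun j => gaussianReal_of_var_ne_zero _ hv
    have : ∀ j, SigmaFinite ((volume : Measure ℝ).withDensity
        fun x => ENNReal.ofReal (gaussianPDFReal (M i j) v x)) := by
      intro j; rw [← h0]; infer_instance
    simp_rw [h0]
    rw [pi_withDensity_ofReal _ _ (fun j => integrable_gaussianPDFReal _ _)
      fun j x => gaussianPDFReal_nonneg _ _ _]
    rfl
  have : ∀ i, SigmaFinite ((volume : Measure (Fin m → ℝ)).withDensity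
        fun x => ENNReal.ofReal (∏ j, gaussianPDFReal (M i j) v (x j))) := by
    intro i; rw [← h1]; infer_instance
  simp_rw [h1]
  exact pi_withDensity_ofReal (fun _ => (volume : Measure (Fin m → ℝ)))
    (fun i x => ∏ j, gaussianPDFReal (M i j) v (x j))
    (fun i => Integrable.fintype_prod fun j => integrable_gaussianPDFReal _ _)
    fun i x => Finset.prod_nonneg fun j _ => gaussianPDFReal_nonneg _ _ _

/-- The real-valued density of `gaussianMatrixLaw M`. -/
noncomputable def gaussDens {n m : ℕ} (M X : RealMat n m) : ℝ :=
  ∏ i, ∏ j, gaussianPDFReal (M i j) 1 (X i j)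

theorem gaussDens_pos {n m : ℕ} (M X : RealMat n m) : 0 < gaussDens M X :=
  Finset.prod_pos fun _ _ => Finset.prod_pos fun _ _ => gaussianPDFReal_pos _ _ _ one_ne_zero

theorem gaussDens_comm {n m : ℕ} (M X : RealMat n m) : gaussDens M X = gaussDens X M := by
  simp only [gaussDens, gaussianPDFReal]
  refine Finset.prod_congr rfl fun i _ => Finset.prod_congr rfl fun j _ => ?_
  rw [← neg_sub, neg_sq]

theorem gaussianMatrixDensity_eq {n m : ℕ} (M X : RealMat n m) :
    gaussianMatrixDensity M X = ENNReal.ofReal (gaussDens M X) := by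
  simp only [gaussianMatrixDensity, gaussDens, gaussianPDF]
  rw [ENNReal.ofReal_prod_of_nonneg
    fun i _ => Finset.prod_nonneg fun j _ => gaussianPDFReal_nonneg _ _ _]
  refine Finset.prod_congr rfl fun i _ => ?_
  rw [ENNReal.ofReal_prod_of_nonneg fun j _ => gaussianPDFReal_nonneg _ _ _]

@[fun_prop]
theorem continuous_gaussianPDFReal (a : ℝ) (v : NNReal) : Continuous (gaussianPDFReal a v) := by
  rw [gaussianPDFReal_def]; fun_prop

theorem continuous_gaussDens {n m : ℕ} (M : RealMat n m) : Continuous (gaussDens M) := by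
  unfold gaussDens; fun_prop

theorem gaussianMatrixLaw_eq_withDensity {n m : ℕ} (M : RealMat n m) :
    gaussianMatrixLaw M = volume.withDensity fun X => ENNReal.ofReal (gaussDens M X) :=
  pi_gaussianReal_eq_withDensity M one_ne_zero

/-- By symmetry of the density, the likelihood of `M` at `X`, as a function of `M`, is the
density of the Gaussian law centred at `X`. -/
theorem withDensity_gaussianMatrixDensity {n m : ℕ} (X : RealMat n m) :
    (volume.withDensity fun M => gaussianMatrixDensity M X) = gaussianMatrixLaw X := by
  rw [gaussianMatrixLaw_eq_withDensity]
  simp_rw [gaussianMatrixDensity_eq, gaussDens_comm]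

theorem gaussianMatrixLaw_map_add {n m : ℕ} (X Y : RealMat n m) :
    (gaussianMatrixLaw X).map (fun Z => Y + Z) = gaussianMatrixLaw (Y + X) := by
  have h : (fun Z : RealMat n m => Y + Z) = fun Z i => (fun z : Fin m → ℝ => Y i + z) (Z i) := rfl
  unfold gaussianMatrixLaw
  have h1 : ∀ i, (Measure.pi fun j => gaussianReal (X i j) 1).map (fun z : Fin m → ℝ => Y i + z) =
      Measure.pi fun j => gaussianReal ((Y + X) i j) 1 := by
    intro i
    have h : (fun z : Fin m → ℝ => Y i + z) = fun z j => (fun t => Y i j + t) (z j) := rfl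
    have : ∀ j, SigmaFinite ((gaussianReal (X i j) 1).map (fun t => Y i j + t)) := by
      intro j; rw [gaussianReal_map_const_add]; infer_instance
    rw [h, Measure.pi_map_pi (fun j => by fun_prop)]
    congr 1; ext1 j
    rw [gaussianReal_map_const_add, add_comm]; rfl
  have : ∀ i, SigmaFinite ((Measure.pi fun j => gaussianReal (X i j) 1).map
      (fun z : Fin m → ℝ => Y i + z)) := by
    intro j; rw [h1]; infer_instance
  rw [h, Measure.pi_map_pi (fun j => by fun_prop)]
  congr 1; ext1 i
  exact h1 i

/-- Translation moves the dependence on `X` from the measure into the integrand, where joint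
measurability and differentiation under the integral apply. -/
theorem integral_gaussianMatrixLaw {n m : ℕ} (X : RealMat n m) (f : RealMat n m → ℝ) :
    ∫ M, f M ∂gaussianMatrixLaw X = ∫ Z, f (X + Z) ∂gaussianMatrixLaw 0 := by
  have h := gaussianMatrixLaw_map_add 0 X
  rw [add_zero] at h
  rw [← h]
  exact (MeasurableEquiv.addLeft X).measurableEmbedding.integral_map f

theorem integrable_gaussianMatrixLaw_iff {n m : ℕ} (X : RealMat n m) (f : RealMat n m → ℝ) :
    Integrable f (gaussianMatrixLaw X) ↔ Integrable (fun M => gaussDens X M * f M) := by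
  rw [gaussianMatrixLaw_eq_withDensity, integrable_withDensity_iff_integrable_smul']
  · simp [ENNReal.toReal_ofReal (gaussDens_pos X _).le]
  · exact (continuous_gaussDens X).measurable.ennreal_ofReal
  · simp

theorem integral_gaussianMatrixLaw_eq_volume {n m : ℕ} (X : RealMat n m) (f : RealMat n m → ℝ) :
    ∫ M, f M ∂gaussianMatrixLaw X = ∫ M, gaussDens X M * f M := by
  rw [gaussianMatrixLaw_eq_withDensity, integral_withDensity_eq_integral_toReal_smul]
  · simp [ENNReal.toReal_ofReal (gaussDens_pos X _).le]
  · exact (continuous_gaussDens X).measurable.ennreal_ofReal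
  · simp

/-- The law of a single entry. -/
theorem measurePreserving_entry {n m : ℕ} (c : Fin n → Fin m → ℝ) (v : NNReal)
    (i : Fin n) (j : Fin m) :
    MeasurePreserving (fun X : RealMat n m => X i j)
      (Measure.pi fun i => Measure.pi fun j => gaussianReal (c i j) v) (gaussianReal (c i j) v) :=
  (measurePreserving_eval (fun j => gaussianReal (c i j) v) j).comp
    (measurePreserving_eval (fun i => Measure.pi fun j => gaussianReal (c i j) v) i)

theorem memLp_entry {n m : ℕ} (X : RealMat n m) (i : Fin n) (j : Fin m) (p : NNReal) :
    MemLp (fun M : RealMat n m => M i j) p (gaussianMatrixLaw X) :=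
  (memLp_id_gaussianReal p).comp_measurePreserving (measurePreserving_entry X 1 i j)

theorem integral_entry_sq {n m : ℕ} (i : Fin n) (j : Fin m) :
    ∫ Z : RealMat n m, Z i j ^ 2 ∂gaussianMatrixLaw 0 = 1 := by
  have h := (measurePreserving_entry (0 : RealMat n m) 1 i j)
  have h2 : ∫ x, x ^ 2 ∂gaussianReal 0 1 = 1 := by
    have := variance_fun_id_gaussianReal (μ := 0) (v := 1)
    rw [variance_eq_integral aemeasurable_id'] at this
    simpa using this
  rw [← h2]
  have h3 := h.map_eq
  simp only [Pi.zero_apply] at h3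
  rw [← h3, integral_map h.measurable.aemeasurable (by fun_prop)]
  rfl

/-- The matrix unit. -/
noncomputable def matUnit {n m : ℕ} (i : Fin n) (j : Fin m) : RealMat n m :=
  Pi.single i (Pi.single j 1)

theorem matUnit_apply {n m : ℕ} (i k : Fin n) (j l : Fin m) :
    matUnit i j k l = if k = i ∧ l = j then 1 else 0 := by
  unfold matUnit
  by_cases hk : k = i
  · subst hk; simp [Pi.single_apply]
  · simp [hk]

theorem hasDerivAt_gaussianPDFReal (a x : ℝ) :
    HasDerivAt (gaussianPDFReal a 1) (-(x - a) * gaussianPDFReal a 1 x) x := by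
  rw [gaussianPDFReal_def]
  have h : HasDerivAt (fun x : ℝ => -(x - a) ^ 2 / (2 * ((1 : NNReal) : ℝ))) (-(x - a)) x := by
    have := ((((hasDerivAt_id x).sub_const a).pow 2).neg.div_const (2 * ((1 : NNReal) : ℝ)))
    convert! this using 1
    simp; ring
  convert! (h.exp.const_mul (√(2 * Real.pi * ((1 : NNReal) : ℝ)))⁻¹) using 1
  ring

theorem hasLineDerivAt_gaussDens {n m : ℕ} (X M : RealMat n m) (i : Fin n) (j : Fin m) :
    HasLineDerivAt ℝ (gaussDens X) (-(M i j - X i j) * gaussDens X M) M (matUnit i j) := by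
  have key : ∀ t : ℝ, gaussDens X (M + t • matUnit i j) =
      gaussianPDFReal (X i j) 1 (M i j + t) * ((∏ l ∈ Finset.univ.erase j,
        gaussianPDFReal (X i l) 1 (M i l)) * ∏ k ∈ Finset.univ.erase i, ∏ l,
        gaussianPDFReal (X k l) 1 (M k l)) := by
    intro t
    rw [gaussDens, ← Finset.mul_prod_erase _ _ (Finset.mem_univ i),
      ← Finset.mul_prod_erase _ _ (Finset.mem_univ j), mul_assoc]
    congr 2
    · simp [matUnit_apply]
    · refine Finset.prod_congr rfl fun l hl => ?_
      simp [matUnit_apply, Finset.ne_of_mem_erase hl]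
    · refine Finset.prod_congr rfl fun k hk => Finset.prod_congr rfl fun l _ => ?_
      simp [matUnit_apply, Finset.ne_of_mem_erase hk]
  have h0 := key 0
  simp only [zero_smul, add_zero] at h0
  unfold HasLineDerivAt
  rw [funext key, h0]
  have h1 : HasDerivAt (fun t : ℝ => gaussianPDFReal (X i j) 1 (M i j + t))
      (-(M i j - X i j) * gaussianPDFReal (X i j) 1 (M i j)) 0 := by
    have := hasDerivAt_gaussianPDFReal (X i j) (M i j + 0)
    simpa using this.comp_const_add (M i j) 0
  rw [← mul_assoc]
  exact h1.mul_const _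

/-- **Stein's identity** for the Gaussian matrix law. -/
theorem integral_sub_mul_gaussianMatrixLaw {n m : ℕ} (X : RealMat n m) (i : Fin n) (j : Fin m)
    {f f' : RealMat n m → ℝ} (hf : ∀ M, HasLineDerivAt ℝ f (f' M) M (matUnit i j))
    (hfm : Measurable f) (hfm' : Measurable f') {C : ℝ} (hC : ∀ M, |f M| ≤ C)
    (hC' : ∀ M, |f' M| ≤ C) :
    ∫ M, (M i j - X i j) * f M ∂gaussianMatrixLaw X = ∫ M, f' M ∂gaussianMatrixLaw X := by
  have i1 : Integrable f (gaussianMatrixLaw X) :=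
    .of_bound hfm.aestronglyMeasurable C (.of_forall hC)
  have i2 : Integrable f' (gaussianMatrixLaw X) :=
    .of_bound hfm'.aestronglyMeasurable C (.of_forall hC')
  have i0 : Integrable (fun M : RealMat n m => M i j - X i j) (gaussianMatrixLaw X) :=
    (memLp_one_iff_integrable.1 (by simpa using memLp_entry X i j 1)).sub (integrable_const _)
  have i3 : Integrable (fun M : RealMat n m => (M i j - X i j) * f M) (gaussianMatrixLaw X) :=
    i0.mul_bdd hfm.aestronglyMeasurable (.of_forall hC)
  rw [integrable_gaussianMatrixLaw_iff] at i1 i2 i3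
  -- Integration by parts along the matrix unit: differentiating the density produces the factor
  -- `-(M i j - X i j)`.
  have := integral_bilinear_hasLineDerivAt_right_eq_neg_left_of_integrable
    (μ := (volume : Measure (RealMat n m))) (B := ContinuousLinearMap.mul ℝ ℝ)
    (f := gaussDens X) (f' := fun M => -(M i j - X i j) * gaussDens X M) (g := f) (g' := f')
    (v := matUnit i j) (i3.neg.congr (.of_forall fun M => by simp; ring))
    (by simpa using i2) (by simpa using i1)
    (fun M _ => hasLineDerivAt_gaussDens X M i j) (fun M _ => hf M)
  simp only [ContinuousLinearMap.mul_apply'] at this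
  rw [integral_gaussianMatrixLaw_eq_volume, integral_gaussianMatrixLaw_eq_volume, this,
    ← integral_neg]
  congr 1; ext M; ring

/-! ### Risk of the Bayes estimator for a smooth superharmonic prior -/

/-- The Gaussian average of `f` around `X`. -/
noncomputable def gaussAvg {n m : ℕ} (f : RealMat n m → ℝ) (X : RealMat n m) : ℝ :=
  ∫ M, f M ∂gaussianMatrixLaw X

/-- The posterior mean for the prior with Lebesgue density `F`. -/
noncomputable def posteriorMean {n m : ℕ} (F : RealMat n m → ℝ) (X : RealMat n m) : RealMat n m :=
  fun i j => gaussAvg (fun M => M i j * F M) X / gaussAvg F X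

theorem measurable_gaussAvg {n m : ℕ} {f : RealMat n m → ℝ} (hf : Measurable f) :
    Measurable (gaussAvg f) := by
  have h : gaussAvg f = fun X => ∫ Z, f (X + Z) ∂gaussianMatrixLaw 0 :=
    funext fun X => integral_gaussianMatrixLaw X f
  rw [h]
  exact (StronglyMeasurable.integral_prod_right (f := fun X Z : RealMat n m => f (X + Z))
    (hf.comp (measurable_fst.add measurable_snd)).stronglyMeasurable).measurable

theorem integrable_of_abs_le {n m : ℕ} {f : RealMat n m → ℝ} (hf : Measurable f) {C : ℝ}
    (hC : ∀ M, |f M| ≤ C) (X : RealMat n m) : Integrable f (gaussianMatrixLaw X) :=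
  .of_bound hf.aestronglyMeasurable C (.of_forall hC)

theorem HasLineDerivAt.hasDerivAt_line {n m : ℕ} {f f' : RealMat n m → ℝ} {v : RealMat n m}
    (hf : ∀ M, HasLineDerivAt ℝ f (f' M) M v) (M : RealMat n m) (t : ℝ) :
    HasDerivAt (fun s : ℝ => f (M + s • v)) (f' (M + t • v)) t := by
  have h := hf (M + t • v)
  unfold HasLineDerivAt at h
  have h2 : (fun s : ℝ => f (M + s • v)) = fun s => (fun r : ℝ => f (M + t • v + r • v)) (s - t) := by
    ext s; congr 1; rw [add_assoc, ← add_smul]; congr 2; ring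
  rw [h2]
  have h3 : HasDerivAt (fun r : ℝ => f (M + t • v + r • v)) (f' (M + t • v)) (t - t) := by
    rwa [sub_self]
  exact h3.comp_sub_const t t

/-- After recentring at 0 the derivative falls on the integrand, and the constant `C` is an
integrable majorant because the Gaussian law is finite. -/
theorem hasLineDerivAt_gaussAvg {n m : ℕ} {f f' : RealMat n m → ℝ} {v : RealMat n m}
    (hf : ∀ M, HasLineDerivAt ℝ f (f' M) M v) (hfm : Measurable f) (hfm' : Measurable f')
    {C : ℝ} (hC : ∀ M, |f M| ≤ C) (hC' : ∀ M, |f' M| ≤ C) (X : RealMat n m) :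
    HasLineDerivAt ℝ (gaussAvg f) (gaussAvg f' X) X v := by
  unfold HasLineDerivAt gaussAvg
  simp_rw [integral_gaussianMatrixLaw _ f, integral_gaussianMatrixLaw _ f']
  have := (hasDerivAt_integral_of_dominated_loc_of_deriv_le (μ := gaussianMatrixLaw (0 : RealMat n m))
    (F := fun (t : ℝ) Z => f (X + t • v + Z)) (F' := fun t Z => f' (X + t • v + Z)) (x₀ := 0)
    (s := Set.univ) (bound := fun _ => C) Filter.univ_mem
    (.of_forall fun t => (hfm.comp (measurable_const_add _)).aestronglyMeasurable)
    (.of_bound (hfm.comp (measurable_const_add _)).aestronglyMeasurable C (.of_forall fun _ => hC _))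
    (hfm'.comp (measurable_const_add _)).aestronglyMeasurable (.of_forall fun _ _ _ => hC' _)
    (integrable_const C) (.of_forall fun Z t _ => ?_)).2
  · simpa using this
  · have := HasLineDerivAt.hasDerivAt_line hf (X + Z) t
    simpa [add_assoc, add_comm, add_left_comm] using this

/-- A positive bounded `C²` superharmonic function whose partial derivatives of order one and two
are bounded by multiples of the function. -/
structure SmoothSuperharmonic {n m : ℕ} (F : RealMat n m → ℝ)
    (F1 F2 : Fin n → Fin m → RealMat n m → ℝ) (C : ℝ) : Prop where
  meas : Measurable F
  meas1 : ∀ i j, Measurable (F1 i j)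
  meas2 : ∀ i j, Measurable (F2 i j)
  pos : ∀ M, 0 < F M
  le : ∀ M, F M ≤ C
  deriv1 : ∀ i j M, HasLineDerivAt ℝ F (F1 i j M) M (matUnit i j)
  deriv2 : ∀ i j M, HasLineDerivAt ℝ (F1 i j) (F2 i j M) M (matUnit i j)
  bound1 : ∀ i j M, |F1 i j M| ≤ C * F M
  bound2 : ∀ i j M, |F2 i j M| ≤ C * F M
  laplacian : ∀ M, ∑ i, ∑ j, F2 i j M ≤ 0

namespace SmoothSuperharmonic

variable {n m : ℕ} {F : RealMat n m → ℝ} {F1 F2 : Fin n → Fin m → RealMat n m → ℝ} {C : ℝ}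

theorem const_pos (h : SmoothSuperharmonic F F1 F2 C) : 0 < C := (h.pos 0).trans_le (h.le 0)

theorem abs_le (h : SmoothSuperharmonic F F1 F2 C) (M : RealMat n m) : |F M| ≤ C + C * C := by
  rw [abs_of_pos (h.pos M)]; nlinarith [h.le M, h.const_pos]

theorem abs_le_of_bound (h : SmoothSuperharmonic F F1 F2 C) {x : ℝ} {M : RealMat n m}
    (hx : |x| ≤ C * F M) : |x| ≤ C + C * C := by
  nlinarith [h.le M, h.const_pos]

theorem integrable (h : SmoothSuperharmonic F F1 F2 C) (X : RealMat n m) :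
    Integrable F (gaussianMatrixLaw X) := integrable_of_abs_le h.meas h.abs_le X

theorem gaussAvg_pos (h : SmoothSuperharmonic F F1 F2 C) (X : RealMat n m) :
    0 < gaussAvg F X :=
  (integral_pos_iff_support_of_nonneg (fun M => (h.pos M).le) (h.integrable X)).2 (by
    have : Function.support F = Set.univ := Set.eq_univ_of_forall fun M => (h.pos M).ne'
    rw [this]; simp)

/-- Bounds relative to `F`, unlike absolute ones, survive division by the average of `F`. They make
the score and its derivative bounded, which supplies every integrability condition in Stein's
identity. -/
theorem abs_gaussAvg_le (h : SmoothSuperharmonic F F1 F2 C) {G : RealMat n m → ℝ}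
    (hG : ∀ M, |G M| ≤ C * F M) (X : RealMat n m) : |gaussAvg G X| ≤ C * gaussAvg F X := by
  unfold gaussAvg
  rw [← integral_const_mul]
  exact norm_integral_le_of_norm_le (f := G) ((h.integrable X).const_mul C) (.of_forall fun M => hG M)

/-- Stein's identity at centre `X` trades the factor `M i j - X i j` in the numerator for a
derivative of `F`. The correction to `X` is thus the logarithmic gradient of the averaged prior. -/
theorem posteriorMean_eq (h : SmoothSuperharmonic F F1 F2 C) (X : RealMat n m) (i : Fin n)
    (j : Fin m) : posteriorMean F X i j = X i j + gaussAvg (F1 i j) X / gaussAvg F X := by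
  have hs := integral_sub_mul_gaussianMatrixLaw X i j (h.deriv1 i j) h.meas (h.meas1 i j)
    h.abs_le (fun M => h.abs_le_of_bound (h.bound1 i j M))
  have i0 : Integrable (fun M : RealMat n m => M i j) (gaussianMatrixLaw X) :=
    memLp_one_iff_integrable.1 (by simpa using memLp_entry X i j 1)
  simp_rw [sub_mul] at hs
  rw [integral_sub (i0.mul_bdd h.meas.aestronglyMeasurable (.of_forall h.abs_le))
    ((h.integrable X).const_mul _), integral_const_mul] at hs
  have hp := (h.gaussAvg_pos X).ne'
  unfold posteriorMean
  field_simp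
  unfold gaussAvg at *
  linarith

/-- The score `∇ log` of the Gaussian average. -/
theorem score_bound (h : SmoothSuperharmonic F F1 F2 C) {G : RealMat n m → ℝ}
    (hG : ∀ M, |G M| ≤ C * F M) (X : RealMat n m) : |gaussAvg G X / gaussAvg F X| ≤ C := by
  rw [abs_div, abs_of_pos (h.gaussAvg_pos X), div_le_iff₀ (h.gaussAvg_pos X)]
  exact h.abs_gaussAvg_le hG X

theorem hasLineDerivAt_score (h : SmoothSuperharmonic F F1 F2 C) (X : RealMat n m) (i : Fin n)
    (j : Fin m) : HasLineDerivAt ℝ (fun X => gaussAvg (F1 i j) X / gaussAvg F X)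
      (gaussAvg (F2 i j) X / gaussAvg F X - (gaussAvg (F1 i j) X / gaussAvg F X) ^ 2) X
      (matUnit i j) := by
  have h1 := hasLineDerivAt_gaussAvg (h.deriv1 i j) h.meas (h.meas1 i j)
    h.abs_le (fun M => h.abs_le_of_bound (h.bound1 i j M)) X
  have h2 := hasLineDerivAt_gaussAvg (h.deriv2 i j) (h.meas1 i j) (h.meas2 i j)
    (fun M => h.abs_le_of_bound (h.bound1 i j M)) (fun M => h.abs_le_of_bound (h.bound2 i j M)) X
  unfold HasLineDerivAt at *
  have hp := (h.gaussAvg_pos X).ne'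
  convert! h2.div h1 (by simpa using hp) using 1
  simp only [zero_smul, add_zero]
  field_simp

/-- **Stein's theorem**: the Bayes estimator for a superharmonic prior has risk at most `nm`. -/
theorem risk_le (h : SmoothSuperharmonic F F1 F2 C) (M : RealMat n m) :
    ∫⁻ X, frobeniusLoss M (posteriorMean F X) ∂gaussianMatrixLaw M ≤ n * m := by
  set g : Fin n → Fin m → RealMat n m → ℝ := fun i j X => gaussAvg (F1 i j) X / gaussAvg F X
  set l : Fin n → Fin m → RealMat n m → ℝ := fun i j X => gaussAvg (F2 i j) X / gaussAvg F X
  have hg : ∀ i j X, |g i j X| ≤ C := fun i j X => h.score_bound (h.bound1 i j) X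
  have hl : ∀ i j X, |l i j X| ≤ C := fun i j X => h.score_bound (h.bound2 i j) X
  have hgm : ∀ i j, Measurable (g i j) := fun i j =>
    (measurable_gaussAvg (h.meas1 i j)).div (measurable_gaussAvg h.meas)
  have hlm : ∀ i j, Measurable (l i j) := fun i j =>
    (measurable_gaussAvg (h.meas2 i j)).div (measurable_gaussAvg h.meas)
  have hgi : ∀ i j, Integrable (g i j) (gaussianMatrixLaw M) := fun i j =>
    integrable_of_abs_le (hgm i j) (hg i j) M
  have hli : ∀ i j, Integrable (l i j) (gaussianMatrixLaw M) := fun i j =>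
    integrable_of_abs_le (hlm i j) (hl i j) M
  have hg2 : ∀ i j X, |g i j X ^ 2| ≤ C ^ 2 := fun i j X => by
    rw [abs_pow]; exact pow_le_pow_left₀ (abs_nonneg _) (hg i j X) 2
  have hg2i : ∀ i j, Integrable (fun X => g i j X ^ 2) (gaussianMatrixLaw M) := fun i j =>
    integrable_of_abs_le ((hgm i j).pow_const 2) (hg2 i j) M
  have i0 : ∀ i j, Integrable (fun X : RealMat n m => X i j - M i j) (gaussianMatrixLaw M) :=
    fun i j => (memLp_one_iff_integrable.1 (by simpa using memLp_entry M i j 1)).sub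
      (integrable_const _)
  have i2 : ∀ i j, Integrable (fun X : RealMat n m => (X i j - M i j) ^ 2)
      (gaussianMatrixLaw M) :=
    fun i j => (((memLp_entry M i j 2).sub (memLp_const _)).integrable_sq)
  have i1 : ∀ i j, Integrable (fun X : RealMat n m => (X i j - M i j) * g i j X)
      (gaussianMatrixLaw M) :=
    fun i j => (i0 i j).mul_bdd (hgm i j).aestronglyMeasurable (.of_forall (hg i j))
  have hstein : ∀ i j, ∫ X, (X i j - M i j) * g i j X ∂gaussianMatrixLaw M =
      ∫ X, l i j X ∂gaussianMatrixLaw M - ∫ X, g i j X ^ 2 ∂gaussianMatrixLaw M := by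
    intro i j
    rw [← integral_sub (hli i j) (hg2i i j)]
    refine integral_sub_mul_gaussianMatrixLaw M i j (fun X => h.hasLineDerivAt_score X i j)
      (hgm i j) ((hlm i j).sub ((hgm i j).pow_const 2)) (C := C + C ^ 2)
      (fun X => (hg i j X).trans (by nlinarith)) (fun X => ?_)
    exact (abs_sub _ _).trans (add_le_add (hl i j X) (hg2 i j X))
  have hsq : ∀ i j, ∫ X, (X i j - M i j) ^ 2 ∂gaussianMatrixLaw M = 1 := by
    intro i j
    rw [integral_gaussianMatrixLaw]
    simp [integral_entry_sq]
  have hi : ∀ i j, Integrable (fun X => (posteriorMean F X i j - M i j) ^ 2)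
      (gaussianMatrixLaw M) ∧ ∫ X, (posteriorMean F X i j - M i j) ^ 2 ∂gaussianMatrixLaw M ≤
        1 + 2 * ∫ X, l i j X ∂gaussianMatrixLaw M := by
    intro i j
    have he : ∀ X, (posteriorMean F X i j - M i j) ^ 2 =
        (X i j - M i j) ^ 2 + 2 * ((X i j - M i j) * g i j X) + g i j X ^ 2 := by
      intro X; rw [h.posteriorMean_eq]; simp only [g]; ring
    simp_rw [he]
    refine ⟨((i2 i j).add ((i1 i j).const_mul 2)).add (hg2i i j), ?_⟩
    have i12 : Integrable (fun X => (X i j - M i j) ^ 2 + 2 * ((X i j - M i j) * g i j X))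
      (gaussianMatrixLaw M) := (i2 i j).add ((i1 i j).const_mul 2)
    rw [integral_add i12 (hg2i i j), integral_add (i2 i j) ((i1 i j).const_mul 2),
      integral_const_mul, hstein, hsq]
    -- Stein's identity contributes -2 E g² and the square +E g²; the net term -E g² is discarded.
    have : 0 ≤ ∫ X, g i j X ^ 2 ∂gaussianMatrixLaw M := integral_nonneg fun X => sq_nonneg _
    linarith
  unfold frobeniusLoss
  rw [← ofReal_integral_eq_lintegral_ofReal
    (integrable_finsetSum _ fun i _ => integrable_finsetSum _ fun j _ => (hi i j).1)
    (.of_forall fun X => Finset.sum_nonneg fun i _ => Finset.sum_nonneg fun j _ => sq_nonneg _)]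
  rw [show (n * m : ℝ≥0∞) = ENNReal.ofReal (n * m) by
    rw [ENNReal.ofReal_mul (by positivity)]; simp]
  refine ENNReal.ofReal_le_ofReal ?_
  rw [integral_finsetSum _ fun i _ => integrable_finsetSum _ fun j _ => (hi i j).1]
  simp_rw [integral_finsetSum _ fun j _ => (hi _ j).1]
  calc ∑ i, ∑ j, ∫ X, (posteriorMean F X i j - M i j) ^ 2 ∂gaussianMatrixLaw M
      ≤ ∑ i : Fin n, ∑ j : Fin m, (1 + 2 * ∫ X, l i j X ∂gaussianMatrixLaw M) :=
        Finset.sum_le_sum fun i _ => Finset.sum_le_sum fun j _ => (hi i j).2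
    _ = n * m + 2 * ∫ X, ∑ i, ∑ j, l i j X ∂gaussianMatrixLaw M := by
        rw [integral_finsetSum _ fun i _ => integrable_finsetSum _ fun j _ => hli i j]
        simp_rw [integral_finsetSum _ fun j _ => hli _ j]
        simp [Finset.sum_add_distrib, Finset.mul_sum]
    _ ≤ n * m + 2 * 0 := by
        gcongr
        refine integral_nonpos fun X => ?_
        have hb : ∀ i j, Integrable (F2 i j) (gaussianMatrixLaw X) := fun i j =>
          integrable_of_abs_le (h.meas2 i j) (fun M => h.abs_le_of_bound (h.bound2 i j M)) X
        -- Averaging commutes with the Laplacian, so the sign of the Laplacian of `F` passes to the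
        -- averaged function.
        have : ∑ i, ∑ j, l i j X = (∫ M, ∑ i, ∑ j, F2 i j M ∂gaussianMatrixLaw X) /
            gaussAvg F X := by
          rw [integral_finsetSum _ fun i _ => integrable_finsetSum _ fun j _ => hb i j]
          simp_rw [integral_finsetSum _ fun j _ => hb _ j, Finset.sum_div]
          rfl
        simp only [this, Pi.zero_apply]
        exact div_nonpos_of_nonpos_of_nonneg (integral_nonpos h.laplacian) (h.gaussAvg_pos X).le
    _ = n * m := by ring

end SmoothSuperharmonic

/-! ### The minimax risk is at least `nm` -/

theorem le_integral_sub_sq_gaussianReal (c y : ℝ) (v : NNReal) :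
    v ≤ ∫ x, (y - x) ^ 2 ∂gaussianReal c v := by
  have h := variance_le_expectation_sq (μ := gaussianReal c v) (X := fun x => y - x)
    (by fun_prop)
  rw [variance_const_sub (by fun_prop), variance_fun_id_gaussianReal] at h
  exact h

/-- Bayes' formula for a normal prior with mean zero and a normal likelihood. -/
theorem gaussianPDFReal_mul_eq (t : NNReal) (ht : 0 < t) (x y : ℝ) :
    gaussianPDFReal 0 t x * gaussianPDFReal x 1 y =
      gaussianPDFReal 0 (1 + t) y * gaussianPDFReal ((t / (1 + t) : NNReal) * y) (t / (1 + t)) x := by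
  have h0 : (0 : ℝ) < t := ht
  simp only [gaussianPDFReal, NNReal.coe_one, NNReal.coe_add, NNReal.coe_div, sub_zero, mul_one]
  rw [mul_mul_mul_comm, mul_mul_mul_comm (√(2 * Real.pi * (1 + t)))⁻¹, ← Real.exp_add,
    ← Real.exp_add, ← mul_inv, ← mul_inv, ← Real.sqrt_mul (by positivity),
    ← Real.sqrt_mul (by positivity)]
  congr 1
  · congr 2
    field_simp
  · congr 1
    field_simp
    ring

theorem measurable_frobeniusLoss {n m : ℕ} :
    Measurable (Function.uncurry (frobeniusLoss (n := n) (m := m))) := by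
  simp only [Function.uncurry_def, frobeniusLoss]
  fun_prop

/-- A second moment about any point is at least the variance, so each of the nm entries costs at
least `v`, whatever the action `A` and the centre `c`. -/
theorem le_lintegral_frobeniusLoss {n m : ℕ} (c A : RealMat n m) (v : NNReal) :
    ENNReal.ofReal (n * m * v) ≤ ∫⁻ M, frobeniusLoss M A
      ∂(Measure.pi fun i => Measure.pi fun j => gaussianReal (c i j) v) := by
  set μ : Measure (RealMat n m) := Measure.pi fun i => Measure.pi fun j => gaussianReal (c i j) v
  have hi : ∀ i j, Integrable (fun M : RealMat n m => (A i j - M i j) ^ 2) μ := by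
    intro i j
    have h2 : MemLp (fun x : ℝ => x) 2 (gaussianReal (c i j) v) := memLp_id_gaussianReal 2
    exact ((memLp_const (A i j)).sub
      (h2.comp_measurePreserving (measurePreserving_entry c v i j))).integrable_sq
  unfold frobeniusLoss
  rw [← ofReal_integral_eq_lintegral_ofReal
    (integrable_finsetSum _ fun i _ => integrable_finsetSum _ fun j _ => hi i j)
    (.of_forall fun X => Finset.sum_nonneg fun i _ => Finset.sum_nonneg fun j _ => sq_nonneg _)]
  refine ENNReal.ofReal_le_ofReal ?_
  rw [integral_finsetSum _ fun i _ => integrable_finsetSum _ fun j _ => hi i j]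
  simp_rw [integral_finsetSum _ fun j _ => hi _ j]
  calc (n * m * v : ℝ) = ∑ i : Fin n, ∑ j : Fin m, (v : ℝ) := by simp [mul_assoc]
    _ ≤ _ := Finset.sum_le_sum fun i _ => Finset.sum_le_sum fun j _ => by
        have h := measurePreserving_entry c v i j
        have h3 : ∫ M, (A i j - M i j) ^ 2 ∂μ = ∫ x, (A i j - x) ^ 2 ∂gaussianReal (c i j) v := by
          rw [← h.map_eq, integral_map h.measurable.aemeasurable (by fun_prop)]
        rw [h3]
        exact le_integral_sub_sq_gaussianReal _ _ _

/-! ### Average risk under a centred Gaussian prior -/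

/-- The density of a Gaussian matrix with independent entries of variance `v`. -/
noncomputable def gaussDensVar {n m : ℕ} (v : NNReal) (M X : RealMat n m) : ℝ :=
  ∏ i, ∏ j, gaussianPDFReal (M i j) v (X i j)

theorem gaussDensVar_nonneg {n m : ℕ} (v : NNReal) (M X : RealMat n m) :
    0 ≤ gaussDensVar v M X :=
  Finset.prod_nonneg fun _ _ => Finset.prod_nonneg fun _ _ => gaussianPDFReal_nonneg _ _ _

theorem measurable_gaussDensVar {n m : ℕ} (v : NNReal) :
    Measurable (Function.uncurry (gaussDensVar (n := n) (m := m) v)) := by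
  simp only [Function.uncurry_def, gaussDensVar, gaussianPDFReal]; fun_prop

theorem measurable_gaussDensVar_right {n m : ℕ} (v : NNReal) (M : RealMat n m) :
    Measurable (gaussDensVar v M) :=
  (measurable_gaussDensVar v).of_uncurry_left

theorem gaussDensVar_mul_eq {n m : ℕ} (t : NNReal) (ht : 0 < t) (M X : RealMat n m) :
    gaussDensVar t 0 M * gaussDensVar 1 M X =
      gaussDensVar (1 + t) 0 X *
        gaussDensVar (t / (1 + t)) (fun i j => (t / (1 + t) : NNReal) * X i j) M := by
  simp only [gaussDensVar, ← Finset.prod_mul_distrib]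
  exact Finset.prod_congr rfl fun i _ => Finset.prod_congr rfl fun j _ =>
    gaussianPDFReal_mul_eq t ht _ _

theorem lintegral_gaussDensVar {n m : ℕ} {v : NNReal} (hv : v ≠ 0) (M : RealMat n m)
    {f : RealMat n m → ℝ≥0∞} (hf : Measurable f) :
    ∫⁻ X, f X ∂(Measure.pi fun i => Measure.pi fun j => gaussianReal (M i j) v) =
      ∫⁻ X, ENNReal.ofReal (gaussDensVar v M X) * f X := by
  rw [pi_gaussianReal_eq_withDensity M hv]
  exact lintegral_withDensity_eq_lintegral_mul _
    (measurable_gaussDensVar_right v M).ennreal_ofReal hf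

/-- The expected loss of a randomized estimate at the parameter `M` and observation `X`. -/
noncomputable def condLoss {n m : ℕ} (κ : Kernel (RealMat n m) (RealMat n m))
    (M X : RealMat n m) : ℝ≥0∞ := ∫⁻ A, frobeniusLoss M A ∂κ X

theorem measurable_condLoss {n m : ℕ} (κ : Kernel (RealMat n m) (RealMat n m)) [IsMarkovKernel κ] :
    Measurable (Function.uncurry (condLoss κ)) := by
  have h : Measurable (Function.uncurry fun (p : RealMat n m × RealMat n m) A =>
      frobeniusLoss p.1 A) := by
    simp only [Function.uncurry_def, frobeniusLoss]
    fun_prop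
  exact Measurable.lintegral_kernel_prod_right (κ := κ.comap Prod.snd measurable_snd) h

theorem measurable_condLoss_right {n m : ℕ} (κ : Kernel (RealMat n m) (RealMat n m))
    [IsMarkovKernel κ] (M : RealMat n m) : Measurable (condLoss κ M) :=
  (measurable_condLoss κ).of_uncurry_left

theorem measurable_condLoss_left {n m : ℕ} (κ : Kernel (RealMat n m) (RealMat n m))
    [IsMarkovKernel κ] (X : RealMat n m) : Measurable fun M => condLoss κ M X :=
  (measurable_condLoss κ).of_uncurry_right

theorem avgRisk_eq {n m : ℕ} (t : NNReal) (ht : 0 < t) (κ : Kernel (RealMat n m) (RealMat n m))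
    [IsMarkovKernel κ] :
    avgRisk frobeniusLoss (gaussianMatrixModel n m) κ
        (Measure.pi fun _ => Measure.pi fun _ => gaussianReal 0 t) =
      ∫⁻ M, ∫⁻ X, ENNReal.ofReal (gaussDensVar t 0 M * gaussDensVar 1 M X) * condLoss κ M X := by
  have h1 : ∀ M, ∫⁻ A, frobeniusLoss M A ∂((κ ∘ₖ gaussianMatrixModel n m) M) =
      ∫⁻ X, ENNReal.ofReal (gaussDensVar 1 M X) * condLoss κ M X := by
    intro M
    rw [Kernel.lintegral_comp _ _ _ measurable_frobeniusLoss.of_uncurry_left]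
    exact lintegral_gaussDensVar one_ne_zero M (measurable_condLoss_right κ M)
  unfold avgRisk
  simp_rw [h1]
  have hm : Measurable (Function.uncurry fun M X : RealMat n m =>
      ENNReal.ofReal (gaussDensVar 1 M X) * condLoss κ M X) :=
    (measurable_gaussDensVar 1).ennreal_ofReal.mul (measurable_condLoss κ)
  refine (lintegral_gaussDensVar ht.ne' (0 : RealMat n m) hm.lintegral_prod_right).trans ?_
  refine lintegral_congr fun M => ?_
  rw [← lintegral_const_mul]
  · refine lintegral_congr fun X => ?_
    rw [ENNReal.ofReal_mul (gaussDensVar_nonneg _ _ _), mul_assoc]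
  · exact hm.of_uncurry_left

/-- By conjugacy, M given X is Gaussian with entry variance t/(1+t), whatever X is. No action,
random or not, can then have posterior loss below nm t/(1+t), and integrating over the marginal N(0,
1+t) of X keeps this constant. -/
theorem le_avgRisk {n m : ℕ} (t : NNReal) (ht : 0 < t) (κ : Kernel (RealMat n m) (RealMat n m))
    [IsMarkovKernel κ] :
    ENNReal.ofReal (n * m * (t / (1 + t) : NNReal)) ≤
      avgRisk frobeniusLoss (gaussianMatrixModel n m) κ
        (Measure.pi fun _ => Measure.pi fun _ => gaussianReal 0 t) := by
  set v : NNReal := t / (1 + t) with hv_def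
  have hv : v ≠ 0 := by positivity
  have ht1 : 1 + t ≠ 0 := by positivity
  have hm : Measurable (Function.uncurry fun M X : RealMat n m =>
      ENNReal.ofReal (gaussDensVar t 0 M * gaussDensVar 1 M X) * condLoss κ M X) :=
    (((measurable_gaussDensVar_right t 0).comp measurable_fst).mul
      (measurable_gaussDensVar 1)).ennreal_ofReal.mul (measurable_condLoss κ)
  rw [avgRisk_eq t ht κ, lintegral_lintegral_swap hm.aemeasurable]
  calc ENNReal.ofReal (n * m * v)
      = ∫⁻ X : RealMat n m, ENNReal.ofReal (gaussDensVar (1 + t) 0 X) *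
          ENNReal.ofReal (n * m * v) := by
        rw [← lintegral_gaussDensVar ht1 (0 : RealMat n m) measurable_const]
        simp
    _ ≤ _ := lintegral_mono fun X => ?_
  have h2 : ∫⁻ M, ENNReal.ofReal (gaussDensVar t 0 M * gaussDensVar 1 M X) * condLoss κ M X =
      ENNReal.ofReal (gaussDensVar (1 + t) 0 X) *
        ∫⁻ M, condLoss κ M X
          ∂(Measure.pi fun i => Measure.pi fun j => gaussianReal (v * X i j) v) := by
    rw [lintegral_gaussDensVar hv (fun i j => v * X i j) (measurable_condLoss_left κ X)]
    refine Eq.trans ?_ (lintegral_const_mul _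
      ((measurable_gaussDensVar_right v (fun i j => v * X i j)).ennreal_ofReal.mul
        (measurable_condLoss_left κ X)))
    refine lintegral_congr fun M => ?_
    rw [gaussDensVar_mul_eq t ht, ENNReal.ofReal_mul (gaussDensVar_nonneg _ _ _), mul_assoc]
  rw [h2]
  gcongr
  unfold condLoss
  rw [lintegral_lintegral_swap measurable_frobeniusLoss.aemeasurable]
  calc ENNReal.ofReal (n * m * v) = ∫⁻ _, ENNReal.ofReal (n * m * v) ∂κ X := by simp
    _ ≤ _ := lintegral_mono fun A => le_lintegral_frobeniusLoss _ A v

/-- Centred Gaussian priors of variance k are least favourable in the limit: their Bayes risks are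
at least nm k/(k+1), and the minimax risk dominates each of them. -/
theorem le_minimaxRisk (n m : ℕ) :
    (n * m : ℝ≥0∞) ≤ minimaxRisk frobeniusLoss (gaussianMatrixModel n m) := by
  have h1 : ∀ k : ℕ, ENNReal.ofReal (n * m * ((k : ℝ) / (k + 1))) ≤
      minimaxRisk frobeniusLoss (gaussianMatrixModel n m) := by
    intro k
    rcases Nat.eq_zero_or_pos k with rfl | hk
    · simp
    refine le_trans ?_ (bayesRisk_le_minimaxRisk frobeniusLoss (gaussianMatrixModel n m)
      (Measure.pi fun _ => Measure.pi fun _ => gaussianReal 0 (k : NNReal)))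
    refine le_iInf₂ fun κ hκ => ?_
    have := le_avgRisk (k : NNReal) (by exact_mod_cast hk) κ
    rwa [NNReal.coe_div, NNReal.coe_add, NNReal.coe_one, NNReal.coe_natCast, add_comm] at this
  have h2 : Filter.Tendsto (fun k : ℕ => ENNReal.ofReal (n * m * ((k : ℝ) / (k + 1))))
      Filter.atTop (nhds (ENNReal.ofReal (n * m * 1))) :=
    ENNReal.tendsto_ofReal ((tendsto_natCast_div_add_atTop (1 : ℝ)).const_mul _)
  have h3 := le_of_tendsto' h2 h1
  rwa [mul_one, ENNReal.ofReal_mul (by positivity), ENNReal.ofReal_natCast,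
    ENNReal.ofReal_natCast] at h3

/-! ### Negative powers -/

/-- If `h` is bounded below, has bounded second derivatives and `(β + 1) |∇h|² ≤ h Δh`, then
`h ^ (-β)` is smooth and superharmonic. -/
theorem smoothSuperharmonic_rpow_neg {n m : ℕ} {h : RealMat n m → ℝ}
    {h1 h2 : Fin n → Fin m → RealMat n m → ℝ} {β c K : ℝ} (hβ : 0 ≤ β) (hc : 0 < c)
    (hm : Measurable h) (hm1 : ∀ i j, Measurable (h1 i j)) (hm2 : ∀ i j, Measurable (h2 i j))
    (hh : ∀ M, c ≤ h M) (hd1 : ∀ i j M, HasLineDerivAt ℝ h (h1 i j M) M (matUnit i j))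
    (hd2 : ∀ i j M, HasLineDerivAt ℝ (h1 i j) (h2 i j M) M (matUnit i j))
    (hK : ∀ i j M, |h2 i j M| ≤ K)
    (hlap : ∀ M, (β + 1) * ∑ i, ∑ j, h1 i j M ^ 2 ≤ h M * ∑ i, ∑ j, h2 i j M) :
    ∃ F1 F2 C, SmoothSuperharmonic (fun M => h M ^ (-β)) F1 F2 C := by
  have h0 : ∀ M, 0 < h M := fun M => hc.trans_le (hh M)
  set F : RealMat n m → ℝ := fun M => h M ^ (-β) with hF
  have hF0 : ∀ M, 0 < F M := fun M => Real.rpow_pos_of_pos (h0 M) _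
  have hKn : ∀ i : Fin n, ∀ j : Fin m, 0 ≤ K := fun i j => (abs_nonneg _).trans (hK i j 0)
  set L : ℝ := n * m * K / c with hL
  have hw : ∀ i j M, |h2 i j M / h M| ≤ K / c := by
    intro i j M
    rw [abs_div, abs_of_pos (h0 M)]
    exact div_le_div₀ (hKn i j) (hK i j M) hc (hh M)
  have hu : ∀ i j M, (h1 i j M / h M) ^ 2 ≤ L := by
    intro i j M
    have e1 : h1 i j M ^ 2 ≤ ∑ i, ∑ j, h1 i j M ^ 2 :=
      (Finset.single_le_sum (f := fun j => h1 i j M ^ 2) (fun j _ => sq_nonneg _)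
        (Finset.mem_univ j)).trans
      (Finset.single_le_sum (f := fun i => ∑ j, h1 i j M ^ 2)
        (fun i _ => Finset.sum_nonneg fun j _ => sq_nonneg _) (Finset.mem_univ i))
    have e2 : ∑ i, ∑ j, h2 i j M ≤ n * m * K := by
      calc ∑ i, ∑ j, h2 i j M ≤ ∑ i : Fin n, ∑ j : Fin m, K :=
            Finset.sum_le_sum fun i _ => Finset.sum_le_sum fun j _ => (le_abs_self _).trans (hK i j M)
        _ = n * m * K := by simp [mul_assoc]
    -- The differential inequality itself controls the gradient: since β ≥ 0, |∇h|² ≤ h Δh, and Δh ≤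
    -- nmK. No separate bound on first derivatives is needed.
    have e3 : h1 i j M ^ 2 ≤ h M * (n * m * K) := by
      have : 0 ≤ ∑ i, ∑ j, h1 i j M ^ 2 :=
        Finset.sum_nonneg fun i _ => Finset.sum_nonneg fun j _ => sq_nonneg _
      nlinarith [hlap M, mul_le_mul_of_nonneg_left e2 (h0 M).le]
    have hn := hKn i j
    rw [div_pow, div_le_iff₀ (pow_pos (h0 M) 2), hL, div_mul_eq_mul_div, le_div_iff₀ hc]
    calc h1 i j M ^ 2 * c ≤ h M * (n * m * K) * h M :=
          mul_le_mul e3 (hh M) hc.le (mul_nonneg (h0 M).le (by positivity))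
      _ = n * m * K * h M ^ 2 := by ring
  have habs : ∀ {x : ℝ}, x ^ 2 ≤ L → |x| ≤ 1 + L := fun {x} hx => by
    rw [← sq_abs] at hx; nlinarith [sq_nonneg (|x| - 1)]
  -- The three summands bound F, |F1|/F and |F2|/F respectively; adding them gives one constant for
  -- all three.
  set C : ℝ := c ^ (-β) + β * (1 + |L|) + β * (|K| / c + (β + 1) * |L|) with hC
  have hC1 : 0 ≤ c ^ (-β) := Real.rpow_nonneg hc.le _
  have hC2 : 0 ≤ β * (1 + |L|) := by positivity
  have hC3 : 0 ≤ β * (|K| / c + (β + 1) * |L|) := by positivity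
  have dF : ∀ i j M, HasLineDerivAt ℝ F (-β * (F M * (h1 i j M / h M))) M (matUnit i j) := by
    intro i j M
    have hd := hd1 i j M
    unfold HasLineDerivAt at *
    have h00 : h (M + (0 : ℝ) • matUnit i j) = h M := by simp
    convert! hd.rpow_const (p := -β) (Or.inl (by rw [h00]; exact (h0 M).ne')) using 1
    rw [h00, Real.rpow_sub_one (h0 M).ne']
    simp only [hF]; ring
  refine ⟨fun i j M => -β * (F M * (h1 i j M / h M)),
    fun i j M => -β * (F M * (h2 i j M / h M - (β + 1) * (h1 i j M / h M) ^ 2)), C, ?_⟩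
  refine ⟨hm.pow_const _, fun i j => ?_, fun i j => ?_, hF0, fun M => ?_, dF, fun i j M => ?_,
    fun i j M => ?_, fun i j M => ?_, fun M => ?_⟩
  · exact ((hm.pow_const _).mul ((hm1 i j).div hm)).const_mul _
  · exact ((hm.pow_const _).mul (((hm2 i j).div hm).sub
      ((((hm1 i j).div hm).pow_const 2).const_mul _))).const_mul _
  · have : F M ≤ c ^ (-β) := Real.rpow_le_rpow_of_nonpos hc (hh M) (by linarith)
    linarith
  · have hdF := dF i j M
    have e1 := hd1 i j M
    have e2 := hd2 i j M
    unfold HasLineDerivAt at *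
    have h00 : h (M + (0 : ℝ) • matUnit i j) = h M := by simp
    convert! (hdF.mul (e2.div e1 (by rw [h00]; exact (h0 M).ne'))).const_mul (-β) using 1
    simp only [zero_smul, add_zero, Pi.div_apply]
    have := (h0 M).ne'
    field_simp
    ring
  · rw [abs_mul, abs_neg, abs_of_nonneg hβ, abs_mul, abs_of_pos (hF0 M)]
    have := (habs (hu i j M)).trans (by gcongr; exact le_abs_self L : 1 + L ≤ 1 + |L|)
    calc β * (F M * |h1 i j M / h M|) ≤ β * (F M * (1 + |L|)) := by
          have := hF0 M; gcongr
      _ = β * (1 + |L|) * F M := by ring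
      _ ≤ C * F M := by have := hF0 M; gcongr; linarith
  · rw [abs_mul, abs_neg, abs_of_nonneg hβ, abs_mul, abs_of_pos (hF0 M)]
    have e : |h2 i j M / h M - (β + 1) * (h1 i j M / h M) ^ 2| ≤ |K| / c + (β + 1) * |L| := by
      refine (abs_sub _ _).trans (add_le_add ((hw i j M).trans ?_) ?_)
      · gcongr; exact le_abs_self K
      · rw [abs_of_nonneg (by positivity)]
        have := (hu i j M).trans (le_abs_self L)
        gcongr
    calc β * (F M * |h2 i j M / h M - (β + 1) * (h1 i j M / h M) ^ 2|)
        ≤ β * (F M * (|K| / c + (β + 1) * |L|)) := by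
          have := hF0 M; gcongr
      _ = β * (|K| / c + (β + 1) * |L|) * F M := by ring
      _ ≤ C * F M := by have := hF0 M; gcongr; linarith
  -- The Laplacian of h^(-β) is -β h^(-β-2) (h Δh - (β+1)|∇h|²).
  · have e : ∑ i, ∑ j, -β * (F M * (h2 i j M / h M - (β + 1) * (h1 i j M / h M) ^ 2)) =
        -β * F M / h M ^ 2 * (h M * ∑ i, ∑ j, h2 i j M - (β + 1) * ∑ i, ∑ j, h1 i j M ^ 2) := by
      simp only [Finset.mul_sum, ← Finset.sum_sub_distrib]
      refine Finset.sum_congr rfl fun i _ => Finset.sum_congr rfl fun j _ => ?_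
      have := (h0 M).ne'
      field_simp
    rw [e]
    refine mul_nonpos_of_nonpos_of_nonneg ?_ (sub_nonneg.2 (hlap M))
    have := hF0 M
    have := h0 M
    rw [neg_mul, neg_div]
    exact neg_nonpos.2 (by positivity)

/-! ### The resolvent of the Gram matrix -/

open Matrix in
/-- The resolvent `(MᵀM + μ)⁻¹`. -/
noncomputable def gramRes {n m : ℕ} (μ : ℝ) (M : RealMat n m) : Matrix (Fin m) (Fin m) ℝ :=
  ((Matrix.of M)ᵀ * Matrix.of M + μ • 1)⁻¹

namespace gramRes
open Matrix

variable {n m : ℕ} {μ : ℝ}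

theorem posDef (hμ : 0 < μ) (M : RealMat n m) :
    ((of M)ᵀ * of M + μ • (1 : Matrix (Fin m) (Fin m) ℝ)).PosDef := by
  have h1 : ((of M)ᵀ * of M).PosSemidef := by
    rw [← conjTranspose_eq_transpose_of_trivial]
    exact posSemidef_conjTranspose_mul_self (of M)
  exact PosDef.posSemidef_add h1 (PosDef.one.smul hμ)

theorem mul_self (hμ : 0 < μ) (M : RealMat n m) :
    gramRes μ M * ((of M)ᵀ * of M + μ • 1) = 1 :=
  nonsing_inv_mul _ ((isUnit_iff_isUnit_det _).1 (posDef hμ M).isUnit)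

theorem self_mul (hμ : 0 < μ) (M : RealMat n m) :
    ((of M)ᵀ * of M + μ • 1) * gramRes μ M = 1 :=
  mul_nonsing_inv _ ((isUnit_iff_isUnit_det _).1 (posDef hμ M).isUnit)

theorem transpose (μ : ℝ) (M : RealMat n m) : (gramRes μ M)ᵀ = gramRes μ M := by
  unfold gramRes
  rw [transpose_nonsing_inv]
  simp [transpose_mul]

theorem symm (μ : ℝ) (M : RealMat n m) (k l : Fin m) : gramRes μ M k l = gramRes μ M l k := by
  conv_lhs => rw [← transpose μ M]
  rfl

/-- `R = NᵀN + μR²` with `N = MR`. -/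
theorem eq_add (hμ : 0 < μ) (M : RealMat n m) :
    gramRes μ M = (of M * gramRes μ M)ᵀ * (of M * gramRes μ M) +
      μ • (gramRes μ M * gramRes μ M) := by
  have h : gramRes μ M = gramRes μ M * ((of M)ᵀ * of M + μ • 1) * gramRes μ M := by
    rw [mul_self hμ, Matrix.one_mul]
  rw [transpose_mul, transpose]
  conv_lhs => rw [h]
  simp only [Matrix.mul_add, Matrix.add_mul, Matrix.mul_assoc, Matrix.mul_smul, Matrix.smul_mul,
    Matrix.one_mul]

/-- `P = P² + μNNᵀ` with `P = MRMᵀ`, `N = MR`. -/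
theorem proj_eq_add (hμ : 0 < μ) (M : RealMat n m) :
    of M * gramRes μ M * (of M)ᵀ = (of M * gramRes μ M * (of M)ᵀ) * (of M * gramRes μ M * (of M)ᵀ)ᵀ
      + μ • ((of M * gramRes μ M) * (of M * gramRes μ M)ᵀ) := by
  have h : gramRes μ M = gramRes μ M * ((of M)ᵀ * of M + μ • 1) * gramRes μ M := by
    rw [mul_self hμ, Matrix.one_mul]
  simp only [transpose_mul, transpose, transpose_transpose]
  conv_lhs => rw [h]
  simp only [Matrix.mul_add, Matrix.add_mul, Matrix.mul_assoc, Matrix.mul_smul, Matrix.smul_mul,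
    Matrix.one_mul]

/-! ### Entrywise bounds for the resolvent -/

theorem diag_eq (hμ : 0 < μ) (M : RealMat n m) (j : Fin m) :
    gramRes μ M j j = ∑ i, (of M * gramRes μ M) i j ^ 2 + μ * ∑ k, gramRes μ M j k ^ 2 := by
  conv_lhs => rw [eq_add hμ M]
  simp only [Matrix.add_apply, Matrix.smul_apply, smul_eq_mul, mul_apply (M := (of M * gramRes μ M)ᵀ),
    transpose_apply]
  congr 1
  · exact Finset.sum_congr rfl fun i _ => by ring
  · rw [mul_apply]
    congr 1
    exact Finset.sum_congr rfl fun k _ => by rw [symm μ M k j]; ring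

theorem proj_diag_eq (hμ : 0 < μ) (M : RealMat n m) (i : Fin n) :
    (of M * gramRes μ M * (of M)ᵀ) i i = ∑ k, (of M * gramRes μ M * (of M)ᵀ) i k ^ 2 +
      μ * ∑ k, (of M * gramRes μ M) i k ^ 2 := by
  conv_lhs => rw [proj_eq_add hμ M]
  rw [Matrix.add_apply, Matrix.smul_apply, smul_eq_mul, mul_apply, mul_apply]
  simp only [transpose_apply, sq]

theorem sum_sq_nonneg {ι : Type*} [Fintype ι] (f : ι → ℝ) : 0 ≤ ∑ k, f k ^ 2 :=
  Finset.sum_nonneg fun _ _ => sq_nonneg _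

theorem sq_le_sum {ι : Type*} [Fintype ι] (f : ι → ℝ) (k : ι) : f k ^ 2 ≤ ∑ k, f k ^ 2 :=
  Finset.single_le_sum (f := fun k => f k ^ 2) (fun _ _ => sq_nonneg _) (Finset.mem_univ k)

theorem diag_nonneg (hμ : 0 < μ) (M : RealMat n m) (j : Fin m) : 0 ≤ gramRes μ M j j := by
  rw [diag_eq hμ]
  have := sum_sq_nonneg fun i => (of M * gramRes μ M) i j
  have := sum_sq_nonneg fun k => gramRes μ M j k
  positivity

/-- All terms in `diag_eq` are nonnegative, so R_jj ≥ μ R_jj², which forces μ R_jj ≤ 1. -/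
theorem diag_le (hμ : 0 < μ) (M : RealMat n m) (j : Fin m) : gramRes μ M j j ≤ 1 / μ := by
  have h := diag_eq hμ M j
  have h1 := sum_sq_nonneg fun i => (of M * gramRes μ M) i j
  have h2 := mul_le_mul_of_nonneg_left (sq_le_sum (fun k => gramRes μ M j k) j) hμ.le
  have h0 := diag_nonneg hμ M j
  rw [le_div_iff₀ hμ]
  by_contra hcon
  push Not at hcon
  have h3 : 0 < gramRes μ M j j := by
    rcases h0.eq_or_lt with h | h
    · rw [← h] at hcon; linarith
    · exact h
  nlinarith

theorem sum_sq_le (hμ : 0 < μ) (M : RealMat n m) (j : Fin m) :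
    ∑ k, gramRes μ M j k ^ 2 ≤ 1 / μ ^ 2 := by
  have h := diag_eq hμ M j
  have h1 := sum_sq_nonneg fun i => (of M * gramRes μ M) i j
  have h2 := diag_le hμ M j
  have h3 : μ * ∑ k, gramRes μ M j k ^ 2 ≤ 1 / μ := by linarith
  rw [le_div_iff₀ (by positivity)]
  rw [le_div_iff₀ hμ] at h3
  nlinarith

theorem left_sq_le (hμ : 0 < μ) (M : RealMat n m) (i : Fin n) (j : Fin m) :
    (of M * gramRes μ M) i j ^ 2 ≤ 1 / μ := by
  have h := diag_eq hμ M j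
  have h1 := sq_le_sum (fun i => (of M * gramRes μ M) i j) i
  have h2 := mul_nonneg hμ.le (sum_sq_nonneg fun k => gramRes μ M j k)
  linarith [diag_le hμ M j]

theorem proj_nonneg (hμ : 0 < μ) (M : RealMat n m) (i : Fin n) :
    0 ≤ (of M * gramRes μ M * (of M)ᵀ) i i := by
  rw [proj_diag_eq hμ]
  have := sum_sq_nonneg fun k => (of M * gramRes μ M * (of M)ᵀ) i k
  have := sum_sq_nonneg fun k => (of M * gramRes μ M) i k
  positivity

/-- From `proj_diag_eq`, P_ii ≥ P_ii² for P = MRMᵀ. -/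
theorem proj_le (hμ : 0 < μ) (M : RealMat n m) (i : Fin n) :
    (of M * gramRes μ M * (of M)ᵀ) i i ≤ 1 := by
  have h := proj_diag_eq hμ M i
  have h1 := sq_le_sum (fun k => (of M * gramRes μ M * (of M)ᵀ) i k) i
  have h2 := mul_nonneg hμ.le (sum_sq_nonneg fun k => (of M * gramRes μ M) i k)
  nlinarith [proj_nonneg hμ M i]

theorem left_sum_sq_le (hμ : 0 < μ) (M : RealMat n m) (i : Fin n) :
    ∑ k, (of M * gramRes μ M) i k ^ 2 ≤ 1 / μ := by
  have h := proj_diag_eq hμ M i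
  have h1 := sum_sq_nonneg (fun k => (of M * gramRes μ M * (of M)ᵀ) i k)
  have h2 := proj_le hμ M i
  rw [le_div_iff₀ hμ]
  nlinarith

theorem sq_apply (M : RealMat n m) (k l : Fin m) :
    (gramRes μ M * gramRes μ M) k l = ∑ r, gramRes μ M k r * gramRes μ M l r := by
  rw [mul_apply]
  exact Finset.sum_congr rfl fun r _ => by rw [symm μ M r l]

theorem abs_sq_apply_le (hμ : 0 < μ) (M : RealMat n m) (k l : Fin m) :
    |(gramRes μ M * gramRes μ M) k l| ≤ 1 / μ ^ 2 := by
  rw [sq_apply]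
  have h := Finset.sum_mul_sq_le_sq_mul_sq Finset.univ (gramRes μ M k) (gramRes μ M l)
  have h1 := sum_sq_le hμ M k
  have h2 := sum_sq_le hμ M l
  refine abs_le_of_sq_le_sq ?_ (by positivity)
  exact h.trans (by rw [sq (1 / μ ^ 2)]; exact mul_le_mul h1 h2 (sum_sq_nonneg _) (by positivity))

theorem left_mul_sq_le (hμ : 0 < μ) (M : RealMat n m) (i : Fin n) (j : Fin m) :
    (of M * gramRes μ M * gramRes μ M) i j ^ 2 ≤ 1 / μ ^ 3 := by
  rw [mul_apply]
  have h := Finset.sum_mul_sq_le_sq_mul_sq Finset.univ ((of M * gramRes μ M) i)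
    (fun k => gramRes μ M k j)
  have h1 := left_sum_sq_le hμ M i
  have h2 := sum_sq_le hμ M j
  simp_rw [symm μ M j] at h2
  refine h.trans ((mul_le_mul h1 h2 (sum_sq_nonneg _) (by positivity)).trans (le_of_eq ?_))
  field_simp

/-- `left_mul_sq_le` is uniform in `M` but decays only like μ^(-3/2), which is not integrable
against t^q at infinity when q ≥ 1/2. Allowing linear growth in `M` gains the decay μ^(-2),
integrable for every q < 1. -/
theorem abs_left_mul_le (hμ : 0 < μ) (M : RealMat n m) (i : Fin n) (j : Fin m) :
    |(of M * gramRes μ M * gramRes μ M) i j| ≤ (∑ k, |M i k|) * (1 / μ ^ 2) := by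
  rw [Matrix.mul_assoc, mul_apply, Finset.sum_mul]
  refine (Finset.abs_sum_le_sum_abs _ _).trans (Finset.sum_le_sum fun k _ => ?_)
  rw [abs_mul]
  exact mul_le_mul_of_nonneg_left (abs_sq_apply_le hμ M k j) (abs_nonneg _)

/-- The second derivative of `-½ tr R` along the `(i, j)` entry. -/
noncomputable def second (μ : ℝ) (M : RealMat n m) (i : Fin n) (j : Fin m) : ℝ :=
  (gramRes μ M * gramRes μ M) j j * (1 - (of M * gramRes μ M * (of M)ᵀ) i i)
    - 2 * ((of M * gramRes μ M) i j * (of M * gramRes μ M * gramRes μ M) i j)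
    - (∑ k, (of M * gramRes μ M) i k ^ 2) * gramRes μ M j j

/-- Each of the three products has size at most μ^(-2), and their coefficients 1, 2, 1 add up to 4.
The bound is uniform in `M`, which later gives the bounded second derivatives that
`smoothSuperharmonic_rpow_neg` requires. -/
theorem abs_second_le (hμ : 0 < μ) (M : RealMat n m) (i : Fin n) (j : Fin m) :
    |second μ M i j| ≤ 4 * (1 / μ ^ 2) := by
  have a1 := abs_sq_apply_le hμ M j j
  have a2 := proj_nonneg hμ M i
  have a3 := proj_le hμ M i
  have a4 := left_sum_sq_le hμ M i
  have a5 := diag_le hμ M j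
  have a6 := diag_nonneg hμ M j
  have a7 := sum_sq_nonneg fun k => (of M * gramRes μ M) i k
  have t1 : |(gramRes μ M * gramRes μ M) j j * (1 - (of M * gramRes μ M * (of M)ᵀ) i i)| ≤
      1 / μ ^ 2 := by
    rw [abs_mul]
    calc _ ≤ 1 / μ ^ 2 * 1 := mul_le_mul a1 (by rw [abs_of_nonneg] <;> linarith) (abs_nonneg _)
          (by positivity)
      _ = _ := mul_one _
  have t2 : |(of M * gramRes μ M) i j * (of M * gramRes μ M * gramRes μ M) i j| ≤ 1 / μ ^ 2 := by
    refine abs_le_of_sq_le_sq ?_ (by positivity)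
    rw [mul_pow]
    refine (mul_le_mul (left_sq_le hμ M i j) (left_mul_sq_le hμ M i j) (sq_nonneg _)
      (by positivity)).trans (le_of_eq ?_)
    field_simp
  have t3 : |(∑ k, (of M * gramRes μ M) i k ^ 2) * gramRes μ M j j| ≤ 1 / μ ^ 2 := by
    rw [abs_of_nonneg (mul_nonneg a7 a6)]
    refine (mul_le_mul a4 a5 a6 (by positivity)).trans (le_of_eq ?_)
    field_simp
  unfold second
  rw [abs_le] at *
  constructor <;> linarith

/-! ### First derivatives of the resolvent -/

section Derivative
attribute [local instance] Matrix.linftyOpNormedRing Matrix.linftyOpNormedAlgebra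

theorem hasLineDerivAt_apply (hμ : 0 < μ) (M : RealMat n m) (i : Fin n) (j k l : Fin m) :
    HasLineDerivAt ℝ (fun M => gramRes μ M k l)
      (-(gramRes μ M k j * (of M * gramRes μ M) i l + (of M * gramRes μ M) i k * gramRes μ M j l))
      M (matUnit i j) := by
  set E : Matrix (Fin n) (Fin m) ℝ := of (matUnit i j) with hE
  set G : ℝ → Matrix (Fin m) (Fin m) ℝ := fun t =>
    (of (M + t • matUnit i j))ᵀ * of (M + t • matUnit i j) + μ • 1 with hG
  -- Along a line the shifted Gram matrix is a quadratic polynomial in the step, and only its linear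
  -- coefficient enters the derivative -R G'(0) R.
  have hGe : ∀ t, G t = ((of M)ᵀ * of M + μ • 1) + t • (Eᵀ * of M + (of M)ᵀ * E) +
      (t ^ 2) • (Eᵀ * E) := by
    intro t
    have : of (M + t • matUnit i j) = of M + t • E := rfl
    simp only [hG, this, transpose_add, transpose_smul, Matrix.mul_add, Matrix.add_mul,
      Matrix.mul_smul, Matrix.smul_mul, smul_smul, smul_add, sq]
    abel
  have hGd : HasDerivAt G (Eᵀ * of M + (of M)ᵀ * E) 0 := by
    rw [funext hGe]
    have := (((hasDerivAt_id (0 : ℝ)).smul_const (Eᵀ * of M + (of M)ᵀ * E)).const_add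
      ((of M)ᵀ * of M + μ • (1 : Matrix (Fin m) (Fin m) ℝ))).add
      (((hasDerivAt_id (0 : ℝ)).pow 2).smul_const (Eᵀ * E))
    convert! this using 1
    simp
  let U : (Matrix (Fin m) (Fin m) ℝ)ˣ :=
    ⟨(of M)ᵀ * of M + μ • 1, gramRes μ M, self_mul hμ M, mul_self hμ M⟩
  have hU : G 0 = U := by rw [hGe]; simp [U]
  have h1 : HasDerivAt (fun t => Ring.inverse (G t))
      (-(gramRes μ M * (Eᵀ * of M + (of M)ᵀ * E) * gramRes μ M)) 0 := by
    have h := hasFDerivAt_ringInverse (𝕜 := ℝ) U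
    rw [← hU] at h
    refine (h.comp_hasDerivAt (0 : ℝ) hGd).congr_deriv ?_
    change -(((U⁻¹ : (Matrix (Fin m) (Fin m) ℝ)ˣ) : Matrix (Fin m) (Fin m) ℝ) * _ * _) = _
    rfl
  have h2 := ((Matrix.entryLinearMap ℝ ℝ k l).toContinuousLinearMap.hasFDerivAt
    (x := Ring.inverse (G 0))).comp_hasDerivAt (0 : ℝ) h1
  unfold HasLineDerivAt
  convert! h2 using 1
  · ext t
    simp [gramRes, hG, nonsing_inv_eq_ringInverse]
  · have e1 : ∀ B : Matrix (Fin m) (Fin m) ℝ, ∀ D : Matrix (Fin n) (Fin m) ℝ,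
        (B * Eᵀ * D) k l = B k j * D i l := by
      intro B D
      simp [mul_apply, hE, matUnit_apply, ite_and]
    have e2 : gramRes μ M * (Eᵀ * of M + (of M)ᵀ * E) * gramRes μ M =
        gramRes μ M * Eᵀ * (of M * gramRes μ M) +
          ((of M * gramRes μ M)ᵀ * E) * gramRes μ M := by
      rw [transpose_mul, transpose]
      simp only [Matrix.mul_add, Matrix.add_mul, Matrix.mul_assoc]
    have e3 : ∀ B : Matrix (Fin n) (Fin m) ℝ, ∀ D : Matrix (Fin m) (Fin m) ℝ,
        (Bᵀ * E * D) k l = B i k * D j l := by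
      intro B D
      simp [mul_apply, hE, matUnit_apply, ite_and]
    change _ = (-(gramRes μ M * (Eᵀ * of M + (of M)ᵀ * E) * gramRes μ M)) k l
    rw [e2, Matrix.neg_apply, Matrix.add_apply, e1, e3]

end Derivative

end gramRes

/-! ### Diagonalization of the Gram matrix -/

section Spectral
open Matrix

theorem singularValue_nonneg {n m : ℕ} (M : RealMat n m) (k : Fin m) : 0 ≤ singularValue M k :=
  LinearMap.singularValues_nonneg _ _

/-- The spectral theorem for `MᵀM` in terms of the singular values of `M`. -/
theorem exists_gram_eq {n m : ℕ} (M : RealMat n m) :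
    ∃ U : Matrix (Fin m) (Fin m) ℝ, Uᵀ * U = 1 ∧ U * Uᵀ = 1 ∧
      (of M)ᵀ * of M = U * diagonal (fun k => singularValue M k ^ 2) * Uᵀ := by
  set T := toEuclideanLin (of M) with hT
  have hn : Module.finrank ℝ (EuclideanSpace ℝ (Fin m)) = m := by simp
  set b := T.isSymmetric_adjoint_comp_self.eigenvectorBasis hn
  set U : Matrix (Fin m) (Fin m) ℝ := of fun j k => b k j with hU
  have h1 : Uᵀ * U = 1 := by
    ext k l
    have := orthonormal_iff_ite.1 b.orthonormal l k
    rw [PiLp.inner_apply] at this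
    simp only [mul_apply, hU, transpose_apply, of_apply, one_apply]
    simpa [eq_comm] using this
  have h2 : U * Uᵀ = 1 := mul_eq_one_comm.1 h1
  refine ⟨U, h1, h2, ?_⟩
  -- The eigenvector equations, read column by column.
  have h3 : (of M)ᵀ * of M * U = U * diagonal (fun k => singularValue M k ^ 2) := by
    ext j k
    have h := T.isSymmetric_adjoint_comp_self.apply_eigenvectorBasis hn k
    rw [← T.sq_singularValues_fin hn k] at h
    replace h : LinearMap.adjoint T (T (b k)) = (T.singularValues k ^ 2) • b k := h
    have hadj : LinearMap.adjoint T = toEuclideanLin (of M)ᵀ := by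
      rw [hT, ← toEuclideanLin_conjTranspose_eq_adjoint, conjTranspose_eq_transpose_of_trivial]
    rw [hadj] at h
    have h' := congrArg (fun v : EuclideanSpace ℝ (Fin m) => v j) h
    simp only [hT, toLpLin_apply, PiLp.smul_apply] at h'
    rw [mul_diagonal, Matrix.mul_assoc, mul_comm]
    simpa [hU, mul_apply, mulVec, dotProduct, singularValue] using h'
  rw [← h3, Matrix.mul_assoc, h2, Matrix.mul_one]

/-! ### Traces of resolvent products in terms of eigenvalues -/

namespace gramRes

variable {n m : ℕ} {M : RealMat n m} {U : Matrix (Fin m) (Fin m) ℝ} {x : Fin m → ℝ}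

theorem eq_diagonal (hU : Uᵀ * U = 1) (hU' : U * Uᵀ = 1)
    (hG : (of M)ᵀ * of M = U * diagonal x * Uᵀ) {μ : ℝ} (hx : ∀ k, x k + μ ≠ 0) :
    gramRes μ M = U * diagonal (fun k => (x k + μ)⁻¹) * Uᵀ := by
  unfold gramRes
  refine inv_eq_left_inv ?_
  have h1 : (of M)ᵀ * of M + μ • 1 = U * diagonal (fun k => x k + μ) * Uᵀ := by
    have : diagonal (fun k => x k + μ) = diagonal x + μ • (1 : Matrix (Fin m) (Fin m) ℝ) := by
      rw [← diagonal_one, ← diagonal_smul, diagonal_add]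
      simp
    rw [this, hG, Matrix.mul_add, Matrix.add_mul, Matrix.mul_smul, Matrix.smul_mul, Matrix.mul_one,
      hU']
  rw [h1]
  calc U * diagonal (fun k => (x k + μ)⁻¹) * Uᵀ * (U * diagonal (fun k => x k + μ) * Uᵀ)
      = U * diagonal (fun k => (x k + μ)⁻¹) * (Uᵀ * U) * diagonal (fun k => x k + μ) * Uᵀ := by
        simp only [Matrix.mul_assoc]
    _ = U * (diagonal (fun k => (x k + μ)⁻¹) * diagonal (fun k => x k + μ)) * Uᵀ := by
        rw [hU, Matrix.mul_one]; simp only [Matrix.mul_assoc]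
    _ = 1 := by
        rw [diagonal_mul_diagonal]
        simp [inv_mul_cancel₀ (hx _), hU']

theorem trace_conj (hU : Uᵀ * U = 1) (d : Fin m → ℝ) :
    trace (U * diagonal d * Uᵀ) = ∑ k, d k := by
  rw [trace_mul_comm, ← Matrix.mul_assoc, hU, Matrix.one_mul, trace_diagonal]

theorem conj_mul_conj (hU : Uᵀ * U = 1) (d e : Fin m → ℝ) :
    (U * diagonal d * Uᵀ) * (U * diagonal e * Uᵀ) = U * diagonal (fun k => d k * e k) * Uᵀ := by
  calc (U * diagonal d * Uᵀ) * (U * diagonal e * Uᵀ)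
      = U * diagonal d * (Uᵀ * U) * diagonal e * Uᵀ := by simp only [Matrix.mul_assoc]
    _ = U * (diagonal d * diagonal e) * Uᵀ := by
        rw [hU, Matrix.mul_one]; simp only [Matrix.mul_assoc]
    _ = _ := by rw [diagonal_mul_diagonal]

theorem sum_sq_eq_trace {a b : ℕ} (B : Matrix (Fin a) (Fin b) ℝ) :
    ∑ i, ∑ j, B i j ^ 2 = trace (Bᵀ * B) := by
  rw [Finset.sum_comm]
  simp [trace, mul_apply, sq]

/-- Sums of second derivatives in terms of eigenvalues. -/
theorem sum_second (hU : Uᵀ * U = 1) (hU' : U * Uᵀ = 1)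
    (hG : (of M)ᵀ * of M = U * diagonal x * Uᵀ) {μ : ℝ} (hx : ∀ k, x k + μ ≠ 0) :
    ∑ i, ∑ j, second μ M i j = n * ∑ k, (x k + μ)⁻¹ ^ 2
      - (∑ k, x k * (x k + μ)⁻¹) * ∑ k, (x k + μ)⁻¹ ^ 2
      - 2 * ∑ k, x k * (x k + μ)⁻¹ ^ 3
      - (∑ k, x k * (x k + μ)⁻¹ ^ 2) * ∑ k, (x k + μ)⁻¹ := by
  have hR := eq_diagonal hU hU' hG hx
  set r : Fin m → ℝ := fun k => (x k + μ)⁻¹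
  have hRt : (gramRes μ M)ᵀ = gramRes μ M := transpose μ M
  have tR : trace (gramRes μ M) = ∑ k, r k := by rw [hR, trace_conj hU]
  have tR2 : trace (gramRes μ M * gramRes μ M) = ∑ k, r k ^ 2 := by
    rw [hR, conj_mul_conj hU, trace_conj hU]
    simp [sq]
  have tP : trace (of M * gramRes μ M * (of M)ᵀ) = ∑ k, x k * r k := by
    rw [trace_mul_comm, ← Matrix.mul_assoc, hG, hR, conj_mul_conj hU, trace_conj hU]
  have tN : trace ((of M * gramRes μ M)ᵀ * (of M * gramRes μ M)) = ∑ k, x k * r k ^ 2 := by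
    have : (of M * gramRes μ M)ᵀ * (of M * gramRes μ M) =
        gramRes μ M * ((of M)ᵀ * of M) * gramRes μ M := by
      rw [transpose_mul, hRt]; simp only [Matrix.mul_assoc]
    rw [this, hG, hR, conj_mul_conj hU, conj_mul_conj hU, trace_conj hU]
    exact Finset.sum_congr rfl fun k _ => by ring
  have tN3 : trace ((of M * gramRes μ M)ᵀ * (of M * gramRes μ M * gramRes μ M)) =
      ∑ k, x k * r k ^ 3 := by
    have : (of M * gramRes μ M)ᵀ * (of M * gramRes μ M * gramRes μ M) =
        gramRes μ M * ((of M)ᵀ * of M) * gramRes μ M * gramRes μ M := by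
      rw [transpose_mul, hRt]; simp only [Matrix.mul_assoc]
    rw [this, hG, hR, conj_mul_conj hU, conj_mul_conj hU, conj_mul_conj hU, trace_conj hU]
    exact Finset.sum_congr rfl fun k _ => by ring
  have e1 : ∑ i : Fin n, ∑ j, (gramRes μ M * gramRes μ M) j j *
      (1 - (of M * gramRes μ M * (of M)ᵀ) i i) = n * ∑ k, r k ^ 2 -
        (∑ k, x k * r k) * ∑ k, r k ^ 2 := by
    rw [← tR2, ← tP, trace, trace]
    simp only [diag_apply, ← Finset.sum_mul, ← Finset.mul_sum]
    rw [Finset.sum_sub_distrib]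
    simp
    ring
  have e2 : ∑ i : Fin n, ∑ j, (of M * gramRes μ M) i j * (of M * gramRes μ M * gramRes μ M) i j =
      ∑ k, x k * r k ^ 3 := by
    rw [← tN3, trace, Finset.sum_comm]
    simp only [diag_apply, mul_apply (M := (of M * gramRes μ M)ᵀ), transpose_apply]
  have e3 : ∑ i : Fin n, ∑ j, (∑ k, (of M * gramRes μ M) i k ^ 2) * gramRes μ M j j =
      (∑ k, x k * r k ^ 2) * ∑ k, r k := by
    rw [← tR, ← tN, ← sum_sq_eq_trace, trace]
    simp only [diag_apply, ← Finset.sum_mul, ← Finset.mul_sum]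
  have e2' : ∑ i : Fin n, ∑ j,
      2 * ((of M * gramRes μ M) i j * (of M * gramRes μ M * gramRes μ M) i j) =
      2 * ∑ k, x k * r k ^ 3 := by
    rw [← e2]
    simp only [Finset.mul_sum]
  simp only [second, Finset.sum_sub_distrib]
  rw [e1, e2', e3]

theorem left_mul_apply (hU : Uᵀ * U = 1) (hU' : U * Uᵀ = 1)
    (hG : (of M)ᵀ * of M = U * diagonal x * Uᵀ) {μ : ℝ} (hx : ∀ k, x k + μ ≠ 0)
    (i : Fin n) (j : Fin m) :
    (of M * gramRes μ M * gramRes μ M) i j =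
      ∑ k, (of M * U) i k * (x k + μ)⁻¹ ^ 2 * U j k := by
  rw [Matrix.mul_assoc, eq_diagonal hU hU' hG hx, conj_mul_conj hU, ← Matrix.mul_assoc,
    ← Matrix.mul_assoc, mul_apply]
  simp only [mul_diagonal, transpose_apply, sq]

theorem sum_sq_weighted (hU : Uᵀ * U = 1)
    (hG : (of M)ᵀ * of M = U * diagonal x * Uᵀ) (d : Fin m → ℝ) :
    ∑ i, ∑ j, (∑ k, (of M * U) i k * d k * U j k) ^ 2 = ∑ k, x k * d k ^ 2 := by
  have h : ∀ i j, ∑ k, (of M * U) i k * d k * U j k = (of M * (U * diagonal d * Uᵀ)) i j := by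
    intro i j
    rw [← Matrix.mul_assoc, ← Matrix.mul_assoc, mul_apply]
    simp only [mul_diagonal, transpose_apply]
  simp_rw [h]
  rw [sum_sq_eq_trace, transpose_mul]
  have : (U * diagonal d * Uᵀ)ᵀ = U * diagonal d * Uᵀ := by
    simp only [transpose_mul, transpose_transpose, diagonal_transpose, Matrix.mul_assoc]
  rw [this, Matrix.mul_assoc, ← Matrix.mul_assoc (of M)ᵀ, hG, conj_mul_conj hU, conj_mul_conj hU,
    trace_conj hU]
  exact Finset.sum_congr rfl fun k _ => by ring

theorem trace_eq (hU : Uᵀ * U = 1) (hU' : U * Uᵀ = 1)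
    (hG : (of M)ᵀ * of M = U * diagonal x * Uᵀ) {μ : ℝ} (hx : ∀ k, x k + μ ≠ 0) :
    trace (gramRes μ M) = ∑ k, (x k + μ)⁻¹ := by
  rw [eq_diagonal hU hU' hG hx, trace_conj hU]

end gramRes

end Spectral

/-! ### The divided differences of a power -/

section PowKer
open Set Filter Real

/-- The normalizing constant in the integral representation of `x ^ q`. -/
noncomputable def powConst (q : ℝ) : ℝ := (∫ t in Ioi 0, rpowIntegrand₀₁ q t 1)⁻¹

/-- The divided difference `(s ^ q - u ^ q) / (s - u)`, as an integral. -/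
noncomputable def powKer (q s u : ℝ) : ℝ :=
  powConst q * ∫ t in Ioi 0, t ^ q * ((s + t)⁻¹ * (u + t)⁻¹)

variable {q s u : ℝ}

theorem powConst_pos (hq : q ∈ Ioo 0 1) : 0 < powConst q :=
  inv_pos.2 (integral_rpowIntegrand₀₁_one_pos hq)

theorem rpowIntegrand_eq {t : ℝ} (hs : 0 < s) (ht : 0 < t) :
    rpowIntegrand₀₁ q t s = s * (t ^ q * (t⁻¹ * (s + t)⁻¹)) := by
  unfold rpowIntegrand₀₁
  have : s + t ≠ 0 := by positivity
  rw [add_comm t s]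
  field_simp
  ring

theorem integrableOn_powKer (hq : q ∈ Ioo 0 1) (hs : 0 < s) (hu : 0 < u) :
    IntegrableOn (fun t => t ^ q * ((s + t)⁻¹ * (u + t)⁻¹)) (Ioi 0) := by
  refine Integrable.mono' ((integrableOn_rpowIntegrand₀₁_Ioi hq hs.le).const_mul s⁻¹)
    (Measurable.aestronglyMeasurable (by fun_prop)) ?_
  filter_upwards [self_mem_ae_restrict measurableSet_Ioi] with t (ht : 0 < t)
  rw [rpowIntegrand_eq hs ht, norm_of_nonneg (by positivity), inv_mul_cancel_left₀ hs.ne',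
    mul_comm t⁻¹]
  gcongr
  linarith

theorem integrableOn_powKer_mul (hq : q ∈ Ioo 0 1) (hs : 0 < s) (hu : 0 < u) {v : ℝ} (hv : 0 < v) :
    IntegrableOn (fun t => t ^ (q + 1) * ((s + t)⁻¹ * (u + t)⁻¹ * (v + t)⁻¹)) (Ioi 0) := by
  refine Integrable.mono' (integrableOn_powKer hq hs hu)
    (Measurable.aestronglyMeasurable (by fun_prop)) ?_
  filter_upwards [self_mem_ae_restrict measurableSet_Ioi] with t (ht : 0 < t)
  rw [norm_of_nonneg (by positivity), rpow_add_one ht.ne']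
  have : t * (v + t)⁻¹ ≤ 1 := by
    rw [← div_eq_mul_inv, div_le_one (by positivity)]; linarith
  calc t ^ q * t * ((s + t)⁻¹ * (u + t)⁻¹ * (v + t)⁻¹)
      = t ^ q * ((s + t)⁻¹ * (u + t)⁻¹) * (t * (v + t)⁻¹) := by ring
    _ ≤ t ^ q * ((s + t)⁻¹ * (u + t)⁻¹) * 1 := by gcongr
    _ = _ := mul_one _

theorem hasDerivAt_inv_add {t : ℝ} (hs : 0 < s) (ht : 0 < t) :
    HasDerivAt (fun t => (s + t)⁻¹) (-((s + t)⁻¹ * (s + t)⁻¹)) t := by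
  have h : s + t ≠ 0 := by positivity
  have := ((hasDerivAt_id t).const_add s).inv h
  convert! this using 1
  simp only [id]; field_simp

theorem tendsto_rpow_mul_zero (hq : q < 1) {f : ℝ → ℝ} (p : ℝ)
    (hf0 : ∀ t, 0 < t → 0 ≤ f t) (hf : ∀ t, 0 < t → t ^ p * f t ≤ t ^ (q - 1)) :
    Tendsto (fun t => t ^ p * f t) atTop (nhds 0) := by
  have h := tendsto_rpow_neg_atTop (y := 1 - q) (by linarith)
  refine squeeze_zero' ?_ ?_ h
  · filter_upwards [eventually_gt_atTop 0] with t ht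
    have := hf0 t ht
    positivity
  · filter_upwards [eventually_gt_atTop 0] with t ht
    rw [neg_sub]
    exact hf t ht

theorem inv_add_le {t : ℝ} (hs : 0 < s) (ht : 0 < t) : (s + t)⁻¹ ≤ t⁻¹ :=
  inv_anti₀ ht (by linarith)

theorem rpow_eq_powConst (hq : q ∈ Ioo 0 1) (hs : 0 < s) :
    s ^ q = powConst q * ∫ t in Ioi 0, rpowIntegrand₀₁ q t s :=
  rpow_eq_const_mul_integral hq hs.le

/-- The function t^q/(s+t) vanishes at 0 and at infinity, so its derivative integrates to zero. The
first part of that derivative is q/s times the integrand representing s^q, and the second is minus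
the integrand of `powKer q s s`. -/
theorem powKer_self (hq : q ∈ Ioo 0 1) (hs : 0 < s) : powKer q s s = q * s ^ (q - 1) := by
  have hi1 := (integrableOn_rpowIntegrand₀₁_Ioi hq hs.le).const_mul (q * s⁻¹)
  have hi2 := integrableOn_powKer hq hs hs
  have h := integral_Ioi_of_hasDerivAt_of_tendsto (a := 0) (f := fun t => t ^ q * (s + t)⁻¹)
    (f' := fun t => q * s⁻¹ * rpowIntegrand₀₁ q t s - t ^ q * ((s + t)⁻¹ * (s + t)⁻¹)) (m := 0)
    (ContinuousAt.continuousWithinAt (by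
      refine ((continuousAt_rpow_const _ _ (Or.inr hq.1.le))).mul (ContinuousAt.inv₀ ?_ ?_)
      · fun_prop
      · simpa using hs.ne')) (fun t ht => ?_) (hi1.sub hi2)
    (tendsto_rpow_mul_zero hq.2 q (fun t ht => by positivity) fun t ht => ?_)
  · rw [integral_sub hi1 hi2, integral_const_mul, zero_rpow hq.1.ne', zero_mul, sub_zero] at h
    unfold powKer
    rw [rpow_sub_one hs.ne', rpow_eq_powConst hq hs, ← sub_eq_zero.1 h]
    field_simp
  · have ht : 0 < t := ht
    convert! (hasDerivAt_rpow_const (p := q) (Or.inl ht.ne')).mul (hasDerivAt_inv_add hs ht) using 1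
    rw [rpowIntegrand_eq hs ht, rpow_sub_one ht.ne']
    field_simp
    ring
  · rw [rpow_sub_one ht.ne', div_eq_mul_inv]
    have := inv_add_le hs ht
    gcongr

/-- The integrands of s^q and u^q are t^q (1/t - 1/(s+t)) and t^q (1/t - 1/(u+t)); partial fractions
extract the factor s - u from their difference. -/
theorem powKer_mul_sub (hq : q ∈ Ioo 0 1) (hs : 0 < s) (hu : 0 < u) :
    powKer q s u * (s - u) = s ^ q - u ^ q := by
  rw [rpow_eq_powConst hq hs, rpow_eq_powConst hq hu, ← mul_sub,
    ← integral_sub (integrableOn_rpowIntegrand₀₁_Ioi hq hs.le)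
      (integrableOn_rpowIntegrand₀₁_Ioi hq hu.le), powKer, mul_assoc, ← integral_mul_const]
  congr 1
  refine setIntegral_congr_fun measurableSet_Ioi fun t (ht : 0 < t) => ?_
  simp only [rpowIntegrand₀₁]
  have h1 : s + t ≠ 0 := by positivity
  have h2 : u + t ≠ 0 := by positivity
  rw [add_comm t s, add_comm t u]
  field_simp
  ring

theorem powKer_nonneg (hq : q ∈ Ioo 0 1) (hs : 0 < s) (hu : 0 < u) : 0 ≤ powKer q s u :=
  mul_nonneg (powConst_pos hq).le (setIntegral_nonneg measurableSet_Ioi fun t (ht : 0 < t) => by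
    positivity)

theorem powKer_comm (q s u : ℝ) : powKer q s u = powKer q u s := by
  simp only [powKer, mul_comm (s + _)⁻¹]

theorem powKer_le (hq : q ∈ Ioo 0 1) (hs : 0 < s) (hu : 0 < u) {v : ℝ} (hv : s ≤ v) :
    powKer q v u ≤ powKer q s u := by
  refine mul_le_mul_of_nonneg_left ?_ (powConst_pos hq).le
  refine setIntegral_mono_on (integrableOn_powKer hq (hs.trans_le hv) hu)
    (integrableOn_powKer hq hs hu) measurableSet_Ioi fun t (ht : 0 < t) => ?_
  gcongr

/-- Integration by parts of t^(q+1) against the derivative of 1/((s+t)(u+t)), with vanishing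
boundary terms. This evaluates the cubic resolvent terms that arise in the Laplacian. -/
theorem integral_powKer_add (hq : q ∈ Ioo 0 1) (hs : 0 < s) (hu : 0 < u) :
    powConst q * ∫ t in Ioi 0, t ^ (q + 1) * ((s + t)⁻¹ * (u + t)⁻¹ * ((s + t)⁻¹ + (u + t)⁻¹)) =
      (q + 1) * powKer q s u := by
  have hi1 := (integrableOn_powKer hq hs hu).const_mul (q + 1)
  have hi2 : IntegrableOn (fun t => t ^ (q + 1) *
      ((s + t)⁻¹ * (u + t)⁻¹ * ((s + t)⁻¹ + (u + t)⁻¹))) (Ioi 0) := by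
    refine ((integrableOn_powKer_mul hq hs hu hs).add (integrableOn_powKer_mul hq hs hu hu)).congr
      (.of_forall fun t => ?_)
    simp only [Pi.add_apply]; ring
  have hq1 : 0 < q + 1 := by linarith [hq.1]
  have h := integral_Ioi_of_hasDerivAt_of_tendsto (a := 0)
    (f := fun t => t ^ (q + 1) * ((s + t)⁻¹ * (u + t)⁻¹))
    (f' := fun t => (q + 1) * (t ^ q * ((s + t)⁻¹ * (u + t)⁻¹)) -
      t ^ (q + 1) * ((s + t)⁻¹ * (u + t)⁻¹ * ((s + t)⁻¹ + (u + t)⁻¹))) (m := 0)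
    (ContinuousAt.continuousWithinAt (by
      refine ((continuousAt_rpow_const _ _ (Or.inr hq1.le))).mul
        ((ContinuousAt.inv₀ ?_ ?_).mul (ContinuousAt.inv₀ ?_ ?_))
      · fun_prop
      · simpa using hs.ne'
      · fun_prop
      · simpa using hu.ne')) (fun t ht => ?_) (hi1.sub hi2)
    (tendsto_rpow_mul_zero hq.2 (q + 1) (fun t ht => by positivity) fun t ht => ?_)
  · rw [integral_sub hi1 hi2, integral_const_mul, zero_rpow hq1.ne', zero_mul, sub_zero] at h
    unfold powKer
    rw [← sub_eq_zero.1 h]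
    ring
  · have ht : 0 < t := ht
    convert! (hasDerivAt_rpow_const (p := q + 1) (Or.inl ht.ne')).mul
      ((hasDerivAt_inv_add hs ht).mul (hasDerivAt_inv_add hu ht)) using 1
    rw [add_sub_cancel_right]
    simp only [Pi.mul_apply]
    ring
  · rw [rpow_add_one ht.ne', rpow_sub_one ht.ne']
    calc t ^ q * t * ((s + t)⁻¹ * (u + t)⁻¹) ≤ t ^ q * t * (t⁻¹ * t⁻¹) := by
          have := inv_add_le hs ht
          have := inv_add_le hu ht
          gcongr
      _ = t ^ q / t := by field_simp

/-! ### Trapezoidal bounds for divided differences -/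

theorem rpow_le_tangent {e y t : ℝ} (he : 0 ≤ e) (he1 : e ≤ 1) (hy : 0 < y) (ht : 0 < t) :
    t ^ e ≤ y ^ e + e * y ^ (e - 1) * (t - y) := by
  have h := rpow_one_add_le_one_add_mul_self (s := t / y - 1) (by linarith [div_pos ht hy]) he he1
  rw [add_sub_cancel, div_rpow ht.le hy.le, div_le_iff₀ (rpow_pos_of_pos hy _)] at h
  refine h.trans (le_of_eq ?_)
  rw [rpow_sub_one hy.ne']
  field_simp

/-- The trapezoidal rule underestimates the integral of a concave power. -/
theorem trapezoid_le_rpow_sub {a t : ℝ} (ha : 1 ≤ a) (ha2 : a ≤ 2) (ht : 0 < t) (hts : t ≤ s) :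
    a / 2 * (s - t) * (s ^ (a - 1) + t ^ (a - 1)) ≤ s ^ a - t ^ a := by
  set ψ : ℝ → ℝ := fun y => y ^ a - t ^ a - a / 2 * ((y - t) * (y ^ (a - 1) + t ^ (a - 1))) with hψ
  have hd : ∀ y, 0 < y → HasDerivAt ψ (a * y ^ (a - 1) - a / 2 * (1 * (y ^ (a - 1) + t ^ (a - 1)) +
      (y - t) * ((a - 1) * y ^ (a - 1 - 1)))) y := by
    intro y hy
    have h1 := (hasDerivAt_rpow_const (x := y) (p := a) (Or.inl hy.ne')).sub_const (t ^ a)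
    have h2 := (hasDerivAt_rpow_const (x := y) (p := a - 1) (Or.inl hy.ne')).add_const
      (t ^ (a - 1))
    exact h1.sub ((((hasDerivAt_id y).sub_const t).mul h2).const_mul (a / 2))
  have hmono : MonotoneOn ψ (Ici t) := by
    refine monotoneOn_of_deriv_nonneg (convex_Ici t)
      (fun y hy => (hd y (ht.trans_le hy)).continuousAt.continuousWithinAt)
      (fun y hy => (hd y (ht.trans_le (interior_subset hy))).differentiableAt.differentiableWithinAt)
      fun y hy => ?_
    have hy0 : 0 < y := ht.trans_le (interior_subset hy)
    rw [(hd y hy0).deriv]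
    -- ψ'(y) is a/2 times the gap at t between the tangent line of z^(a-1) drawn at y and t^(a-1)
    -- itself, nonnegative by concavity.
    have := rpow_le_tangent (e := a - 1) (by linarith) (by linarith) hy0 ht
    nlinarith
  have h := hmono (self_mem_Ici) hts hts
  simp only [hψ, sub_self, zero_mul, mul_zero] at h
  linarith

/-- For s ≠ u the right side is the divided difference of x^(2q), that is, 2q times the mean of
y^(2q-1) over the interval between u and s. The condition 1/2 ≤ q makes y^(2q-1) concave, so the
mean is at least that of the endpoint values. -/
theorem powKer_mul_add_ge (hq : q ∈ Ioo 0 1) (hq2 : 1 / 2 ≤ q) (hs : 0 < s) (hu : 0 < u) :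
    q * (s ^ (2 * q - 1) + u ^ (2 * q - 1)) ≤ powKer q s u * (s ^ q + u ^ q) := by
  wlog hsu : u ≤ s generalizing s u
  · have := this hu hs (le_of_not_ge hsu)
    rwa [powKer_comm, add_comm (s ^ q), add_comm (s ^ (2 * q - 1))]
  rcases hsu.eq_or_lt with rfl | hlt
  · rw [powKer_self hq hs, ← two_mul, ← two_mul]
    refine le_of_eq ?_
    rw [show 2 * q - 1 = (q - 1) + q by ring, rpow_add hs]
    ring
  · have h1 := trapezoid_le_rpow_sub (a := 2 * q) (by linarith) (by linarith [hq.2]) hu hsu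
    have h2 := powKer_mul_sub hq hs hu
    have e : ∀ x : ℝ, 0 < x → x ^ (2 * q) = x ^ q * x ^ q := fun x hx => by
      rw [two_mul, rpow_add hx]
    rw [e s hs, e u hu] at h1
    have h3 : 0 < s - u := by linarith
    refine le_of_mul_le_mul_right ?_ h3
    calc q * (s ^ (2 * q - 1) + u ^ (2 * q - 1)) * (s - u)
        = 2 * q / 2 * (s - u) * (s ^ (2 * q - 1) + u ^ (2 * q - 1)) := by ring
      _ ≤ s ^ q * s ^ q - u ^ q * u ^ q := h1
      _ = (powKer q s u * (s - u)) * (s ^ q + u ^ q) := by rw [h2]; ring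
      _ = _ := by ring

/-! ### The inequality between spectral sums -/

variable {m : ℕ} {x : Fin m → ℝ}

/-- Chebyshev's sum inequality: x^q increases and x^(q-1) decreases, and their product is x^(2q-1).
-/
theorem card_mul_sum_rpow_le (hq : q ∈ Ioo 0 1) (hx : ∀ k, 0 < x k) :
    m * ∑ k, x k ^ (2 * q - 1) ≤ (∑ k, x k ^ q) * ∑ k, x k ^ (q - 1) := by
  have h : AntivaryOn (fun k => x k ^ q) (fun k => x k ^ (q - 1))
      ((Finset.univ : Finset (Fin m)) : Set (Fin m)) := by
    intro i _ j _ hij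
    have hlt : x j < x i := by
      by_contra hcon
      exact absurd (rpow_le_rpow_of_nonpos (hx i) (not_lt.1 hcon) (by linarith [hq.2]))
        (not_le.2 hij)
    exact rpow_le_rpow (hx j).le hlt.le hq.1.le
  have := h.card_mul_sum_le_sum_mul_sum
  rw [Finset.card_fin] at this
  refine le_trans (le_of_eq ?_) this
  congr 1
  refine Finset.sum_congr rfl fun k _ => ?_
  rw [← rpow_add (hx k)]; congr 1; ring

/-- Chebyshev's inequality pairs x_k^q with the off-diagonal row sums of the kernel, which decrease
in x_k. Symmetrizing the weighted double sum then exposes K(x_k,x_l)(x_k^q + x_l^q), to which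
`powKer_mul_add_ge` applies. -/
theorem offDiag_sum_ge (hq : q ∈ Ioo 0 1) (hq2 : 1 / 2 ≤ q) (hx : ∀ k, 0 < x k) :
    q * m * (m - 1) * ∑ k, x k ^ (2 * q - 1) ≤
      (∑ k, x k ^ q) * ∑ k, (∑ l, powKer q (x k) (x l) - powKer q (x k) (x k)) := by
  have hanti : AntivaryOn (fun k => x k ^ q)
      (fun k => ∑ l, powKer q (x k) (x l) - powKer q (x k) (x k))
      ((Finset.univ : Finset (Fin m)) : Set (Fin m)) := by
    intro i _ j _ hij
    by_contra hcon
    have hlt : x i < x j := by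
      by_contra h
      exact hcon (rpow_le_rpow (hx j).le (not_lt.1 h) hq.1.le)
    refine absurd hij (not_lt.2 ?_)
    have hne : i ≠ j := fun h => by rw [h] at hlt; exact lt_irrefl _ hlt
    -- The kernel decreases in its first argument, so every summand is nonnegative. Keeping only l =
    -- i and l = j, the mixed terms cancel by symmetry and exactly the difference of the two
    -- diagonal entries remains.
    have h1 : ∑ l ∈ {i, j}, (powKer q (x i) (x l) - powKer q (x j) (x l)) ≤
        ∑ l, (powKer q (x i) (x l) - powKer q (x j) (x l)) :=
      Finset.sum_le_sum_of_subset_of_nonneg (Finset.subset_univ _) fun l _ _ =>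
        sub_nonneg.2 (powKer_le hq (hx i) (hx l) hlt.le)
    rw [Finset.sum_pair hne, Finset.sum_sub_distrib, powKer_comm q (x j) (x i)] at h1
    linarith
  have h := hanti.card_mul_sum_le_sum_mul_sum
  rw [Finset.card_fin] at h
  refine le_trans ?_ h
  have h2 : q * m * ∑ k, x k ^ (2 * q - 1) ≤ ∑ k, ∑ l, powKer q (x k) (x l) * x k ^ q := by
    have e1 : ∑ k, ∑ l, q * (x k ^ (2 * q - 1) + x l ^ (2 * q - 1)) ≤
        ∑ k, ∑ l, powKer q (x k) (x l) * (x k ^ q + x l ^ q) :=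
      Finset.sum_le_sum fun k _ => Finset.sum_le_sum fun l _ =>
        powKer_mul_add_ge hq hq2 (hx k) (hx l)
    have e2 : ∑ k, ∑ l, q * (x k ^ (2 * q - 1) + x l ^ (2 * q - 1)) =
        2 * (q * m * ∑ k, x k ^ (2 * q - 1)) := by
      simp only [← Finset.mul_sum, Finset.sum_add_distrib]
      simp
      rw [← Finset.mul_sum]
      ring
    have e3 : ∑ k, ∑ l, powKer q (x k) (x l) * (x k ^ q + x l ^ q) =
        2 * ∑ k, ∑ l, powKer q (x k) (x l) * x k ^ q := by
      simp only [mul_add, Finset.sum_add_distrib]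
      rw [Finset.sum_comm (f := fun k l => powKer q (x k) (x l) * x l ^ q)]
      rw [two_mul]
      congr 1
      refine Finset.sum_congr rfl fun k _ => Finset.sum_congr rfl fun l _ => ?_
      rw [powKer_comm]
    linarith
  have h3 : ∑ k, powKer q (x k) (x k) * x k ^ q = q * ∑ k, x k ^ (2 * q - 1) := by
    rw [Finset.mul_sum]
    refine Finset.sum_congr rfl fun k _ => ?_
    rw [powKer_self hq (hx k), mul_assoc, ← rpow_add (hx k)]
    congr 2; ring
  have h4 : ∑ k, x k ^ q * (∑ l, powKer q (x k) (x l) - powKer q (x k) (x k)) =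
      ∑ k, ∑ l, powKer q (x k) (x l) * x k ^ q - ∑ k, powKer q (x k) (x k) * x k ^ q := by
    rw [← Finset.sum_sub_distrib]
    refine Finset.sum_congr rfl fun k _ => ?_
    rw [← Finset.sum_mul]; ring
  rw [h4, h3]
  have : (0 : ℝ) ≤ m := Nat.cast_nonneg m
  nlinarith

/-- The parameter range for which the Schatten prior is superharmonic (`q = p / 2 < 1`). -/
theorem spectral_ineq {n : ℕ} (hmn : m ≤ n) {α : ℝ} (hq : q ∈ Ioo 0 1) (hα : 0 ≤ α)
    (h : (1 / 2 ≤ q ∧ α ≤ n * m - (1 - q) * m * (m + 1) - 2 * q) ∨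
      α ≤ n * m - m * (m + 1) + (m - 1) * (2 * q)) (hx : ∀ k, 0 < x k) :
    (α + 2 * q) * q * ∑ k, x k ^ (2 * q - 1) ≤ (∑ k, x k ^ q) *
      ((n - m - 1 + 2 * q) * ∑ k, powKer q (x k) (x k) +
        q * ∑ k, (∑ l, powKer q (x k) (x l) - powKer q (x k) (x k))) := by
  have hS : 0 ≤ ∑ k, x k ^ q := Finset.sum_nonneg fun k _ => (rpow_pos_of_pos (hx k) _).le
  have hT : 0 ≤ ∑ k, x k ^ (2 * q - 1) :=
    Finset.sum_nonneg fun k _ => (rpow_pos_of_pos (hx k) _).le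
  have hd : ∑ k, powKer q (x k) (x k) = q * ∑ k, x k ^ (q - 1) := by
    rw [Finset.mul_sum]; exact Finset.sum_congr rfl fun k _ => powKer_self hq (hx k)
  have hc := card_mul_sum_rpow_le hq hx
  have hq0 := hq.1
  have hmn' : (m : ℝ) ≤ n := by exact_mod_cast hmn
  have hm0 : (0 : ℝ) ≤ m := Nat.cast_nonneg m
  rw [hd]
  rcases h with ⟨hq2, hle⟩ | hle
  · have ho := offDiag_sum_ge hq hq2 hx
    have hcoef : 0 ≤ (n - m - 1 + 2 * q : ℝ) := by linarith
    have h1 : (n - m - 1 + 2 * q : ℝ) * q * (m * ∑ k, x k ^ (2 * q - 1)) ≤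
        (n - m - 1 + 2 * q : ℝ) * q * ((∑ k, x k ^ q) * ∑ k, x k ^ (q - 1)) :=
      mul_le_mul_of_nonneg_left hc (by positivity)
    have h2 := mul_le_mul_of_nonneg_left ho hq0.le
    -- The first range is exact here: m(n-m-1+2q) + qm(m-1) = nm - (1-q)m(m+1).
    have h3 : (α + 2 * q) * q * ∑ k, x k ^ (2 * q - 1) ≤
        (m * (n - m - 1 + 2 * q) + q * m * (m - 1)) * q * ∑ k, x k ^ (2 * q - 1) :=
      mul_le_mul_of_nonneg_right (mul_le_mul_of_nonneg_right (by linarith) hq0.le) hT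
    linarith
  · have hmul : α + 2 * q ≤ m * (n - m - 1 + 2 * q) := by linarith
    -- For small q with n = m this sign is not automatic; it follows from 0 < α + 2q ≤ m(n-m-1+2q).
    have hcoef : 0 ≤ (n - m - 1 + 2 * q : ℝ) := by
      by_contra hcon
      push Not at hcon
      have := mul_nonpos_of_nonneg_of_nonpos hm0 hcon.le
      linarith
    have h1 : (n - m - 1 + 2 * q : ℝ) * q * (m * ∑ k, x k ^ (2 * q - 1)) ≤
        (n - m - 1 + 2 * q : ℝ) * q * ((∑ k, x k ^ q) * ∑ k, x k ^ (q - 1)) :=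
      mul_le_mul_of_nonneg_left hc (by positivity)
    have ho : 0 ≤ (∑ k, x k ^ q) *
        (q * ∑ k, (∑ l, powKer q (x k) (x l) - powKer q (x k) (x k))) := by
      refine mul_nonneg hS (mul_nonneg hq0.le (Finset.sum_nonneg fun k _ => sub_nonneg.2 ?_))
      exact Finset.single_le_sum (f := fun l => powKer q (x k) (x l))
        (fun l _ => powKer_nonneg hq (hx k) (hx l)) (Finset.mem_univ k)
    have h3 : (α + 2 * q) * q * ∑ k, x k ^ (2 * q - 1) ≤
        (m * (n - m - 1 + 2 * q)) * q * ∑ k, x k ^ (2 * q - 1) :=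
      mul_le_mul_of_nonneg_right (mul_le_mul_of_nonneg_right hmul hq0.le) hT
    linarith

end PowKer

/-! ### The regularized Schatten trace and its derivatives -/

section Regularized
open Matrix Set Filter

/-! ### Second derivatives and joint measurability of the resolvent trace -/

namespace gramRes

variable {n m : ℕ} {μ : ℝ}

theorem hasLineDerivAt_trace (hμ : 0 < μ) (M : RealMat n m) (i : Fin n) (j : Fin m) :
    HasLineDerivAt ℝ (fun M => trace (gramRes μ M))
      (-2 * (of M * gramRes μ M * gramRes μ M) i j) M (matUnit i j) := by
  have h := HasDerivAt.fun_sum (u := Finset.univ) fun k _ => hasLineDerivAt_apply hμ M i j k k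
  unfold HasLineDerivAt
  convert! h using 1
  rw [mul_apply, Finset.mul_sum]
  refine Finset.sum_congr rfl fun k _ => ?_
  rw [symm μ M j k]; ring

theorem hasLineDerivAt_entry (M : RealMat n m) (i : Fin n) (j k : Fin m) :
    HasLineDerivAt ℝ (fun M : RealMat n m => M i k) (if k = j then 1 else 0) M (matUnit i j) := by
  unfold HasLineDerivAt
  have h : (fun t : ℝ => (M + t • matUnit i j) i k) = fun t => M i k + t * if k = j then 1 else 0 := by
    ext t; simp [matUnit_apply]
  rw [h]
  simpa using ((hasDerivAt_id (0 : ℝ)).mul_const (if k = j then (1 : ℝ) else 0)).const_add (M i k)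

theorem hasLineDerivAt_left (hμ : 0 < μ) (M : RealMat n m) (i : Fin n) (j l : Fin m) :
    HasLineDerivAt ℝ (fun M => (of M * gramRes μ M) i l)
      (gramRes μ M j l * (1 - (of M * gramRes μ M * (of M)ᵀ) i i)
        - (of M * gramRes μ M) i j * (of M * gramRes μ M) i l) M (matUnit i j) := by
  have h := HasDerivAt.fun_sum (u := Finset.univ) fun k _ =>
    (hasLineDerivAt_entry M i j k).mul (hasLineDerivAt_apply hμ M i j k l)
  unfold HasLineDerivAt
  convert! h using 1
  simp only [zero_smul, add_zero, ite_mul, one_mul, zero_mul, Finset.sum_add_distrib,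
    Finset.sum_ite_eq', Finset.mem_univ, if_true, mul_neg, mul_add, neg_add]
  have e1 : (of M * gramRes μ M) i j = ∑ k, M i k * gramRes μ M k j := by rw [mul_apply]; rfl
  have e2 : (of M * gramRes μ M * (of M)ᵀ) i i = ∑ k, M i k * (of M * gramRes μ M) i k := by
    rw [mul_apply]; exact Finset.sum_congr rfl fun k _ => mul_comm _ _
  rw [e1, e2, mul_sub, mul_one, Finset.mul_sum, Finset.sum_mul, Finset.sum_neg_distrib,
    Finset.sum_neg_distrib]
  have e3 : ∑ k, gramRes μ M j l * (M i k * (of M * gramRes μ M) i k) =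
      ∑ k, M i k * ((of M * gramRes μ M) i k * gramRes μ M j l) :=
    Finset.sum_congr rfl fun k _ => by ring
  have e4 : ∑ k, M i k * gramRes μ M k j * (of M * gramRes μ M) i l =
      ∑ k, M i k * (gramRes μ M k j * (of M * gramRes μ M) i l) :=
    Finset.sum_congr rfl fun k _ => by ring
  rw [e3, e4]
  ring

theorem hasLineDerivAt_left_mul (hμ : 0 < μ) (M : RealMat n m) (i : Fin n) (j : Fin m) :
    HasLineDerivAt ℝ (fun M => (of M * gramRes μ M * gramRes μ M) i j) (second μ M i j) M
      (matUnit i j) := by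
  have h := HasDerivAt.fun_sum (u := Finset.univ) fun l _ =>
    (hasLineDerivAt_left hμ M i j l).mul (hasLineDerivAt_apply hμ M i j l j)
  unfold HasLineDerivAt
  convert! h using 1
  simp only [zero_smul, add_zero]
  have e1 : (gramRes μ M * gramRes μ M) j j = ∑ l, gramRes μ M j l * gramRes μ M l j := mul_apply
  have e2 : (of M * gramRes μ M * gramRes μ M) i j =
      ∑ l, (of M * gramRes μ M) i l * gramRes μ M l j := mul_apply
  unfold second
  rw [e1, e2, Finset.sum_mul, Finset.mul_sum,
    Finset.mul_sum, Finset.sum_mul, ← Finset.sum_sub_distrib, ← Finset.sum_sub_distrib]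
  exact Finset.sum_congr rfl fun l _ => by ring

theorem measurable_apply (k l : Fin m) :
    Measurable fun p : ℝ × RealMat n m => gramRes p.1 p.2 k l := by
  have hG : ∀ a b, Measurable fun p : ℝ × RealMat n m =>
      ((of p.2)ᵀ * of p.2 + p.1 • (1 : Matrix (Fin m) (Fin m) ℝ)) a b := by
    intro a b
    simp only [Matrix.add_apply, Matrix.smul_apply, mul_apply, transpose_apply, of_apply]
    fun_prop
  have hdet : ∀ B : ℝ × RealMat n m → Matrix (Fin m) (Fin m) ℝ,
      (∀ a b, Measurable fun p => B p a b) → Measurable fun p => (B p).det := by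
    intro B hB
    simp only [det_apply]
    exact Finset.measurable_fun_sum _ fun σ _ =>
      (Finset.measurable_fun_prod _ fun a _ => hB _ _).const_smul _
  unfold gramRes
  -- Cramer's rule turns each entry into a quotient of polynomials, measurable even where the
  -- determinant vanishes.
  simp only [inv_def, Ring.inverse_eq_inv', Matrix.smul_apply, smul_eq_mul, adjugate_apply]
  refine (hdet _ hG).inv.mul (hdet _ fun a b => ?_)
  by_cases hb : a = l
  · subst hb; simp
  · simpa [updateRow_ne hb] using hG a b

theorem measurable_left (i : Fin n) (l : Fin m) :
    Measurable fun p : ℝ × RealMat n m => (of p.2 * gramRes p.1 p.2) i l := by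
  simp only [mul_apply, of_apply]
  exact Finset.measurable_fun_sum _ fun k _ =>
    Measurable.mul (by fun_prop) (measurable_apply k l)

theorem measurable_left_mul (i : Fin n) (j : Fin m) :
    Measurable fun p : ℝ × RealMat n m =>
      (of p.2 * gramRes p.1 p.2 * gramRes p.1 p.2) i j := by
  simp only [mul_apply (N := gramRes _ _)]
  exact Finset.measurable_fun_sum _ fun k _ => (measurable_left i k).mul (measurable_apply k j)

theorem measurable_second (i : Fin n) (j : Fin m) :
    Measurable fun p : ℝ × RealMat n m => second p.1 p.2 i j := by
  unfold second
  have h1 : Measurable fun p : ℝ × RealMat n m => (gramRes p.1 p.2 * gramRes p.1 p.2) j j := by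
    simp only [mul_apply]
    exact Finset.measurable_fun_sum _ fun k _ => (measurable_apply j k).mul (measurable_apply k j)
  have h2 : Measurable fun p : ℝ × RealMat n m =>
      (of p.2 * gramRes p.1 p.2 * (of p.2)ᵀ) i i := by
    simp only [mul_apply (N := (of _)ᵀ), transpose_apply, of_apply]
    exact Finset.measurable_fun_sum _ fun k _ => (measurable_left i k).mul (by fun_prop)
  exact ((h1.mul (measurable_const.sub h2)).sub
    (((measurable_left i j).mul (measurable_left_mul i j)).const_mul 2)).sub
    ((Finset.measurable_fun_sum _ fun k _ => (measurable_left i k).pow_const 2).mul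
      (measurable_apply j j))

theorem measurable_trace :
    Measurable fun p : ℝ × RealMat n m => trace (gramRes p.1 p.2) :=
  Finset.measurable_fun_sum _ fun k _ => measurable_apply k k

end gramRes

/-- The trace of the `q`-th power of `MᵀM + ε`. -/
noncomputable def regPow {n m : ℕ} (q ε : ℝ) (M : RealMat n m) : ℝ :=
  ∑ k, (singularValue M k ^ 2 + ε) ^ q

/-- The partial derivatives of `regPow`. -/
noncomputable def regGrad {n m : ℕ} (q ε : ℝ) (i : Fin n) (j : Fin m) (M : RealMat n m) : ℝ :=
  powConst q * ∫ t in Ioi 0, t ^ q * (2 * (of M * gramRes (t + ε) M * gramRes (t + ε) M) i j)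

/-- The second partial derivatives of `regPow` along the coordinates. -/
noncomputable def regHess {n m : ℕ} (q ε : ℝ) (i : Fin n) (j : Fin m) (M : RealMat n m) : ℝ :=
  powConst q * ∫ t in Ioi 0, t ^ q * (2 * gramRes.second (t + ε) M i j)

variable {n m : ℕ} {q ε : ℝ}

theorem sq_singularValue_add_pos (hε : 0 < ε) (M : RealMat n m) (k : Fin m) :
    0 < singularValue M k ^ 2 + ε := by positivity

theorem trace_gramRes_eq {μ : ℝ} (hμ : 0 < μ) (M : RealMat n m) :
    trace (gramRes μ M) = ∑ k, (singularValue M k ^ 2 + μ)⁻¹ := by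
  obtain ⟨U, hU, hU', hG⟩ := exists_gram_eq M
  exact gramRes.trace_eq hU hU' hG fun k => (sq_singularValue_add_pos hμ M k).ne'

/-- Each eigenvalue x of MᵀM + ε contributes t^q (1/t - 1/(x+t)), and 1/(x+t) is an eigenvalue of
the resolvent at t + ε. The term m/t makes the integral converge at infinity. -/
theorem regPow_integrand_eq (hε : 0 < ε) (M : RealMat n m) {t : ℝ} (ht : 0 < t) :
    t ^ q * (m * t⁻¹ - trace (gramRes (t + ε) M)) =
      ∑ k, Real.rpowIntegrand₀₁ q t (singularValue M k ^ 2 + ε) := by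
  rw [trace_gramRes_eq (by positivity)]
  simp only [Real.rpowIntegrand₀₁, ← Finset.mul_sum, Finset.sum_sub_distrib]
  simp
  left
  refine Finset.sum_congr rfl fun k _ => ?_
  congr 1; ring

theorem integrableOn_regPow (hq : q ∈ Ioo 0 1) (hε : 0 < ε) (M : RealMat n m) :
    IntegrableOn (fun t => t ^ q * (m * t⁻¹ - trace (gramRes (t + ε) M))) (Ioi 0) := by
  refine IntegrableOn.congr_fun (f := fun t =>
    ∑ k, Real.rpowIntegrand₀₁ q t (singularValue M k ^ 2 + ε)) ?_
    (fun t ht => (regPow_integrand_eq hε M ht).symm) measurableSet_Ioi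
  exact integrable_finsetSum _ fun k _ =>
    Real.integrableOn_rpowIntegrand₀₁_Ioi hq (sq_singularValue_add_pos hε M k).le

theorem regPow_eq_integral (hq : q ∈ Ioo 0 1) (hε : 0 < ε) (M : RealMat n m) :
    regPow q ε M = powConst q * ∫ t in Ioi 0, t ^ q * (m * t⁻¹ - trace (gramRes (t + ε) M)) := by
  rw [setIntegral_congr_fun measurableSet_Ioi fun t ht => regPow_integrand_eq hε M ht,
    integral_finsetSum _ fun k _ =>
      Real.integrableOn_rpowIntegrand₀₁_Ioi hq (sq_singularValue_add_pos hε M k).le,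
    Finset.mul_sum]
  exact Finset.sum_congr rfl fun k _ => rpow_eq_powConst hq (sq_singularValue_add_pos hε M k)

theorem integrableOn_rpow_mul_inv_sq (hq : q ∈ Ioo 0 1) (hε : 0 < ε) :
    IntegrableOn (fun t => t ^ q * (1 / (t + ε) ^ 2)) (Ioi 0) := by
  refine (integrableOn_powKer hq hε hε).congr_fun (fun t _ => ?_) measurableSet_Ioi
  change t ^ q * ((ε + t)⁻¹ * (ε + t)⁻¹) = _
  rw [add_comm ε t, one_div, sq, mul_inv]

theorem measurable_section {f : ℝ × RealMat n m → ℝ} (hf : Measurable f) (ε : ℝ)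
    (M : RealMat n m) : Measurable fun t => f (t + ε, M) :=
  hf.comp (by fun_prop : Measurable fun t : ℝ => (t + ε, M))

theorem hasLineDerivAt_regPow (hq : q ∈ Ioo 0 1) (hε : 0 < ε) (M : RealMat n m) (i : Fin n)
    (j : Fin m) : HasLineDerivAt ℝ (regPow q ε) (regGrad q ε i j M) M (matUnit i j) := by
  rw [show regPow q ε = fun M : RealMat n m => powConst q * ∫ t in Ioi 0,
    t ^ q * (m * t⁻¹ - trace (gramRes (t + ε) M)) from funext (regPow_eq_integral hq hε)]
  unfold HasLineDerivAt regGrad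
  refine HasDerivAt.const_mul _ ?_
  -- The gradient majorant grows with `M`, so domination is only local: on the unit ball of steps
  -- each entry changes by at most 1.
  have h := (hasDerivAt_integral_of_dominated_loc_of_deriv_le (μ := volume.restrict (Ioi (0 : ℝ)))
    (F := fun (r : ℝ) t => t ^ q * (m * t⁻¹ - trace (gramRes (t + ε) (M + r • matUnit i j))))
    (F' := fun r t => t ^ q * (2 * (of (M + r • matUnit i j) * gramRes (t + ε) (M + r • matUnit i j)
      * gramRes (t + ε) (M + r • matUnit i j)) i j)) (x₀ := 0)
    (s := Metric.ball 0 1)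
    (bound := fun t => (2 * ∑ k, (|M i k| + 1)) * (t ^ q * (1 / (t + ε) ^ 2)))
    (Metric.ball_mem_nhds 0 one_pos) (.of_forall fun r => ?_) ?_ ?_ ?_ ?_ ?_).2
  · simpa using h
  · exact Measurable.aestronglyMeasurable (Measurable.mul (by fun_prop)
      (Measurable.sub (by fun_prop) (measurable_section gramRes.measurable_trace ε _)))
  · have := integrableOn_regPow hq hε M
    rw [IntegrableOn] at this
    simpa using this
  · exact Measurable.aestronglyMeasurable (Measurable.mul (by fun_prop)
      ((measurable_section (gramRes.measurable_left_mul i j) ε _).const_mul 2))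
  · filter_upwards [self_mem_ae_restrict measurableSet_Ioi] with t (ht : 0 < t) r hr
    have h1 := gramRes.abs_left_mul_le (by positivity : 0 < t + ε) (M + r • matUnit i j) i j
    have h2 : ∑ k, |(M + r • matUnit i j) i k| ≤ ∑ k, (|M i k| + 1) := by
      refine Finset.sum_le_sum fun k _ => ?_
      have hr' : |r| ≤ 1 := by simpa using (Metric.mem_ball.1 hr).le
      simp only [Pi.add_apply, Pi.smul_apply, matUnit_apply, true_and, smul_eq_mul]
      refine (abs_add_le _ _).trans (add_le_add le_rfl ?_)
      split_ifs <;> simp [hr']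
    rw [Real.norm_eq_abs, abs_mul, abs_mul, abs_of_nonneg (by positivity : 0 ≤ t ^ q), abs_two]
    calc _ ≤ t ^ q * (2 * ((∑ k, (|M i k| + 1)) * (1 / (t + ε) ^ 2))) := by
          gcongr; exact h1.trans (by gcongr)
      _ = _ := by ring
  · exact (integrableOn_rpow_mul_inv_sq hq hε).const_mul _
  · filter_upwards [self_mem_ae_restrict measurableSet_Ioi] with t (ht : 0 < t) r _
    have h1 := HasLineDerivAt.hasDerivAt_line (fun M =>
      gramRes.hasLineDerivAt_trace (by positivity : 0 < t + ε) M i j) M r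
    convert! (h1.const_sub (m * t⁻¹)).const_mul (t ^ q) using 1
    ring

theorem abs_regHess_integrand_le (hε : 0 < ε) (M : RealMat n m) (i : Fin n) (j : Fin m) {t : ℝ}
    (ht : 0 < t) :
    ‖t ^ q * (2 * gramRes.second (t + ε) M i j)‖ ≤ 8 * (t ^ q * (1 / (t + ε) ^ 2)) := by
  have h1 := gramRes.abs_second_le (by positivity : 0 < t + ε) M i j
  rw [Real.norm_eq_abs, abs_mul, abs_mul, abs_of_nonneg (by positivity : 0 ≤ t ^ q), abs_two]
  calc _ ≤ t ^ q * (2 * (4 * (1 / (t + ε) ^ 2))) := by gcongr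
    _ = _ := by ring

theorem measurable_regHess_integrand (q ε : ℝ) (M : RealMat n m) (i : Fin n) (j : Fin m) :
    Measurable fun t => t ^ q * (2 * gramRes.second (t + ε) M i j) :=
  Measurable.mul (by fun_prop) ((measurable_section (gramRes.measurable_second i j) ε M).const_mul 2)

theorem integrableOn_regHess (hq : q ∈ Ioo 0 1) (hε : 0 < ε) (M : RealMat n m) (i : Fin n)
    (j : Fin m) : IntegrableOn (fun t => t ^ q * (2 * gramRes.second (t + ε) M i j)) (Ioi 0) := by
  refine Integrable.mono' ((integrableOn_rpow_mul_inv_sq hq hε).const_mul 8)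
    (measurable_regHess_integrand q ε M i j).aestronglyMeasurable ?_
  filter_upwards [self_mem_ae_restrict measurableSet_Ioi] with t ht
  exact abs_regHess_integrand_le hε M i j ht

theorem integrableOn_regGrad (hq : q ∈ Ioo 0 1) (hε : 0 < ε) (M : RealMat n m) (i : Fin n)
    (j : Fin m) : IntegrableOn (fun t =>
      t ^ q * (2 * (of M * gramRes (t + ε) M * gramRes (t + ε) M) i j)) (Ioi 0) := by
  refine Integrable.mono' ((integrableOn_rpow_mul_inv_sq hq hε).const_mul (2 * ∑ k, |M i k|))
    (Measurable.aestronglyMeasurable (Measurable.mul (by fun_prop)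
      ((measurable_section (gramRes.measurable_left_mul i j) ε _).const_mul 2))) ?_
  filter_upwards [self_mem_ae_restrict measurableSet_Ioi] with t (ht : 0 < t)
  have h1 := gramRes.abs_left_mul_le (by positivity : 0 < t + ε) M i j
  rw [Real.norm_eq_abs, abs_mul, abs_mul, abs_of_nonneg (by positivity : 0 ≤ t ^ q), abs_two]
  calc _ ≤ t ^ q * (2 * ((∑ k, |M i k|) * (1 / (t + ε) ^ 2))) := by gcongr
    _ = _ := by ring

theorem hasLineDerivAt_regGrad (hq : q ∈ Ioo 0 1) (hε : 0 < ε) (M : RealMat n m) (i : Fin n)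
    (j : Fin m) : HasLineDerivAt ℝ (regGrad q ε i j) (regHess q ε i j M) M (matUnit i j) := by
  unfold HasLineDerivAt regGrad regHess
  refine HasDerivAt.const_mul _ ?_
  have h := (hasDerivAt_integral_of_dominated_loc_of_deriv_le (μ := volume.restrict (Ioi (0 : ℝ)))
    (F := fun (r : ℝ) t => t ^ q * (2 * (of (M + r • matUnit i j) * gramRes (t + ε) (M + r • matUnit i j)
      * gramRes (t + ε) (M + r • matUnit i j)) i j))
    (F' := fun r t => t ^ q * (2 * gramRes.second (t + ε) (M + r • matUnit i j) i j)) (x₀ := 0)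
    (s := univ) (bound := fun t => 8 * (t ^ q * (1 / (t + ε) ^ 2)))
    univ_mem (.of_forall fun r => ?_) ?_ ?_ ?_ ?_ ?_).2
  · simpa using h
  · exact (integrableOn_regGrad hq hε _ i j).aestronglyMeasurable
  · have := integrableOn_regGrad hq hε M i j
    rw [IntegrableOn] at this
    simpa using this
  · exact (integrableOn_regHess hq hε _ i j).aestronglyMeasurable
  · filter_upwards [self_mem_ae_restrict measurableSet_Ioi] with t ht r _
    exact abs_regHess_integrand_le hε _ i j ht
  · exact (integrableOn_rpow_mul_inv_sq hq hε).const_mul _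
  · filter_upwards [self_mem_ae_restrict measurableSet_Ioi] with t (ht : 0 < t) r _
    have h1 := HasLineDerivAt.hasDerivAt_line (fun M =>
      gramRes.hasLineDerivAt_left_mul (by positivity : 0 < t + ε) M i j) M r
    exact (h1.const_mul 2).const_mul (t ^ q)

theorem abs_regHess_le (hq : q ∈ Ioo 0 1) (hε : 0 < ε) (M : RealMat n m) (i : Fin n) (j : Fin m) :
    |regHess q ε i j M| ≤ powConst q * ∫ t in Ioi 0, 8 * (t ^ q * (1 / (t + ε) ^ 2)) := by
  unfold regHess
  rw [abs_mul, abs_of_pos (powConst_pos hq)]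
  refine mul_le_mul_of_nonneg_left ?_ (powConst_pos hq).le
  refine norm_integral_le_of_norm_le (f := fun t => t ^ q * (2 * gramRes.second (t + ε) M i j))
    ((integrableOn_rpow_mul_inv_sq hq hε).const_mul 8) ?_
  filter_upwards [self_mem_ae_restrict measurableSet_Ioi] with t ht
  exact abs_regHess_integrand_le hε M i j ht

theorem measurable_setIntegral {f : ℝ × RealMat n m → ℝ} (hf : Measurable f) (c : ℝ) :
    Measurable fun M => c * ∫ t in Ioi 0, f (t, M) := by
  refine Measurable.const_mul ?_ c
  exact (StronglyMeasurable.integral_prod_right (ν := volume.restrict (Ioi (0 : ℝ)))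
    (f := fun (M : RealMat n m) (t : ℝ) => f (t, M))
    (hf.comp measurable_swap).stronglyMeasurable).measurable

theorem measurable_shift (ε : ℝ) :
    Measurable fun p : ℝ × RealMat n m => (p.1 + ε, p.2) := by fun_prop

theorem measurable_regGrad (q ε : ℝ) (i : Fin n) (j : Fin m) : Measurable (regGrad q ε i j) := by
  have h1 : Measurable fun p : ℝ × RealMat n m =>
      (of p.2 * gramRes (p.1 + ε) p.2 * gramRes (p.1 + ε) p.2) i j := by
    simpa only [Function.comp_def] using (gramRes.measurable_left_mul i j).comp (measurable_shift ε)
  exact measurable_setIntegral (Measurable.mul (measurable_fst.pow_const q) (h1.const_mul 2))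
    (powConst q)

theorem measurable_regHess (q ε : ℝ) (i : Fin n) (j : Fin m) : Measurable (regHess q ε i j) := by
  have h1 : Measurable fun p : ℝ × RealMat n m => gramRes.second (p.1 + ε) p.2 i j := by
    simpa only [Function.comp_def] using (gramRes.measurable_second i j).comp (measurable_shift ε)
  exact measurable_setIntegral (Measurable.mul (measurable_fst.pow_const q) (h1.const_mul 2))
    (powConst q)

theorem measurable_regPow (hq : q ∈ Ioo 0 1) (hε : 0 < ε) :
    Measurable (regPow q ε : RealMat n m → ℝ) := by
  rw [show regPow q ε = fun M : RealMat n m => powConst q * ∫ t in Ioi 0,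
    t ^ q * (m * t⁻¹ - trace (gramRes (t + ε) M)) from funext (regPow_eq_integral hq hε)]
  have h1 : Measurable fun p : ℝ × RealMat n m => trace (gramRes (p.1 + ε) p.2) := by
    simpa only [Function.comp_def] using gramRes.measurable_trace.comp (measurable_shift ε)
  exact measurable_setIntegral (Measurable.mul (measurable_fst.pow_const q)
    (Measurable.sub (measurable_fst.inv.const_mul (m : ℝ)) h1)) (powConst q)

end Regularized

/-! ### Superharmonicity of the regularized prior -/

section Superharmonic
open Matrix Set Filter

variable {n m : ℕ} {q ε : ℝ}

/-- In the eigenbasis U the integral over t acts on each eigenvalue separately, so the gradient is M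
U diag(2K(s_k,s_k)) Uᵀ. -/
theorem sum_regGrad_sq (hq : q ∈ Ioo 0 1) (hε : 0 < ε) (M : RealMat n m) :
    ∑ i, ∑ j, regGrad q ε i j M ^ 2 = ∑ k, singularValue M k ^ 2 *
      (2 * powKer q (singularValue M k ^ 2 + ε) (singularValue M k ^ 2 + ε)) ^ 2 := by
  obtain ⟨U, hU, hU', hG⟩ := exists_gram_eq M
  rw [← gramRes.sum_sq_weighted hU hG]
  refine Finset.sum_congr rfl fun i _ => Finset.sum_congr rfl fun j _ => ?_
  congr 1
  have hi : ∀ k, IntegrableOn (fun t => t ^ q * ((singularValue M k ^ 2 + ε + t)⁻¹ *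
      (singularValue M k ^ 2 + ε + t)⁻¹)) (Ioi 0) := fun k =>
    integrableOn_powKer hq (sq_singularValue_add_pos hε M k) (sq_singularValue_add_pos hε M k)
  have h : ∀ t ∈ Ioi (0 : ℝ),
      t ^ q * (2 * (of M * gramRes (t + ε) M * gramRes (t + ε) M) i j) =
      ∑ k, (2 * ((of M * U) i k * U j k)) * (t ^ q * ((singularValue M k ^ 2 + ε + t)⁻¹ *
        (singularValue M k ^ 2 + ε + t)⁻¹)) := by
    intro t (ht : 0 < t)
    rw [gramRes.left_mul_apply hU hU' hG fun k =>
      (sq_singularValue_add_pos (by positivity : 0 < t + ε) M k).ne', Finset.mul_sum,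
      Finset.mul_sum]
    refine Finset.sum_congr rfl fun k _ => ?_
    rw [show singularValue M k ^ 2 + (t + ε) = singularValue M k ^ 2 + ε + t by ring]
    ring
  unfold regGrad
  rw [setIntegral_congr_fun measurableSet_Ioi h,
    integral_finsetSum _ fun k _ => (hi k).const_mul _, Finset.mul_sum]
  refine Finset.sum_congr rfl fun k _ => ?_
  rw [integral_const_mul, powKer]
  ring

/-- Pointwise lower bound for the Laplacian of the resolvent trace in terms of
`s k = x k + ε`. -/
theorem resolvent_sum_ge (x s : Fin m → ℝ) {t : ℝ} (ht : 0 < t) (hs : ∀ k, 0 < s k)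
    (hxs : ∀ k, x k ≤ s k) :
    ∑ k, ((n - m - 2 : ℝ) * ((s k + t)⁻¹ * (s k + t)⁻¹) +
        t * ((s k + t)⁻¹ * (s k + t)⁻¹ * ((s k + t)⁻¹ + (s k + t)⁻¹))) +
      ∑ k, ∑ l, (t * ((s k + t)⁻¹ * (s l + t)⁻¹ * ((s k + t)⁻¹ + (s l + t)⁻¹)) -
        (s k + t)⁻¹ * (s l + t)⁻¹) ≤
    n * ∑ k, (s k + t)⁻¹ ^ 2 - (∑ k, x k * (s k + t)⁻¹) * ∑ k, (s k + t)⁻¹ ^ 2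
      - 2 * ∑ k, x k * (s k + t)⁻¹ ^ 3 - (∑ k, x k * (s k + t)⁻¹ ^ 2) * ∑ k, (s k + t)⁻¹ := by
  set r : Fin m → ℝ := fun k => (s k + t)⁻¹ with hr
  have hr0 : ∀ k, 0 < r k := fun k => inv_pos.2 (add_pos (hs k) ht)
  -- Equality would hold with s in place of x; regularization only loses in the favourable
  -- direction, since x enters the Laplacian with a negative sign.
  have hxr : ∀ k, x k * r k ≤ 1 - t * r k := by
    intro k
    have h1 : (s k + t) * r k = 1 := mul_inv_cancel₀ (add_pos (hs k) ht).ne'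
    nlinarith [mul_le_mul_of_nonneg_right (hxs k) (hr0 k).le]
  have hS1 : 0 ≤ ∑ k, r k := Finset.sum_nonneg fun k _ => (hr0 k).le
  have hS2 : 0 ≤ ∑ k, r k ^ 2 := Finset.sum_nonneg fun k _ => sq_nonneg _
  have b1 : ∑ k, x k * r k ≤ m - t * ∑ k, r k := by
    calc ∑ k, x k * r k ≤ ∑ k, (1 - t * r k) := Finset.sum_le_sum fun k _ => hxr k
      _ = _ := by simp [Finset.mul_sum]
  have b2 : ∑ k, x k * r k ^ 2 ≤ ∑ k, r k - t * ∑ k, r k ^ 2 := by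
    calc ∑ k, x k * r k ^ 2 ≤ ∑ k, (r k - t * r k ^ 2) := Finset.sum_le_sum fun k _ => by
          nlinarith [mul_le_mul_of_nonneg_right (hxr k) (hr0 k).le]
      _ = _ := by simp [Finset.mul_sum]
  have b3 : ∑ k, x k * r k ^ 3 ≤ ∑ k, r k ^ 2 - t * ∑ k, r k ^ 3 := by
    calc ∑ k, x k * r k ^ 3 ≤ ∑ k, (r k ^ 2 - t * r k ^ 3) := Finset.sum_le_sum fun k _ => by
          nlinarith [mul_le_mul_of_nonneg_right (hxr k) (sq_nonneg (r k))]
      _ = _ := by simp [Finset.mul_sum]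
  have c1 := mul_le_mul_of_nonneg_right b1 hS2
  have c2 := mul_le_mul_of_nonneg_right b2 hS1
  have e1 : ∑ k, ((n - m - 2 : ℝ) * (r k * r k) + t * (r k * r k * (r k + r k))) =
      (n - m - 2) * ∑ k, r k ^ 2 + 2 * t * ∑ k, r k ^ 3 := by
    rw [Finset.mul_sum, Finset.mul_sum, ← Finset.sum_add_distrib]
    exact Finset.sum_congr rfl fun k _ => by ring
  have e2 : ∑ k, ∑ l, (t * (r k * r l * (r k + r l)) - r k * r l) =
      2 * t * ((∑ k, r k ^ 2) * ∑ k, r k) - (∑ k, r k) * ∑ k, r k := by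
    have f1 : (∑ k, r k ^ 2) * ∑ k, r k = ∑ k, ∑ l, r k ^ 2 * r l := Finset.sum_mul_sum ..
    have f2 : (∑ k, r k ^ 2) * ∑ k, r k = ∑ k, ∑ l, r k * r l ^ 2 := by
      rw [mul_comm]; exact Finset.sum_mul_sum ..
    have f3 : (∑ k, r k) * ∑ k, r k = ∑ k, ∑ l, r k * r l := Finset.sum_mul_sum ..
    rw [show 2 * t * ((∑ k, r k ^ 2) * ∑ k, r k) = t * ((∑ k, r k ^ 2) * ∑ k, r k) +
      t * ((∑ k, r k ^ 2) * ∑ k, r k) by ring]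
    nth_rewrite 1 [f1]
    rw [f2, f3]
    simp only [Finset.mul_sum, ← Finset.sum_add_distrib, ← Finset.sum_sub_distrib]
    exact Finset.sum_congr rfl fun k _ => Finset.sum_congr rfl fun l _ => by ring
  change ∑ k, ((n - m - 2 : ℝ) * (r k * r k) + t * (r k * r k * (r k + r k))) +
    ∑ k, ∑ l, (t * (r k * r l * (r k + r l)) - r k * r l) ≤
    n * ∑ k, r k ^ 2 - (∑ k, x k * r k) * ∑ k, r k ^ 2
      - 2 * ∑ k, x k * r k ^ 3 - (∑ k, x k * r k ^ 2) * ∑ k, r k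
  rw [e1, e2]
  linarith

/-- Integrating `resolvent_sum_ge` against t^q turns quadratic terms into K and, by
`integral_powKer_add`, cubic ones into (q+1)K. The double sum thus has coefficient (q+1) - 1 = q,
and the diagonal collects (n-m-2) + (q+1) + q = n-m-1+2q. -/
theorem sum_regHess_ge (hq : q ∈ Ioo 0 1) (hε : 0 < ε) (M : RealMat n m) :
    2 * ((n - m - 1 + 2 * q) * ∑ k, powKer q (singularValue M k ^ 2 + ε)
          (singularValue M k ^ 2 + ε) +
        q * ∑ k, (∑ l, powKer q (singularValue M k ^ 2 + ε) (singularValue M l ^ 2 + ε) -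
          powKer q (singularValue M k ^ 2 + ε) (singularValue M k ^ 2 + ε))) ≤
      ∑ i, ∑ j, regHess q ε i j M := by
  obtain ⟨U, hU, hU', hG⟩ := exists_gram_eq M
  set x : Fin m → ℝ := fun k => singularValue M k ^ 2 with hx
  set s : Fin m → ℝ := fun k => singularValue M k ^ 2 + ε with hs_def
  have hs : ∀ k, 0 < s k := sq_singularValue_add_pos hε M
  have hxs : ∀ k, x k ≤ s k := fun k => by simp only [hx, hs_def]; linarith
  set a : Fin m → Fin m → ℝ → ℝ := fun k l t => t ^ q * ((s k + t)⁻¹ * (s l + t)⁻¹) with ha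
  set b : Fin m → Fin m → ℝ → ℝ := fun k l t =>
    t ^ (q + 1) * ((s k + t)⁻¹ * (s l + t)⁻¹ * ((s k + t)⁻¹ + (s l + t)⁻¹)) with hb
  have hai : ∀ k l, IntegrableOn (a k l) (Ioi 0) := fun k l => integrableOn_powKer hq (hs k) (hs l)
  have hbi : ∀ k l, IntegrableOn (b k l) (Ioi 0) := fun k l =>
    ((integrableOn_powKer_mul hq (hs k) (hs l) (hs k)).add
      (integrableOn_powKer_mul hq (hs k) (hs l) (hs l))).congr (.of_forall fun t => by
        simp only [Pi.add_apply, hb]; ring)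
  set L : ℝ → ℝ := fun t => ∑ k, ((n - m - 2 : ℝ) * a k k t + b k k t) +
    ∑ k, ∑ l, (b k l t - a k l t) with hL
  have hLi1 : IntegrableOn (fun t => ∑ k, ((n - m - 2 : ℝ) * a k k t + b k k t)) (Ioi 0) :=
    integrable_finsetSum _ fun k _ => ((hai k k).const_mul _).add (hbi k k)
  have hLi2 : IntegrableOn (fun t => ∑ k, ∑ l, (b k l t - a k l t)) (Ioi 0) :=
    integrable_finsetSum _ fun k _ => integrable_finsetSum _ fun l _ => (hbi k l).sub (hai k l)
  have hLi : IntegrableOn L (Ioi 0) := hLi1.add hLi2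
  have hDa : ∀ k l, powConst q * ∫ t in Ioi 0, a k l t = powKer q (s k) (s l) := fun k l => rfl
  have hDb : ∀ k l, powConst q * ∫ t in Ioi 0, b k l t = (q + 1) * powKer q (s k) (s l) :=
    fun k l => integral_powKer_add hq (hs k) (hs l)
  have hLint : powConst q * ∫ t in Ioi 0, L t = (n - m - 1 + 2 * q) * ∑ k, powKer q (s k) (s k) +
        q * ∑ k, (∑ l, powKer q (s k) (s l) - powKer q (s k) (s k)) := by
    have hc : ∀ k, IntegrableOn (fun t => (n - m - 2 : ℝ) * a k k t + b k k t) (Ioi 0) := fun k =>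
      ((hai k k).const_mul _).add (hbi k k)
    have hd : ∀ k l, IntegrableOn (fun t => b k l t - a k l t) (Ioi 0) := fun k l =>
      (hbi k l).sub (hai k l)
    simp only [hL]
    rw [integral_add hLi1 hLi2, integral_finsetSum _ fun k _ => hc k,
      integral_finsetSum _ fun k _ => integrable_finsetSum _ fun l _ => hd k l]
    have h1 : ∀ k, ∫ t in Ioi 0, ((n - m - 2 : ℝ) * a k k t + b k k t) =
        (n - m - 2 : ℝ) * (∫ t in Ioi 0, a k k t) + ∫ t in Ioi 0, b k k t := fun k => by
      rw [integral_add ((hai k k).const_mul _) (hbi k k), integral_const_mul]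
    have h2 : ∀ k, ∫ t in Ioi 0, ∑ l, (b k l t - a k l t) =
        ∑ l, ((∫ t in Ioi 0, b k l t) - ∫ t in Ioi 0, a k l t) := fun k => by
      rw [integral_finsetSum _ fun l _ => hd k l]
      exact Finset.sum_congr rfl fun l _ => integral_sub (hbi k l) (hai k l)
    simp only [h1, h2]
    rw [mul_add, Finset.mul_sum, Finset.mul_sum]
    simp only [mul_add, mul_sub, Finset.mul_sum (s := Finset.univ), hDb, hDa, mul_left_comm (powConst q)]
    simp only [← Finset.sum_add_distrib]
    refine Finset.sum_congr rfl fun k _ => ?_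
    rw [← Finset.mul_sum]
    have : ∑ l, ((q + 1) * powKer q (s k) (s l) - powKer q (s k) (s l)) =
        q * ∑ l, powKer q (s k) (s l) := by
      rw [Finset.mul_sum]; exact Finset.sum_congr rfl fun l _ => by ring
    rw [this]; ring
  have hH : ∑ i, ∑ j, regHess q ε i j M =
      powConst q * ∫ t in Ioi 0, ∑ i, ∑ j, t ^ q * (2 * gramRes.second (t + ε) M i j) := by
    rw [integral_finsetSum _ fun i _ => integrable_finsetSum _ fun j _ =>
      integrableOn_regHess hq hε M i j, Finset.mul_sum]
    refine Finset.sum_congr rfl fun i _ => ?_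
    rw [integral_finsetSum _ fun j _ => integrableOn_regHess hq hε M i j, Finset.mul_sum]
    rfl
  rw [hH]
  change 2 * ((n - m - 1 + 2 * q) * ∑ k, powKer q (s k) (s k) +
        q * ∑ k, (∑ l, powKer q (s k) (s l) - powKer q (s k) (s k))) ≤ _
  rw [← hLint, mul_left_comm, ← integral_const_mul]
  refine mul_le_mul_of_nonneg_left ?_ (powConst_pos hq).le
  refine setIntegral_mono_on (hLi.const_mul 2) (integrable_finsetSum _ fun i _ =>
    integrable_finsetSum _ fun j _ => integrableOn_regHess hq hε M i j) measurableSet_Ioi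
    fun t (ht : 0 < t) => ?_
  have h1 := resolvent_sum_ge (n := n) x s ht hs hxs
  have h2 := gramRes.sum_second hU hU' hG (μ := t + ε) fun k =>
    (sq_singularValue_add_pos (by positivity : 0 < t + ε) M k).ne'
  simp only [show ∀ k, x k + (t + ε) = s k + t from fun k => by
    simp only [hs_def, hx]; ring] at h2
  rw [← h2] at h1
  have h3 : L t = t ^ q * (∑ k, ((n - m - 2 : ℝ) * ((s k + t)⁻¹ * (s k + t)⁻¹) +
        t * ((s k + t)⁻¹ * (s k + t)⁻¹ * ((s k + t)⁻¹ + (s k + t)⁻¹))) +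
      ∑ k, ∑ l, (t * ((s k + t)⁻¹ * (s l + t)⁻¹ * ((s k + t)⁻¹ + (s l + t)⁻¹)) -
        (s k + t)⁻¹ * (s l + t)⁻¹)) := by
    simp only [hL, ha, hb, Real.rpow_add_one ht.ne', mul_add (t ^ q), Finset.mul_sum]
    congr 1
    · exact Finset.sum_congr rfl fun k _ => by ring
    · exact Finset.sum_congr rfl fun k _ => Finset.sum_congr rfl fun l _ => by ring
  have h4 : ∑ i, ∑ j, t ^ q * (2 * gramRes.second (t + ε) M i j) =
      2 * (t ^ q * ∑ i, ∑ j, gramRes.second (t + ε) M i j) := by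
    simp only [Finset.mul_sum]
    exact Finset.sum_congr rfl fun k _ => Finset.sum_congr rfl fun l _ => by ring
  rw [h4, h3]
  have := Real.rpow_nonneg ht.le q
  gcongr

theorem le_regPow (hq : 0 < q) (hε : 0 < ε) (M : RealMat n m) :
    m * ε ^ q ≤ regPow q ε M := by
  unfold regPow
  calc (m : ℝ) * ε ^ q = ∑ _k : Fin m, ε ^ q := by simp
    _ ≤ _ := Finset.sum_le_sum fun k _ =>
      Real.rpow_le_rpow hε.le (by nlinarith [sq_nonneg (singularValue M k)]) hq.le

theorem smoothSuperharmonic_regPow_of_lt_one (hmn : m ≤ n) (hm : 0 < m) {α : ℝ}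
    (hq : q ∈ Ioo 0 1) (hα : 0 ≤ α) (hε : 0 < ε)
    (h : (1 / 2 ≤ q ∧ α ≤ n * m - (1 - q) * m * (m + 1) - 2 * q) ∨
      α ≤ n * m - m * (m + 1) + (m - 1) * (2 * q)) :
    ∃ F1 F2 C, SmoothSuperharmonic
      (fun M : RealMat n m => regPow q ε M ^ (-(α / (2 * q)))) F1 F2 C := by
  have hq0 := hq.1
  have hm' : (0 : ℝ) < m := by exact_mod_cast hm
  refine smoothSuperharmonic_rpow_neg (h1 := regGrad q ε) (h2 := regHess q ε)
    (c := m * ε ^ q) (by positivity) (by positivity) (measurable_regPow hq hε)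
    (measurable_regGrad q ε) (measurable_regHess q ε) (le_regPow hq0 hε)
    (fun i j M => hasLineDerivAt_regPow hq hε M i j)
    (fun i j M => hasLineDerivAt_regGrad hq hε M i j)
    (fun i j M => abs_regHess_le hq hε M i j) fun M => ?_
  have hs := sq_singularValue_add_pos hε M
  have h1 := spectral_ineq hmn hq hα h hs
  have h2 := sum_regHess_ge hq hε M
  -- Only σ² ≤ σ² + ε is lost here.
  have h3 : ∑ i, ∑ j, regGrad q ε i j M ^ 2 ≤
      4 * q ^ 2 * ∑ k, (singularValue M k ^ 2 + ε) ^ (2 * q - 1) := by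
    rw [sum_regGrad_sq hq hε M, Finset.mul_sum]
    refine Finset.sum_le_sum fun k _ => ?_
    rw [powKer_self hq (hs k)]
    have e : (singularValue M k ^ 2 + ε) ^ (2 * q - 1) = (singularValue M k ^ 2 + ε) *
        ((singularValue M k ^ 2 + ε) ^ (q - 1)) ^ 2 := by
      rw [show 2 * q - 1 = 1 + (q - 1) + (q - 1) by ring, Real.rpow_add (hs k),
        Real.rpow_add (hs k), Real.rpow_one]
      ring
    rw [e]
    have : 0 ≤ q ^ 2 * ((singularValue M k ^ 2 + ε) ^ (q - 1)) ^ 2 := by positivity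
    nlinarith
  have h0 : 0 ≤ regPow q ε M := le_trans (by positivity) (le_regPow hq0 hε M)
  calc (α / (2 * q) + 1) * ∑ i, ∑ j, regGrad q ε i j M ^ 2
      ≤ (α / (2 * q) + 1) *
        (4 * q ^ 2 * ∑ k, (singularValue M k ^ 2 + ε) ^ (2 * q - 1)) := by gcongr
    _ = 2 * ((α + 2 * q) * q * ∑ k, (singularValue M k ^ 2 + ε) ^ (2 * q - 1)) := by
        field_simp; ring
    _ ≤ 2 * (regPow q ε M * _) := mul_le_mul_of_nonneg_left h1 two_pos.le
    _ = regPow q ε M * (2 * _) := by ring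
    _ ≤ _ := mul_le_mul_of_nonneg_left h2 h0

/-! ### The Frobenius case and the full parameter range -/

theorem sum_sq_singularValue (M : RealMat n m) :
    ∑ k, singularValue M k ^ 2 = ∑ i, ∑ j, M i j ^ 2 := by
  obtain ⟨U, hU, -, hG⟩ := exists_gram_eq M
  have h := gramRes.sum_sq_eq_trace (of M)
  rw [hG, gramRes.trace_conj hU] at h
  exact h.symm

theorem regPow_one (ε : ℝ) (M : RealMat n m) :
    regPow 1 ε M = ∑ i, ∑ j, M i j ^ 2 + m * ε := by
  simp [regPow, Finset.sum_add_distrib, sum_sq_singularValue]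

/-- The resolvent integral needs q < 1, so p = 2 is done by hand: h = ‖M‖_F² + mε has gradient 2M
and Laplacian 2nm, and the condition reduces to α + 2 ≤ nm. -/
theorem smoothSuperharmonic_regPow_one (hm : 0 < m) {α : ℝ} (hα : 0 ≤ α) (hε : 0 < ε)
    (h : α ≤ n * m - 2) :
    ∃ F1 F2 C, SmoothSuperharmonic
      (fun M : RealMat n m => regPow 1 ε M ^ (-(α / (2 * 1)))) F1 F2 C := by
  have hm' : (0 : ℝ) < m := by exact_mod_cast hm
  have hreg : (regPow 1 ε : RealMat n m → ℝ) = fun M => ∑ i, ∑ j, M i j ^ 2 + m * ε :=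
    funext (regPow_one ε)
  refine smoothSuperharmonic_rpow_neg (h1 := fun i j M => 2 * M i j) (h2 := fun i j M => 2)
    (c := m * ε ^ (1 : ℝ)) (K := 2) (by positivity) (by positivity) (by rw [hreg]; fun_prop)
    (fun i j => by fun_prop)
    (fun i j => by fun_prop) (le_regPow one_pos hε) (fun i j M => ?_) (fun i j M => ?_)
    (fun i j M => by simp) fun M => ?_
  · rw [hreg]
    unfold HasLineDerivAt
    have h1 : ∀ k l, HasDerivAt (fun t : ℝ => (M + t • matUnit i j) k l ^ 2)
        (2 * M k l * matUnit i j k l) 0 := by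
      intro k l
      have h2 : HasDerivAt (fun t : ℝ => (M + t • matUnit i j) k l) (matUnit i j k l) 0 := by
        simpa using ((hasDerivAt_id (0 : ℝ)).mul_const (matUnit i j k l)).const_add (M k l)
      simpa using h2.fun_pow 2
    have h3 := (HasDerivAt.fun_sum (u := Finset.univ) fun k _ =>
      HasDerivAt.fun_sum (u := Finset.univ) fun l _ => h1 k l).add_const (m * ε)
    convert! h3 using 1
    simp [matUnit_apply, ite_and]
  · have := HasDerivAt.const_mul (2 : ℝ) (gramRes.hasLineDerivAt_entry M i j j)
    unfold HasLineDerivAt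
    simpa using this
  · rw [regPow_one]
    have e : ∑ i, ∑ j, (2 * M i j) ^ 2 = 4 * ∑ i, ∑ j, M i j ^ 2 := by
      simp only [Finset.mul_sum]
      exact Finset.sum_congr rfl fun i _ => Finset.sum_congr rfl fun j _ => by ring
    rw [e]
    have hS : 0 ≤ ∑ i, ∑ j, M i j ^ 2 :=
      Finset.sum_nonneg fun i _ => Finset.sum_nonneg fun j _ => sq_nonneg _
    have hnm : (0 : ℝ) ≤ n * m := by positivity
    simp only [Finset.sum_const, Finset.card_univ, Fintype.card_fin, nsmul_eq_mul]
    have h4 : 0 ≤ m * ε * (n * (m * 2)) := by positivity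
    nlinarith [mul_le_mul_of_nonneg_right h hS]

/-- Superharmonicity of the regularized Schatten prior in the stated parameter range. -/
theorem smoothSuperharmonic_regPow (hmn : m ≤ n) (hm : 0 < m) {p α : ℝ} (hα : 0 ≤ α) (hε : 0 < ε)
    (hpα : (1 ≤ p ∧ p ≤ 2 ∧ α ≤ n * m - (1 - p / 2) * m * (m + 1) - p) ∨
      (0 < p ∧ p < 1 ∧ α ≤ n * m - m * (m + 1) + (m - 1) * p)) :
    ∃ F1 F2 C, SmoothSuperharmonic
      (fun M : RealMat n m => regPow (p / 2) ε M ^ (-(α / p))) F1 F2 C := by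
  have e : α / p = α / (2 * (p / 2)) := by congr 1; ring
  rw [e]
  rcases hpα with ⟨h1, h2, h3⟩ | ⟨h1, h2, h3⟩
  · rcases h2.eq_or_lt with rfl | hlt
    · have := smoothSuperharmonic_regPow_one (n := n) hm hα hε (by linarith)
      simpa using this
    · exact smoothSuperharmonic_regPow_of_lt_one hmn hm ⟨by linarith, by linarith⟩ hα hε
        (Or.inl ⟨by linarith, by linarith⟩)
  · exact smoothSuperharmonic_regPow_of_lt_one hmn hm ⟨by linarith, by linarith⟩ hα hε
      (Or.inr (by linarith))

end Superharmonic

/-! ### Generalized Bayes estimators are posterior means -/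

section BayesMinimax
open Filter Topology

variable {n m : ℕ}

/-- The bias-variance decomposition, entry by entry; only the squared bias depends on the action. -/
theorem lintegral_frobeniusLoss_eq (P : Measure (RealMat n m)) [IsProbabilityMeasure P]
    (hP : ∀ i j, MemLp (fun M : RealMat n m => M i j) 2 P) (A : RealMat n m) :
    ∫⁻ M, frobeniusLoss M A ∂P = ENNReal.ofReal
      (∑ i, ∑ j, Var[fun M : RealMat n m => M i j; P] + ∑ i, ∑ j, (A i j - ∫ M, M i j ∂P) ^ 2) := by
  have hi : ∀ i j, Integrable (fun M : RealMat n m => (A i j - M i j) ^ 2) P := fun i j =>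
    ((memLp_const (A i j)).sub (hP i j)).integrable_sq
  unfold frobeniusLoss
  rw [← ofReal_integral_eq_lintegral_ofReal
    (integrable_finsetSum _ fun i _ => integrable_finsetSum _ fun j _ => hi i j)
    (.of_forall fun X => Finset.sum_nonneg fun i _ => Finset.sum_nonneg fun j _ => sq_nonneg _)]
  congr 1
  rw [integral_finsetSum _ fun i _ => integrable_finsetSum _ fun j _ => hi i j]
  simp_rw [integral_finsetSum _ fun j _ => hi _ j, ← Finset.sum_add_distrib]
  refine Finset.sum_congr rfl fun i _ => Finset.sum_congr rfl fun j _ => ?_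
  have h1 : Integrable (fun M : RealMat n m => M i j) P := (hP i j).integrable one_le_two
  have h := variance_eq_sub (μ := P) (X := fun M : RealMat n m => A i j - M i j)
    ((memLp_const (A i j)).sub (hP i j))
  rw [variance_const_sub (hP i j).aestronglyMeasurable, integral_sub (integrable_const _) h1] at h
  simp only [integral_const, probReal_univ, one_smul, Pi.pow_apply] at h
  linarith

/-- Under squared loss the posterior expected loss is minimized exactly at the mean. -/
theorem forall_lintegral_frobeniusLoss_le_iff (P : Measure (RealMat n m)) [IsProbabilityMeasure P]
    (hP : ∀ i j, MemLp (fun M : RealMat n m => M i j) 2 P) (D : RealMat n m) :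
    (∀ A, ∫⁻ M, frobeniusLoss M D ∂P ≤ ∫⁻ M, frobeniusLoss M A ∂P) ↔
      D = fun i j => ∫ M, M i j ∂P := by
  have hV : 0 ≤ ∑ i, ∑ j, Var[fun M : RealMat n m => M i j; P] :=
    Finset.sum_nonneg fun i _ => Finset.sum_nonneg fun j _ => variance_nonneg _ _
  have hS : ∀ A : RealMat n m, 0 ≤ ∑ i, ∑ j, (A i j - ∫ M, M i j ∂P) ^ 2 := fun A =>
    Finset.sum_nonneg fun i _ => Finset.sum_nonneg fun j _ => sq_nonneg _
  simp_rw [lintegral_frobeniusLoss_eq P hP]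
  constructor
  · intro h
    have h1 := h fun i j => ∫ M, M i j ∂P
    rw [ENNReal.ofReal_le_ofReal_iff (add_nonneg hV (hS _))] at h1
    simp only [sub_self, ne_eq, OfNat.ofNat_ne_zero, not_false_eq_true, zero_pow,
      Finset.sum_const_zero, add_le_add_iff_left] at h1
    have h0 := le_antisymm h1 (hS D)
    ext i j
    rw [Finset.sum_eq_zero_iff_of_nonneg fun i _ => Finset.sum_nonneg fun j _ => sq_nonneg _] at h0
    have h2 := h0 i (Finset.mem_univ i)
    rw [Finset.sum_eq_zero_iff_of_nonneg fun j _ => sq_nonneg _] at h2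
    have h3 := h2 j (Finset.mem_univ j)
    exact sub_eq_zero.1 (pow_eq_zero_iff two_ne_zero |>.1 h3)
  · rintro rfl A
    refine ENNReal.ofReal_le_ofReal ?_
    simpa using hS A

/-- A measurable estimator of risk at most `nm` is minimax. -/
theorem isMinimax_of_risk_le {δ : RealMat n m → RealMat n m} (hδ : Measurable δ)
    (h : ∀ M, ∫⁻ X, frobeniusLoss M (δ X) ∂gaussianMatrixLaw M ≤ n * m) : IsMinimax δ := by
  refine ⟨hδ, le_antisymm ((iSup_le h).trans (le_minimaxRisk n m)) ?_⟩
  -- A nonrandomized estimator competes in the minimax infimum as a deterministic kernel.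
  refine (iInf₂_le_of_le (Kernel.deterministic δ hδ) (Kernel.isMarkovKernel_deterministic hδ) le_rfl).trans (iSup_mono fun M => ?_)
  rw [Kernel.deterministic_comp_eq_map, Kernel.map_apply _ hδ,
    lintegral_map (measurable_frobeniusLoss.of_uncurry_left) hδ]

/-- The Gaussian likelihood is symmetric in parameter and observation, so the posterior is the
Gaussian law at `X` reweighted by the prior. Only the almost-everywhere class of the prior density
matters, so values ∞ on a null set are harmless. -/
theorem posteriorLaw_withDensity {w : RealMat n m → ℝ≥0∞} (hw : Measurable w)
    {G : RealMat n m → ℝ} (hwG : w =ᵐ[volume] fun M => ENNReal.ofReal (G M)) (X : RealMat n m) :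
    posteriorLaw (volume.withDensity w) X =
      (∫⁻ M, ENNReal.ofReal (G M) ∂gaussianMatrixLaw X)⁻¹ •
        (gaussianMatrixLaw X).withDensity fun M => ENNReal.ofReal (G M) := by
  have hg : Measurable fun M : RealMat n m => gaussianMatrixDensity M X := by
    simp_rw [gaussianMatrixDensity_eq, gaussDens_comm _ X]
    exact (continuous_gaussDens X).measurable.ennreal_ofReal
  have hac : gaussianMatrixLaw X ≪ volume := by
    rw [← withDensity_gaussianMatrixDensity]; exact withDensity_absolutelyContinuous _ _
  have h : ((volume.withDensity w).withDensity fun M => gaussianMatrixDensity M X) =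
      (gaussianMatrixLaw X).withDensity fun M => ENNReal.ofReal (G M) := by
    rw [← withDensity_congr_ae (hac.ae_le hwG), ← withDensity_gaussianMatrixDensity,
      ← withDensity_mul _ hw hg, ← withDensity_mul _ hg hw, mul_comm]
  unfold posteriorLaw
  rw [h]
  congr 2
  rw [← setLIntegral_univ, ← withDensity_apply _ MeasurableSet.univ, h,
    withDensity_apply _ MeasurableSet.univ, setLIntegral_univ]

/-- If the prior has density `G` with enough moments, its only generalized Bayes estimator is the
posterior mean. -/
theorem isGeneralizedBayes_iff {w : RealMat n m → ℝ≥0∞} (hw : Measurable w)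
    {G : RealMat n m → ℝ} (hG : Measurable G) (hG0 : ∀ M, 0 ≤ G M)
    (hwG : w =ᵐ[volume] fun M => ENNReal.ofReal (G M))
    (hGi : ∀ X, Integrable G (gaussianMatrixLaw X)) (hGp : ∀ X, 0 < gaussAvg G X)
    (hG2 : ∀ X i j, Integrable (fun M => M i j ^ 2 * G M) (gaussianMatrixLaw X))
    (δ : RealMat n m → RealMat n m) :
    IsGeneralizedBayes (volume.withDensity w) δ ↔ δ = posteriorMean G := by
  have hl : ∀ X, ∫⁻ M, ENNReal.ofReal (G M) ∂gaussianMatrixLaw X =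
      ENNReal.ofReal (gaussAvg G X) := fun X =>
    (ofReal_integral_eq_lintegral_ofReal (hGi X) (.of_forall hG0)).symm
  have hprob : ∀ X, IsProbabilityMeasure (posteriorLaw (volume.withDensity w) X) := by
    intro X
    rw [posteriorLaw_withDensity hw hwG, hl]
    constructor
    rw [Measure.smul_apply, withDensity_apply _ MeasurableSet.univ, setLIntegral_univ, hl,
      smul_eq_mul, ENNReal.inv_mul_cancel (by simpa using hGp X) ENNReal.ofReal_ne_top]
  have hne : ∀ X, (ENNReal.ofReal (gaussAvg G X))⁻¹ ≠ ∞ := fun X => by simpa using hGp X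
  have hL2 : ∀ X i j, MemLp (fun M : RealMat n m => M i j) 2
      (posteriorLaw (volume.withDensity w) X) := by
    intro X i j
    rw [memLp_two_iff_integrable_sq
      (Measurable.aestronglyMeasurable (by fun_prop)), posteriorLaw_withDensity hw hwG, hl]
    refine Integrable.smul_measure ?_ (hne X)
    rw [integrable_withDensity_iff hG.ennreal_ofReal (by simp)]
    simpa [ENNReal.toReal_ofReal (hG0 _)] using hG2 X i j
  have hmean : ∀ X i j, ∫ M, M i j ∂posteriorLaw (volume.withDensity w) X =
      posteriorMean G X i j := by
    intro X i j
    rw [posteriorLaw_withDensity hw hwG, hl, integral_smul_measure,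
      integral_withDensity_eq_integral_toReal_smul hG.ennreal_ofReal (by simp)]
    simp only [ENNReal.toReal_ofReal (hG0 _), ENNReal.toReal_inv,
      ENNReal.toReal_ofReal (hGp X).le, smul_eq_mul, posteriorMean, mul_comm (G _)]
    rw [div_eq_inv_mul]
    rfl
  unfold IsGeneralizedBayes
  constructor
  · intro h
    ext1 X
    have := (forall_lintegral_frobeniusLoss_le_iff _ (hL2 X) (δ X)).1 (h X).2
    rw [this]
    ext i j
    exact hmean X i j
  · rintro rfl X
    refine ⟨hprob X, (forall_lintegral_frobeniusLoss_le_iff _ (hL2 X) _).2 ?_⟩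
    ext i j
    exact (hmean X i j).symm

/-! ### Limits of posterior means -/

theorem measurable_posteriorMean {G : RealMat n m → ℝ} (hG : Measurable G) :
    Measurable (posteriorMean G) :=
  measurable_pi_lambda _ fun i => measurable_pi_lambda _ fun j =>
    (measurable_gaussAvg (f := fun M => M i j * G M) (by fun_prop)).div (measurable_gaussAvg hG)

theorem abs_entry_le (M : RealMat n m) (i : Fin n) (j : Fin m) : |M i j| ≤ ‖M‖ :=
  (norm_le_pi_norm (M i) j).trans (norm_le_pi_norm M i)

/-- Dominated convergence in numerator and denominator; the weight 1 + ‖M‖² dominates both |M i j|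
and 1, so one majorant serves for both. -/
theorem tendsto_posteriorMean {F : ℕ → RealMat n m → ℝ} {G b : RealMat n m → ℝ} (X : RealMat n m)
    (hF : ∀ k, Measurable (F k))
    (hFb : ∀ k, ∀ᵐ M ∂gaussianMatrixLaw X, |F k M| ≤ b M)
    (hb : Integrable (fun M => b M * (1 + ‖M‖ ^ 2)) (gaussianMatrixLaw X))
    (hFG : ∀ᵐ M ∂gaussianMatrixLaw X, Tendsto (fun k => F k M) atTop (𝓝 (G M)))
    (hG : gaussAvg G X ≠ 0) :
    Tendsto (fun k => posteriorMean (F k) X) atTop (𝓝 (posteriorMean G X)) := by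
  refine tendsto_pi_nhds.2 fun i => tendsto_pi_nhds.2 fun j => Tendsto.div ?_ ?_ hG
  · refine tendsto_integral_of_dominated_convergence _
      (fun k => Measurable.aestronglyMeasurable (by fun_prop)) hb (fun k => ?_) ?_
    · filter_upwards [hFb k] with M hM
      rw [Real.norm_eq_abs, abs_mul]
      have h1 := abs_entry_le M i j
      have h2 : ‖M‖ ≤ 1 + ‖M‖ ^ 2 := by nlinarith [sq_nonneg (‖M‖ - 1)]
      rw [mul_comm]
      exact mul_le_mul hM (h1.trans h2) (abs_nonneg _) ((abs_nonneg _).trans hM)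
    · filter_upwards [hFG] with M hM using hM.const_mul _
  · refine tendsto_integral_of_dominated_convergence _
      (fun k => (hF k).aestronglyMeasurable) hb (fun k => ?_) hFG
    filter_upwards [hFb k] with M hM
    rw [Real.norm_eq_abs]
    nlinarith [abs_nonneg (F k M), sq_nonneg ‖M‖]

/-- Risk bounds pass to pointwise limits of estimators. -/
theorem risk_le_of_tendsto {δ : ℕ → RealMat n m → RealMat n m} {δ' : RealMat n m → RealMat n m}
    (hδ : ∀ k, Measurable (δ k)) (hlim : ∀ X, Tendsto (fun k => δ k X) atTop (𝓝 (δ' X)))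
    {M : RealMat n m} {r : ℝ≥0∞}
    (h : ∀ k, ∫⁻ X, frobeniusLoss M (δ k X) ∂gaussianMatrixLaw M ≤ r) :
    ∫⁻ X, frobeniusLoss M (δ' X) ∂gaussianMatrixLaw M ≤ r := by
  have hc : Continuous (frobeniusLoss M) := by
    unfold frobeniusLoss
    exact ENNReal.continuous_ofReal.comp (by fun_prop)
  calc ∫⁻ X, frobeniusLoss M (δ' X) ∂gaussianMatrixLaw M
      = ∫⁻ X, liminf (fun k => frobeniusLoss M (δ k X)) atTop ∂gaussianMatrixLaw M :=
        lintegral_congr fun X => (((hc.tendsto _).comp (hlim X)).liminf_eq).symm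
    _ ≤ liminf (fun k => ∫⁻ X, frobeniusLoss M (δ k X) ∂gaussianMatrixLaw M) atTop :=
        lintegral_liminf_le fun k => hc.measurable.comp (hδ k)
    _ ≤ r := liminf_le_of_le (by isBoundedDefault) fun b hb => by
        obtain ⟨k, hk⟩ := hb.exists
        exact hk.trans (h k)

end BayesMinimax

/-! ### The Schatten prior -/

section Schatten
open Filter Topology Set

variable {n m : ℕ} {p α : ℝ}

/-- The Schatten trace `‖M‖_p^p`. -/
noncomputable def schattenPow (p : ℝ) (M : RealMat n m) : ℝ :=
  ∑ k, singularValue M k ^ p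

theorem rpow_sum_le_sum_rpow {ι : Type*} (s : Finset ι) {x : ι → ℝ} (hx : ∀ i, 0 ≤ x i) {q : ℝ}
    (hq : 0 < q) (hq1 : q ≤ 1) : (∑ i ∈ s, x i) ^ q ≤ ∑ i ∈ s, x i ^ q := by
  classical
  induction s using Finset.induction_on with
  | empty => simp [Real.zero_rpow hq.ne']
  | insert a s ha ih =>
    rw [Finset.sum_insert ha, Finset.sum_insert ha]
    exact (Real.rpow_add_le_add_rpow (hx a) (Finset.sum_nonneg fun i _ => hx i) hq.le hq1).trans
      (by gcongr)

theorem norm_sq_le_sum_sq (M : RealMat n m) : ‖M‖ ^ 2 ≤ ∑ i, ∑ j, M i j ^ 2 := by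
  have h0 : 0 ≤ ∑ i, ∑ j, M i j ^ 2 :=
    Finset.sum_nonneg fun i _ => Finset.sum_nonneg fun j _ => sq_nonneg _
  refine (Real.le_sqrt (norm_nonneg _) h0).1 ?_
  refine (pi_norm_le_iff_of_nonneg (Real.sqrt_nonneg _)).2 fun i =>
    (pi_norm_le_iff_of_nonneg (Real.sqrt_nonneg _)).2 fun j => Real.abs_le_sqrt ?_
  calc M i j ^ 2 ≤ ∑ j, M i j ^ 2 :=
        Finset.single_le_sum (f := fun j => M i j ^ 2) (fun j _ => sq_nonneg _) (Finset.mem_univ j)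
    _ ≤ _ := Finset.single_le_sum (f := fun i => ∑ j, M i j ^ 2)
        (fun i _ => Finset.sum_nonneg fun j _ => sq_nonneg _) (Finset.mem_univ i)

/-- The norm here is the maximum of the entries, hence at most the Frobenius norm; subadditivity of
x^(p/2) for p ≤ 2 then passes from the Frobenius to the Schatten sum. -/
theorem norm_rpow_le_schattenPow (hp : 0 < p) (hp2 : p ≤ 2) (M : RealMat n m) :
    ‖M‖ ^ p ≤ schattenPow p M := by
  calc ‖M‖ ^ p = (‖M‖ ^ 2) ^ (p / 2) := by
        rw [← Real.rpow_natCast, ← Real.rpow_mul (norm_nonneg _)]; congr 1; push_cast; ring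
    _ ≤ (∑ k, singularValue M k ^ 2) ^ (p / 2) := by
        rw [sum_sq_singularValue]
        exact Real.rpow_le_rpow (by positivity) (norm_sq_le_sum_sq M) (by positivity)
    _ ≤ ∑ k, (singularValue M k ^ 2) ^ (p / 2) :=
        rpow_sum_le_sum_rpow _ (fun k => sq_nonneg _) (by positivity) (by linarith)
    _ = schattenPow p M := Finset.sum_congr rfl fun k _ => by
        rw [← Real.rpow_natCast, ← Real.rpow_mul (singularValue_nonneg M k)]
        congr 1; push_cast; ring

theorem schattenPow_le_regPow (hp : 0 < p) {ε : ℝ} (hε : 0 < ε) (M : RealMat n m) :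
    schattenPow p M ≤ regPow (p / 2) ε M := by
  refine Finset.sum_le_sum fun k _ => ?_
  calc singularValue M k ^ p = (singularValue M k ^ 2) ^ (p / 2) := by
        rw [← Real.rpow_natCast, ← Real.rpow_mul (singularValue_nonneg M k)]
        congr 1; push_cast; ring
    _ ≤ _ := Real.rpow_le_rpow (by positivity) (by linarith) (by positivity)

theorem schattenPow_pos (hp : 0 < p) (hp2 : p ≤ 2) {M : RealMat n m} (hM : M ≠ 0) :
    0 < schattenPow p M :=
  (Real.rpow_pos_of_pos (norm_pos_iff.2 hM) p).trans_le (norm_rpow_le_schattenPow hp hp2 M)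

theorem schattenPow_nonneg (p : ℝ) (M : RealMat n m) : 0 ≤ schattenPow p M :=
  Finset.sum_nonneg fun k _ => Real.rpow_nonneg (singularValue_nonneg M k) p

theorem tendsto_regPow (hp : 0 < p) (M : RealMat n m) :
    Tendsto (fun k : ℕ => regPow (p / 2) (1 / ((k : ℝ) + 1)) M) atTop (𝓝 (schattenPow p M)) := by
  refine tendsto_finsetSum _ fun i _ => ?_
  have h : singularValue M i ^ p = (singularValue M i ^ 2 + 0) ^ (p / 2) := by
    rw [add_zero, ← Real.rpow_natCast, ← Real.rpow_mul (singularValue_nonneg M i)]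
    congr 1; push_cast; ring
  rw [h]
  exact (tendsto_one_div_add_atTop_nhds_zero_nat.const_add _).rpow_const (Or.inr (by positivity))

theorem measurable_regPow_of_le_two (hp : 0 < p) (hp2 : p ≤ 2) {ε : ℝ} (hε : 0 < ε) :
    Measurable (regPow (p / 2) ε : RealMat n m → ℝ) := by
  rcases hp2.eq_or_lt with rfl | h
  · have hreg : (regPow (2 / 2) ε : RealMat n m → ℝ) = fun M => ∑ i, ∑ j, M i j ^ 2 + m * ε := by
      ext M; rw [div_self two_ne_zero, regPow_one]
    rw [hreg]; fun_prop
  · exact measurable_regPow ⟨by positivity, by linarith⟩ hε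

theorem measurable_schattenPow (hp : 0 < p) (hp2 : p ≤ 2) :
    Measurable (schattenPow p : RealMat n m → ℝ) :=
  measurable_of_tendsto_metrizable
    (fun k : ℕ => measurable_regPow_of_le_two (n := n) (m := m) hp hp2
      (ε := 1 / ((k : ℝ) + 1)) (by positivity))
    (tendsto_pi_nhds.2 fun M => tendsto_regPow hp M)

theorem rpow_neg_div_le_norm_rpow (hp : 0 < p) (hα : 0 ≤ α) {M : RealMat n m} (hM : M ≠ 0) {x : ℝ}
    (hx : ‖M‖ ^ p ≤ x) : x ^ (-(α / p)) ≤ ‖M‖ ^ (-α) := by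
  have h := Real.rpow_le_rpow_of_nonpos (Real.rpow_pos_of_pos (norm_pos_iff.2 hM) p) hx
    (neg_nonpos.2 (div_nonneg hα hp.le))
  rw [← Real.rpow_mul (norm_nonneg _)] at h
  rwa [show p * -(α / p) = -α by field_simp] at h

/-! ### Integrability of the dominating function -/

theorem ae_ne_zero (hn : 0 < n) (hm : 0 < m) :
    ∀ᵐ M : RealMat n m, M ≠ 0 := by
  have : Nonempty (Fin n) := ⟨⟨0, hn⟩⟩
  have : Nonempty (Fin m) := ⟨⟨0, hm⟩⟩
  exact Measure.ae_ne volume 0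

theorem gaussianMatrixLaw_absolutelyContinuous (X : RealMat n m) :
    gaussianMatrixLaw X ≪ volume := by
  rw [← withDensity_gaussianMatrixDensity]; exact withDensity_absolutelyContinuous _ _

/-- In polar coordinates for the given norm the radial integrand is y^(nm-1-α), integrable at 0
because α < nm. -/
theorem integrableOn_norm_rpow_neg (hn : 0 < n) (hm : 0 < m) (hα : α < n * m) :
    IntegrableOn (fun M : RealMat n m => ‖M‖ ^ (-α)) (Metric.ball 0 1) := by
  have : Nonempty (Fin n) := ⟨⟨0, hn⟩⟩
  have : Nonempty (Fin m) := ⟨⟨0, hm⟩⟩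
  have hd : Module.finrank ℝ (RealMat n m) = n * m := by
    simp [RealMat, Module.finrank_pi_fintype]
  rw [integrableOn_fun_norm_addHaar volume (f := fun y => y ^ (-α)), hd]
  have hpos : 1 ≤ n * m := Nat.mul_pos hn hm
  have : IntegrableOn (fun y : ℝ => y ^ ((n * m : ℝ) - 1 - α)) (Ioo 0 1) :=
    (intervalIntegral.integrableOn_Ioo_rpow_iff one_pos).2 (by linarith)
  refine this.congr_fun (fun y hy => ?_) measurableSet_Ioo
  simp only [smul_eq_mul]
  rw [← Real.rpow_natCast, ← Real.rpow_add hy.1]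
  congr 1; push_cast [Nat.cast_sub hpos]; ring

theorem integrable_norm_sq (X : RealMat n m) :
    Integrable (fun M => 1 + ‖M‖ ^ 2) (gaussianMatrixLaw X) := by
  have h : Integrable (fun M => ∑ i, ∑ j, M i j ^ 2) (gaussianMatrixLaw X) :=
    integrable_finsetSum _ fun i _ => integrable_finsetSum _ fun j _ =>
      (memLp_entry X i j 2).integrable_sq
  refine (integrable_const 1).add (h.mono' (by fun_prop) (.of_forall fun M => ?_))
  rw [Real.norm_of_nonneg (by positivity)]
  exact norm_sq_le_sum_sq M

theorem gaussDens_le (X M : RealMat n m) : gaussDens X M ≤ gaussDens (0 : RealMat n m) 0 := by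
  unfold gaussDens
  refine Finset.prod_le_prod (fun i _ => Finset.prod_nonneg fun j _ => gaussianPDFReal_nonneg _ _ _)
    fun i _ => Finset.prod_le_prod (fun j _ => gaussianPDFReal_nonneg _ _ _) fun j _ => ?_
  simp only [gaussianPDFReal]
  refine mul_le_mul_of_nonneg_left (Real.exp_le_exp.2 ?_) (by positivity)
  have h : -(M i j - X i j) ^ 2 / (2 * ((1 : NNReal) : ℝ)) ≤ 0 :=
    div_nonpos_of_nonpos_of_nonneg (neg_nonpos.2 (sq_nonneg _)) (by positivity)
  simpa using h

/-- Inside the unit ball the Gaussian density is bounded and the singularity is locally integrable;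
outside it ‖M‖^(-α) ≤ 1 and Gaussian second moments suffice. -/
theorem integrable_norm_rpow_neg_mul (hn : 0 < n) (hm : 0 < m) (hα : 0 ≤ α) (hαn : α < n * m)
    (X : RealMat n m) :
    Integrable (fun M => ‖M‖ ^ (-α) * (1 + ‖M‖ ^ 2)) (gaussianMatrixLaw X) := by
  have hmeas : Measurable fun M : RealMat n m => ‖M‖ ^ (-α) * (1 + ‖M‖ ^ 2) := by fun_prop
  rw [← integrableOn_univ, ← union_compl_self (Metric.ball (0 : RealMat n m) 1)]
  refine IntegrableOn.union ?_ ?_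
  · have hb := (integrableOn_norm_rpow_neg hn hm hαn).const_mul
      (2 * gaussDens (0 : RealMat n m) 0)
    have hs : MeasurableSet (Metric.ball (0 : RealMat n m) 1) := Metric.isOpen_ball.measurableSet
    rw [← integrable_indicator_iff hs, integrable_gaussianMatrixLaw_iff]
    replace hb := (integrable_indicator_iff hs).2 hb
    refine hb.mono' (((continuous_gaussDens X).measurable.mul
      (hmeas.indicator hs)).aestronglyMeasurable) (.of_forall fun M => ?_)
    by_cases hM : M ∈ Metric.ball (0 : RealMat n m) 1
    · simp only [indicator_of_mem hM]
      have h1 : ‖M‖ < 1 := by simpa using hM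
      have h2 : 0 ≤ ‖M‖ ^ (-α) := Real.rpow_nonneg (norm_nonneg _) _
      have h3 : 1 + ‖M‖ ^ 2 ≤ 2 := by nlinarith [norm_nonneg M]
      rw [Real.norm_of_nonneg (mul_nonneg (gaussDens_pos _ _).le (by positivity))]
      calc gaussDens X M * (‖M‖ ^ (-α) * (1 + ‖M‖ ^ 2))
          ≤ gaussDens (0 : RealMat n m) 0 * (‖M‖ ^ (-α) * 2) := by
            gcongr
            · exact (gaussDens_pos _ _).le
            · exact gaussDens_le X M
        _ = _ := by ring
    · simp [indicator_of_notMem hM]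
  · refine (integrable_norm_sq X).integrableOn.mono' hmeas.aestronglyMeasurable ?_
    refine (ae_restrict_iff' Metric.isOpen_ball.measurableSet.compl).2 (.of_forall fun M hM => ?_)
    have h1 : 1 ≤ ‖M‖ := by simpa using hM
    have h2 : ‖M‖ ^ (-α) ≤ 1 := Real.rpow_le_one_of_one_le_of_nonpos h1 (by linarith)
    rw [Real.norm_of_nonneg (by positivity)]
    exact mul_le_of_le_one_left (by positivity) h2

/-- The origin must be excluded: for α > 0 the extended density is ∞ there, while the real power
takes the default value 0. -/
theorem schattenPrior_density_eq (hp : 0 < p) (hp2 : p ≤ 2) {M : RealMat n m} (hM : M ≠ 0) :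
    ENNReal.ofReal (schattenNorm p M) ^ (-α) =
      ENNReal.ofReal (schattenPow p M ^ (-(α / p))) := by
  have hS := schattenPow_pos hp hp2 hM
  have h : schattenNorm p M = schattenPow p M ^ (1 / p) := rfl
  rw [h, ENNReal.ofReal_rpow_of_pos (Real.rpow_pos_of_pos hS _), ← Real.rpow_mul hS.le]
  congr 2
  ring

theorem measurable_schattenPrior_density (hp : 0 < p) (hp2 : p ≤ 2) :
    Measurable fun M : RealMat n m => ENNReal.ofReal (schattenNorm p M) ^ (-α) :=
  ((measurable_schattenPow hp hp2).pow_const (1 / p)).ennreal_ofReal.pow_const (-α)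

end Schatten

theorem mainTheorem4 (n m : ℕ) (hmn : m ≤ n) (p α : ℝ) (hα : 0 ≤ α)
    (hpα : (1 ≤ p ∧ p ≤ 2 ∧ α ≤ n * m - (1 - p / 2) * m * (m + 1) - p) ∨
      (0 < p ∧ p < 1 ∧ α ≤ n * m - m * (m + 1) + (m - 1) * p)) :
    (∃! δ : RealMat n m → RealMat n m, IsGeneralizedBayes (schattenPrior n m p α) δ) ∧
      ∀ δ : RealMat n m → RealMat n m,
        IsGeneralizedBayes (schattenPrior n m p α) δ → IsMinimax δ := by
  have hp : 0 < p := by rcases hpα with h | h <;> linarith [h.1]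
  have hp2 : p ≤ 2 := by rcases hpα with h | h <;> linarith [h.2.1]
  -- For m = 0 both ranges would give α ≤ -p < 0.
  have hm : 0 < m := by
    rcases Nat.eq_zero_or_pos m with rfl | h
    · norm_num at hpα
      rcases hpα with h | h <;> linarith
    · exact h
  have hn : 0 < n := hm.trans_le hmn
  have hm1 : (1 : ℝ) ≤ m := by exact_mod_cast hm
  have hαn : α < n * m := by
    rcases hpα with ⟨h1, h2, h3⟩ | ⟨h1, h2, h3⟩
    · have : 0 ≤ (1 - p / 2) * m * (m + 1) := by
        have : 0 ≤ 1 - p / 2 := by linarith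
        positivity
      linarith
    · nlinarith
  set G : RealMat n m → ℝ := fun M => schattenPow p M ^ (-(α / p))
  -- The regularization parameter ε = 1/(k+1) is positive and tends to 0.
  set F : ℕ → RealMat n m → ℝ := fun k M => regPow (p / 2) (1 / ((k : ℝ) + 1)) M ^ (-(α / p))
  have hG0 : ∀ M, 0 ≤ G M := fun M => Real.rpow_nonneg (schattenPow_nonneg p M) _
  have hGm : Measurable G := (measurable_schattenPow hp hp2).pow_const _
  have hne : ∀ X : RealMat n m, ∀ᵐ M ∂gaussianMatrixLaw X, M ≠ 0 := fun X =>
    (gaussianMatrixLaw_absolutelyContinuous X).ae_le (ae_ne_zero hn hm)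
  have hGb : ∀ M, M ≠ 0 → G M ≤ ‖M‖ ^ (-α) := fun M hM =>
    rpow_neg_div_le_norm_rpow hp hα hM (norm_rpow_le_schattenPow hp hp2 M)
  have hb := integrable_norm_rpow_neg_mul (n := n) (m := m) hn hm hα hαn
  have hGi : ∀ X, Integrable G (gaussianMatrixLaw X) := by
    refine fun X => (hb X).mono' hGm.aestronglyMeasurable ?_
    filter_upwards [hne X] with M hM
    rw [Real.norm_of_nonneg (hG0 M)]
    nlinarith [hGb M hM, hG0 M, sq_nonneg ‖M‖]
  have hG2 : ∀ X i j, Integrable (fun M => M i j ^ 2 * G M) (gaussianMatrixLaw X) := by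
    refine fun X i j => (hb X).mono' (Measurable.aestronglyMeasurable (by fun_prop)) ?_
    filter_upwards [hne X] with M hM
    rw [Real.norm_of_nonneg (mul_nonneg (sq_nonneg _) (hG0 M)), mul_comm]
    refine mul_le_mul (hGb M hM) ?_ (sq_nonneg _) ((hG0 M).trans (hGb M hM))
    nlinarith [sq_le_sq' (neg_le_of_abs_le (abs_entry_le M i j)) (le_of_abs_le (abs_entry_le M i j))]
  have hGp : ∀ X, 0 < gaussAvg G X := by
    refine fun X => (integral_pos_iff_support_of_nonneg hG0 (hGi X)).2 ?_
    have : (Function.support G : Set (RealMat n m)) =ᵐ[gaussianMatrixLaw X] Set.univ := by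
      refine Filter.eventuallyEq_univ.2 ?_
      filter_upwards [hne X] with M hM
      exact (Real.rpow_pos_of_pos (schattenPow_pos hp hp2 hM) _).ne'
    rw [measure_congr this, measure_univ]
    exact one_pos
  have hiff : ∀ δ, IsGeneralizedBayes (schattenPrior n m p α) δ ↔ δ = posteriorMean G := by
    refine isGeneralizedBayes_iff (measurable_schattenPrior_density hp hp2) hGm hG0 ?_ hGi hGp hG2
    filter_upwards [ae_ne_zero hn hm] with M hM using schattenPrior_density_eq hp hp2 hM
  have hFm : ∀ k, Measurable (F k) := fun k =>
    (measurable_regPow_of_le_two hp hp2 (by positivity)).pow_const _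
  have hlim : ∀ X, Filter.Tendsto (fun k => posteriorMean (F k) X) Filter.atTop
      (nhds (posteriorMean G X)) := by
    refine fun X => tendsto_posteriorMean X hFm (fun k => ?_) (hb X) ?_ (hGp X).ne'
    · filter_upwards [hne X] with M hM
      have h := (norm_rpow_le_schattenPow hp hp2 M).trans
        (schattenPow_le_regPow hp (ε := 1 / ((k : ℝ) + 1)) (by positivity) M)
      rw [abs_of_nonneg (Real.rpow_nonneg ((Real.rpow_nonneg (norm_nonneg _) _).trans h) _)]
      exact rpow_neg_div_le_norm_rpow hp hα hM h
    · filter_upwards [hne X] with M hM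
      exact (tendsto_regPow hp M).rpow_const (Or.inl (schattenPow_pos hp hp2 hM).ne')
  refine ⟨⟨posteriorMean G, (hiff _).2 rfl, fun δ hδ => (hiff δ).1 hδ⟩, fun δ hδ => ?_⟩
  rw [(hiff δ).1 hδ]
  refine isMinimax_of_risk_le (measurable_posteriorMean hGm) fun M =>
    risk_le_of_tendsto (fun k => measurable_posteriorMean (hFm k)) hlim fun k => ?_
  obtain ⟨F1, F2, C, h⟩ := smoothSuperharmonic_regPow (n := n) hmn hm hα
    (ε := 1 / ((k : ℝ) + 1)) (by positivity) hpα
  exact h.risk_le M
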